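/- **Setting.** Let $q,p,m,l\ge 0$ be integers and consider the linear system $$x_{t+1}=Ax_t+Bu_t+Cw_t,\qquad t=0,1,2,\dots,$$ with states $x_t\in\mathbb R^q$, controls $u_t\in\mathbb R^p$, real matrices $A,B,C$ of sizes $q\times q$, $q\times p$, $q\times m$, a known initial state $x_0=x$, and independent Gaussian vectors $w_t\in\mathbb R^m$ with mean zero and covariance matrix $\Sigma_S$. Let $0<\beta<1$, $O\ge 0$, $Q=J'J$ with a real $l\times q$ matrix $J$, and let $R$ be symmetric positive definite (a prime denotes the transpose). Assume that $C\Sigma_SC'$ is positive definite, that $(A,B)$ is controllable, and that $(A,J)$ is observable. A strategy $\pi\in\Pi$ decides at each time $t$, as a measurable function of $x_0$ and of the earlier indicators, controls and observations, whether to measure ($i_t=1$) or not ($i_t=0$), receives $y_t=i_tx_t$, and then chooses $u_t$ as a measurable function of $x_0$, the earlier data, $i_t$ and $y_t$. Its cost is $F(\pi;x)=\mathbb E\sum_{t\ge0}\beta^t(x_t'Qx_t+u_t'Ru_t+i_tO)\in[0,\infty]$. A strategy $\tilde\pi\in\tilde\Pi$ is a measurable map that assigns to the state seen at a measurement time (time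 $0$ counts as one) the waiting time $T\in\{1,2,\dots\}\cup\{\infty\}$ until the next measurement and the controls applied until then. If $\bar T_1<\bar T_2<\cdots$ are the resulting measurement times after time $0$ (and $\bar T_k=\infty$ if there are fewer than $k$ of them, with $\beta^\infty=0$), its cost is $\tilde F(\tilde\pi;x)=\mathbb E\big[\sum_{t\ge0}\beta^t(x_t'Qx_t+u_t'Ru_t)+\sum_{k\ge1}\beta^{\bar T_k}O\big]$. We say that the waiting time $T\in\{1,2,\dots\}\cup\{\infty\}$ is optimal if there is a strategy in $\Pi$ that measures exactly at the times $T,2T,3T,\dots$ (never, if $T=\infty$) and minimizes $F(\cdot\,;x)$ over $\Pi$ for every $x$, and there is a strategy in $\tilde\Pi$ with constant waiting time $T$ that minimizes $\tilde F(\cdot\,;x)$ over $\tilde\Pi$ for every $x$. **Theorem.** The algebraic Riccati equation $$P=Q+\beta A'PA-A'PB\beta(R+\beta B'PB)^{-1}\beta B'PA$$ has exactly one symmetric positive semidefinite solution $P$, and this $P$ is positive definite. Put $\varphi=A'PB\beta(R+\beta B'PB)^{-1}\beta B'PA$, let $P_0=0$, $P_{t+1}=AP_tA'+C\Sigma_SC'$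 (the covariance of the estimation error $t$ steps after a measurement), and let $$S_n=\sum_{t=0}^{n-1}\frac{1-\beta^{t+1}}{1-\beta}\,\mathrm{Tr}\big(A^tC\Sigma_SC'(A')^t\varphi\big),\qquad n\ge0 .$$ The fixed-point equation $$r=\inf_{T\ge1}\Big\{\sum_{t=0}^{T-1}\beta^t\,\mathrm{Tr}(P_t\varphi)+\sum_{t=1}^{T}\beta^t\,\mathrm{Tr}(\Sigma_SC'PC)+\beta^T(r+O)\Big\}\qquad(T\in\mathbb N)$$ has exactly one real solution $r$, and the value function is $$V(x)=\inf_{\pi\in\Pi}F(\pi;x)=\inf_{\tilde\pi\in\tilde\Pi}\tilde F(\tilde\pi;x)=x'Px+r<\infty\qquad(x\in\mathbb R^q).$$ There is exactly one $T^*\in\{1,2,\dots\}\cup\{\infty\}$ such that $S_{T^*-1}\le O<S_{T^*}$ if $T^*<\infty$, and $S_n\le O$ for all $n$ if $T^*=\infty$. The waiting time $T^*$ is optimal. Moreover: 1. If $O<\mathrm{Tr}(C\Sigma_SC'\varphi)$, then the waiting time $1$ (measuring at every step) is optimal, $r=\frac{\beta}{1-\beta}\mathrm{Tr}(\Sigma_SC'PC)+\frac{\beta}{1-\beta}O$,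 and $V(x)=x'Px+\frac{\beta}{1-\beta}\mathrm{Tr}(\Sigma_SC'PC)+\frac{\beta}{1-\beta}O$. 2. If a finite $T^*\ge1$ satisfies $$\sum_{t=0}^{T^*-2}\frac{1-\beta^{t+1}}{1-\beta}\mathrm{Tr}\big(A^tC\Sigma_SC'(A')^t\varphi\big)\le O<\sum_{t=0}^{T^*-1}\frac{1-\beta^{t+1}}{1-\beta}\mathrm{Tr}\big(A^tC\Sigma_SC'(A')^t\varphi\big),$$ then the waiting time $T^*$ is optimal, $$r=\frac{\sum_{t=0}^{T^*-1}\beta^t\,\mathrm{Tr}(P_t\varphi)}{1-\beta^{T^*}}+\frac{\beta}{1-\beta}\mathrm{Tr}(\Sigma_SC'PC)+\frac{\beta^{T^*}}{1-\beta^{T^*}}O,$$ and $V(x)=x'Px+r$ with this $r$. 3. If $A$ is stable (all its eigenvalues have modulus less than $1$), then the Lyapunov equation $W_\infty-AW_\infty A'=C\Sigma_SC'$ has exactly one solution $W_\infty$, and $\sum_{t\ge0}\beta^t\mathrm{Tr}(P_t\varphi)$ converges. If in addition $$O\ge\frac{\mathrm{Tr}(W_\infty\varphi)}{1-\beta}-\sum_{t=0}^\infty\beta^t\,\mathrm{Tr}(P_t\varphi),$$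 then it is optimal never to measure ($T^*=\infty$), $r=\sum_{t=0}^\infty\beta^t\mathrm{Tr}(P_t\varphi)+\frac{\beta}{1-\beta}\mathrm{Tr}(\Sigma_SC'PC)$, and $V(x)=x'Px+r$ with this $r$. Otherwise there is a finite $T^*$ as in 2. If $A$ is not stable and $\varphi$ is positive definite, then there is always a finite $T^*$ as in 2. -/

import Mathlib

open MeasureTheory ProbabilityTheory Matrix
open scoped ENNReal

namespace CostlyLQG

/-- The data of an LQG problem with costly measurements: dynamics
`x_{t+1} = A x_t + B u_t + C w_t`, stage cost `x' Q x + u' R u + i O`, discount factor `β`,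
covariance matrix `S` of the noise. The standing assumptions are `StandingAssumptions` below. -/
structure Data (q p m : ℕ) where
  A : Matrix (Fin q) (Fin q) ℝ
  B : Matrix (Fin q) (Fin p) ℝ
  C : Matrix (Fin q) (Fin m) ℝ
  Q : Matrix (Fin q) (Fin q) ℝ
  R : Matrix (Fin p) (Fin p) ℝ
  S : Matrix (Fin m) (Fin m) ℝ
  β : ℝ
  O : ℝ

/-- `β ∈ (0,1)`, `O ≥ 0`, `Q` symmetric positive semidefinite, `R` symmetric positive definite,
and the covariance `C S C'` of the state noise `C w_t` positive definite. -/
structure StandingAssumptions {q p m : ℕ} (D : Data q p m) : Prop where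
  beta_pos : 0 < D.β
  beta_lt_one : D.β < 1
  O_nonneg : 0 ≤ D.O
  Q_posSemidef : D.Q.PosSemidef
  R_posDef : D.R.PosDef
  noise_posDef : (D.C * D.S * D.Cᵀ).PosDef

/-- Kalman's rank condition `rank [B, AB, …, A^{q-1} B] = q`. -/
def Controllable {q p : ℕ} (A : Matrix (Fin q) (Fin q) ℝ) (B : Matrix (Fin q) (Fin p) ℝ) : Prop :=
  (Matrix.of fun (i : Fin q) (k : Fin q × Fin p) => (A ^ (k.1 : ℕ) * B) i k.2).rank = q

/-- Kalman's rank condition `rank [J; JA; …; J A^{q-1}] = q`. -/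
def Observable {q l : ℕ} (A : Matrix (Fin q) (Fin q) ℝ) (J : Matrix (Fin l) (Fin q) ℝ) : Prop :=
  (Matrix.of fun (k : Fin q × Fin l) (j : Fin q) => (J * A ^ (k.1 : ℕ)) k.2 j).rank = q

/-- Schur stability: all complex eigenvalues have modulus smaller than one. -/
def Stable {q : ℕ} (A : Matrix (Fin q) (Fin q) ℝ) : Prop :=
  ∀ z ∈ spectrum ℂ (A.map (fun a : ℝ => (a : ℂ))), ‖z‖ < 1

/-- `w` is a sequence of independent Gaussian vectors with mean zero and covariance matrix `S`. -/
structure IsGaussianWhiteNoise {m : ℕ} {Ω : Type*} [MeasurableSpace Ω] (Pr : Measure Ω)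
    (S : Matrix (Fin m) (Fin m) ℝ) (w : ℕ → Ω → (Fin m → ℝ)) : Prop where
  measurable : ∀ t, Measurable (w t)
  indep : iIndepFun w Pr
  gaussian : ∀ t, IsGaussian (Pr.map (w t))
  mean_zero : ∀ t i, ∫ ω, w t ω i ∂Pr = 0
  cov : ∀ t i j, ∫ ω, w t ω i * w t ω j ∂Pr = S i j

/-! ### Strategies that decide at every time step whether to measure -/

/-- What the controller records at one time step: the indicator `i`, the control `u`, and the
observation `y = i x` (which is zero if no measurement is made). -/
abbrev Record (q p : ℕ) : Type := Bool × (Fin p → ℝ) × (Fin q → ℝ)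

/-- A strategy `(μ, ν)`. The decision `i_t` is a measurable function of `x_0` and of the records
of times `0, …, t-1`; the control `u_t` may depend, in addition, on `i_t` and on `y_t`. -/
structure Policy (q p : ℕ) where
  measure : (t : ℕ) → (Fin q → ℝ) → (Fin t → Record q p) → Bool
  control : (t : ℕ) → (Fin q → ℝ) → (Fin t → Record q p) → Bool → (Fin q → ℝ) → (Fin p → ℝ)
  measurable_measure : ∀ t, Measurable fun a : (Fin q → ℝ) × (Fin t → Record q p) =>
    measure t a.1 a.2
  measurable_control : ∀ t, Measurable
    fun a : (Fin q → ℝ) × (Fin t → Record q p) × Bool × (Fin q → ℝ) =>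
      control t a.1 a.2.1 a.2.2.1 a.2.2.2

section Dynamics

variable {q p m : ℕ} (D : Data q p m)

/-- One step `A x + B u + C w` of the dynamics. -/
def step (x : Fin q → ℝ) (u : Fin p → ℝ) (w : Fin m → ℝ) : Fin q → ℝ :=
  D.A *ᵥ x + D.B *ᵥ u + D.C *ᵥ w

namespace Policy

variable (π : Policy q p) (x₀ : Fin q → ℝ)

/-- The record made at time `t` when the history is `h` and the true state is `x`. -/
def nextRecord (t : ℕ) (h : Fin t → Record q p) (x : Fin q → ℝ) : Record q p :=
  let i : Bool := π.measure t x₀ h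
  let y : Fin q → ℝ := if i then x else 0
  (i, π.control t x₀ h i y, y)

/-- The history before time `t` and the state at time `t`, along the noise path `w`. -/
def run (w : ℕ → Fin m → ℝ) : (t : ℕ) → (Fin t → Record q p) × (Fin q → ℝ)
  | 0 => (Fin.elim0, x₀)
  | t + 1 =>
    let s := run w t
    let e := π.nextRecord x₀ t s.1 s.2
    (Fin.snoc (α := fun _ => Record q p) s.1 e, step D s.2 e.2.1 (w t))

/-- The state `x_t`. -/
def state (w : ℕ → Fin m → ℝ) (t : ℕ) : Fin q → ℝ := (π.run D x₀ w t).2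

/-- The measurement indicator `i_t`. -/
def indicator (w : ℕ → Fin m → ℝ) (t : ℕ) : Bool :=
  (π.nextRecord x₀ t (π.run D x₀ w t).1 (π.run D x₀ w t).2).1

/-- The control `u_t`. -/
def input (w : ℕ → Fin m → ℝ) (t : ℕ) : Fin p → ℝ :=
  (π.nextRecord x₀ t (π.run D x₀ w t).1 (π.run D x₀ w t).2).2.1

/-- The expected cost `F(π; x₀) = E ∑ₜ βᵗ (x_t' Q x_t + u_t' R u_t + i_t O)`, in `[0, ∞]`;
under the standing assumptions all the terms are nonnegative. -/
noncomputable def cost {Ω : Type*} [MeasurableSpace Ω] (Pr : Measure Ω)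
    (w : ℕ → Ω → (Fin m → ℝ)) : ℝ≥0∞ :=
  ∫⁻ ω, ∑' t : ℕ, ENNReal.ofReal (D.β ^ t *
    (π.state D x₀ (fun s => w s ω) t ⬝ᵥ D.Q *ᵥ π.state D x₀ (fun s => w s ω) t
      + π.input D x₀ (fun s => w s ω) t ⬝ᵥ D.R *ᵥ π.input D x₀ (fun s => w s ω) t
      + if π.indicator D x₀ (fun s => w s ω) t then D.O else 0)) ∂Pr

end Policy

end Dynamics

/-- The optimal cost over all strategies that decide at every step whether to measure. -/
noncomputable def value {q p m : ℕ} (D : Data q p m) {Ω : Type*} [MeasurableSpace Ω]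
    (Pr : Measure Ω) (w : ℕ → Ω → (Fin m → ℝ)) (x : Fin q → ℝ) : ℝ≥0∞ :=
  ⨅ π : Policy q p, π.cost D x Pr w

/-! ### Strategies that choose, at each measurement, the next waiting time and the controls -/

/-- A stationary strategy that assigns to a measured state `z` the waiting time
`T ∈ {1, 2, …} ∪ {∞}` until the next measurement and the controls `u_0, …, u_{T-1}` applied in
between (`control z n` is used for `n < T` only). -/
structure LookaheadPolicy (q p : ℕ) where
  wait : (Fin q → ℝ) → ℕ∞
  control : (Fin q → ℝ) → ℕ → (Fin p → ℝ)
  one_le_wait : ∀ z, 1 ≤ wait z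
  measurable_wait : Measurable wait
  measurable_control : Measurable control

section LookaheadDynamics

variable {q p m : ℕ} (D : Data q p m)

namespace LookaheadPolicy

variable (σ : LookaheadPolicy q p) (x₀ : Fin q → ℝ)

/-- The triple (state `x_t`, last measured state, number of steps since the last measurement).
The initial state is known, so that it counts as measured at time `0`. -/
def run (w : ℕ → Fin m → ℝ) : ℕ → (Fin q → ℝ) × (Fin q → ℝ) × ℕ
  | 0 => (x₀, x₀, 0)
  | t + 1 =>
    let s := run w t
    let x' := step D s.1 (σ.control s.2.1 s.2.2) (w t)
    if ((s.2.2 + 1 : ℕ) : ℕ∞) = σ.wait s.2.1 then (x', x', 0) else (x', s.2.1, s.2.2 + 1)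

/-- The state `x_t`. -/
def state (w : ℕ → Fin m → ℝ) (t : ℕ) : Fin q → ℝ := (σ.run D x₀ w t).1

/-- The control `u_t`. -/
def input (w : ℕ → Fin m → ℝ) (t : ℕ) : Fin p → ℝ :=
  σ.control (σ.run D x₀ w t).2.1 (σ.run D x₀ w t).2.2

/-- The time `T̄_k` of the `k`-th measurement, `∞` if there are fewer than `k` measurements:
`T̄_0 = 0` and `T̄_{k+1} = T̄_k + T(x_{T̄_k})`. -/
def measurementTime (w : ℕ → Fin m → ℝ) : ℕ → ℕ∞
  | 0 => 0
  | k + 1 => measurementTime w k + σ.wait (σ.state D x₀ w (measurementTime w k).toNat)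

/-- The expected cost `E [∑ₜ βᵗ (x_t' Q x_t + u_t' R u_t) + ∑_{k ≥ 1} β^{T̄_k} O]`, in `[0, ∞]`,
where `β^∞ = 0`. -/
noncomputable def cost {Ω : Type*} [MeasurableSpace Ω] (Pr : Measure Ω)
    (w : ℕ → Ω → (Fin m → ℝ)) : ℝ≥0∞ :=
  ∫⁻ ω, (∑' t : ℕ, ENNReal.ofReal (D.β ^ t *
      (σ.state D x₀ (fun s => w s ω) t ⬝ᵥ D.Q *ᵥ σ.state D x₀ (fun s => w s ω) t
        + σ.input D x₀ (fun s => w s ω) t ⬝ᵥ D.R *ᵥ σ.input D x₀ (fun s => w s ω) t))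
    + ∑' k : ℕ, if σ.measurementTime D x₀ (fun s => w s ω) (k + 1) = ⊤ then 0
        else ENNReal.ofReal
          (D.β ^ (σ.measurementTime D x₀ (fun s => w s ω) (k + 1)).toNat * D.O)) ∂Pr

end LookaheadPolicy

end LookaheadDynamics

/-- The optimal cost over all stationary strategies of the second kind. -/
noncomputable def lookaheadValue {q p m : ℕ} (D : Data q p m) {Ω : Type*} [MeasurableSpace Ω]
    (Pr : Measure Ω) (w : ℕ → Ω → (Fin m → ℝ)) (x : Fin q → ℝ) : ℝ≥0∞ :=
  ⨅ σ : LookaheadPolicy q p, σ.cost D x Pr w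

/-- The value function (the common optimal cost over both strategy spaces) is finite and
equal to `f`. -/
def IsValueFunction {q p m : ℕ} (D : Data q p m) {Ω : Type*} [MeasurableSpace Ω]
    (Pr : Measure Ω) (w : ℕ → Ω → (Fin m → ℝ)) (f : (Fin q → ℝ) → ℝ) : Prop :=
  ∀ x, (value D Pr w x ≠ ⊤ ∧ (value D Pr w x).toReal = f x) ∧
    (lookaheadValue D Pr w x ≠ ⊤ ∧ (lookaheadValue D Pr w x).toReal = f x)

/-- It is optimal to measure exactly at the times `T, 2T, 3T, …` (never, if `T = ∞`), whatever
the initial state: among all strategies that decide at every step whether to measure, some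
strategy with this measurement schedule is optimal, and among the stationary strategies of the
second kind some strategy with constant waiting time `T` is. -/
def OptimalWaitingTime {q p m : ℕ} (D : Data q p m) {Ω : Type*} [MeasurableSpace Ω]
    (Pr : Measure Ω) (w : ℕ → Ω → (Fin m → ℝ)) (T : ℕ∞) : Prop :=
  (∃ π : Policy q p,
      (∀ t x h, π.measure t x h = true ↔ 0 < t ∧ ∃ n : ℕ, T = (n : ℕ∞) ∧ n ∣ t) ∧
      ∀ x, π.cost D x Pr w = value D Pr w x) ∧
    ∃ σ : LookaheadPolicy q p, (∀ z, σ.wait z = T) ∧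
      ∀ x, σ.cost D x Pr w = lookaheadValue D Pr w x

section Characterization

variable {q p m : ℕ} (D : Data q p m)

/-- The algebraic Riccati equation. -/
def SolvesRiccati (P : Matrix (Fin q) (Fin q) ℝ) : Prop :=
  P = D.Q + D.β • (D.Aᵀ * P * D.A)
    - (D.Aᵀ * P * D.B * (D.β • (D.R + D.β • (D.Bᵀ * P * D.B))⁻¹)) * (D.β • (D.Bᵀ * P * D.A))

/-- `φ = A' P B β (R + β B' P B)⁻¹ β B' P A`. -/
noncomputable def phi (P : Matrix (Fin q) (Fin q) ℝ) : Matrix (Fin q) (Fin q) ℝ :=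
  (D.Aᵀ * P * D.B * (D.β • (D.R + D.β • (D.Bᵀ * P * D.B))⁻¹)) * (D.β • (D.Bᵀ * P * D.A))

/-- The covariance matrix of the estimation error `t` steps after a measurement. -/
def errorCov : ℕ → Matrix (Fin q) (Fin q) ℝ
  | 0 => 0
  | t + 1 => D.A * errorCov t * D.Aᵀ + D.C * D.S * D.Cᵀ

/-- `∑_{t < n} (1 - β^{t+1}) / (1 - β) Tr(Aᵗ C S C' (A')ᵗ φ)`. -/
noncomputable def threshold (P : Matrix (Fin q) (Fin q) ℝ) (n : ℕ) : ℝ :=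
  ∑ t ∈ Finset.range n, (1 - D.β ^ (t + 1)) / (1 - D.β) *
    (D.A ^ t * (D.C * D.S * D.Cᵀ) * D.Aᵀ ^ t * phi D P).trace

/-- The expression whose infimum over `T ≥ 1` is the right-hand side of the fixed-point
equation for `r`. -/
noncomputable def lookaheadConstant (P : Matrix (Fin q) (Fin q) ℝ) (r : ℝ) (T : ℕ) : ℝ :=
  ∑ t ∈ Finset.range T, D.β ^ t * (errorCov D t * phi D P).trace
    + ∑ t ∈ Finset.Icc 1 T, D.β ^ t * (D.S * (D.Cᵀ * P * D.C)).trace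
    + D.β ^ T * (r + D.O)

/-- The fixed-point equation `r = inf_{T ≥ 1} {…}`. -/
def SolvesFixedPoint (P : Matrix (Fin q) (Fin q) ℝ) (r : ℝ) : Prop :=
  IsGLB {c : ℝ | ∃ T : ℕ, 1 ≤ T ∧ c = lookaheadConstant D P r T} r

/-- `T ∈ {1, 2, …} ∪ {∞}` is the index at which `O` falls between consecutive partial sums;
`T = ∞` means that no partial sum exceeds `O`. -/
def IsThresholdIndex (P : Matrix (Fin q) (Fin q) ℝ) (T : ℕ∞) : Prop :=
  1 ≤ T ∧
    (∀ n : ℕ, T = (n : ℕ∞) → threshold D P (n - 1) ≤ D.O ∧ D.O < threshold D P n) ∧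
    (T = ⊤ → ∀ n : ℕ, threshold D P n ≤ D.O)

/-- The Lyapunov equation `W - A W A' = C S C'`. -/
def SolvesLyapunov (W : Matrix (Fin q) (Fin q) ℝ) : Prop :=
  W - D.A * W * D.Aᵀ = D.C * D.S * D.Cᵀ

end Characterization

end CostlyLQG

/-! Completing the square in the Bellman equation (`bellman_identity`) shows that, if `P` solves the
Riccati equation, the stage cost plus `β` times the next value of `P` equals the present value of
`P` plus the loss `quad (gainWeight D P) (u + gain D P *ᵥ x)`. Taken in expectation and telescoped
(`sum_expStage_add`), the cost of any strategy becomes `x' P x`, a constant due to the noise, the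
discounted expected losses and the measurement costs, up to a discounted terminal term.

Between measurements the controller knows only the noise before the last measurement. The state is
therefore a known prediction plus an independent centered error with covariance `errorCov`, and the
expected loss on the event of a given lag is at least its probability times the trace of that
covariance against `φ` (`lintegral_runCost_le_expLoss`). Feeding back the prediction gives equality
(`ClosedLoop.input_add_gain`). What remains is a deterministic choice of measurement times: a
running cost `runCost` that depends only on the lag, and a price `O` per restart.

The running cost is nondecreasing in the lag. Waiting one more step is worthwhile exactly as long as
the running cost stays below `(1 - β) (x + O)`, where `x` is the optimal restart cost, and summation
by parts turns this condition into the comparison of `O` with `threshold`. The fixed point `x`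
bounds every schedule from below, path by path (`IsLastTime.le_scheduleCost`), and the periodic
schedule attains it (`scheduleCost_periodicLast_le`).

The terminal term vanishes whenever the cost is finite (`tendsto_expQuad`): by observability the
`q`-step value `valueIter D q` is positive definite, hence dominates `P` up to a constant, and it is
itself bounded by the next `q` stage costs. The same device gives uniqueness for the Riccati
equation; existence comes from monotone value iteration, which controllability keeps bounded. Both
kinds of strategies are instances of `ClosedLoop`, so one lower bound (`ClosedLoop.le_cost`) and one
upper bound (`ClosedLoop.cost_le`) serve for both. -/

namespace CostlyLQG

open Filter Topology

/-! ### Quadratic forms -/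

/-- The quadratic form `x' G x`. -/
def quad {n : ℕ} (G : Matrix (Fin n) (Fin n) ℝ) (x : Fin n → ℝ) : ℝ := x ⬝ᵥ G *ᵥ x

section Quad

variable {n k : ℕ} {G H : Matrix (Fin n) (Fin n) ℝ}

lemma quad_eq_sum (G : Matrix (Fin n) (Fin n) ℝ) (x : Fin n → ℝ) :
    quad G x = ∑ i, ∑ j, G i j * (x i * x j) := by
  simp only [quad, dotProduct, mulVec, Finset.mul_sum]
  exact Finset.sum_congr rfl fun i _ => Finset.sum_congr rfl fun j _ => by ring

lemma quad_nonneg (hG : G.PosSemidef) (x : Fin n → ℝ) : 0 ≤ quad G x := by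
  simpa [quad] using hG.dotProduct_mulVec_nonneg x

lemma quad_pos (hG : G.PosDef) {x : Fin n → ℝ} (hx : x ≠ 0) : 0 < quad G x := by
  simpa [quad] using hG.dotProduct_mulVec_pos hx

lemma posSemidef_of_quad (hG : Gᵀ = G) (h : ∀ x, 0 ≤ quad G x) : G.PosSemidef :=
  .of_dotProduct_mulVec_nonneg (by simpa [IsHermitian] using hG) (by simpa [quad] using h)

lemma posDef_of_quad (hG : Gᵀ = G) (h : ∀ x, x ≠ 0 → 0 < quad G x) : G.PosDef :=
  .of_dotProduct_mulVec_pos (by simpa [IsHermitian] using hG) (fun x hx => by simpa [quad] using h x hx)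

lemma transpose_eq_of_posSemidef (hG : G.PosSemidef) : Gᵀ = G := by
  simpa [IsHermitian] using hG.isHermitian

@[simp] lemma quad_zero_left (x : Fin n → ℝ) : quad 0 x = 0 := by simp [quad]

@[simp] lemma quad_zero_right : quad G 0 = 0 := by simp [quad]

lemma quad_add_left (x : Fin n → ℝ) : quad (G + H) x = quad G x + quad H x := by
  simp [quad, add_mulVec]

lemma quad_sub_left (x : Fin n → ℝ) : quad (G - H) x = quad G x - quad H x := by
  simp [quad, sub_mulVec]

lemma quad_smul_left (c : ℝ) (x : Fin n → ℝ) : quad (c • G) x = c * quad G x := by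
  simp [quad, smul_mulVec]

lemma quad_smul_right (c : ℝ) (x : Fin n → ℝ) : quad G (c • x) = c ^ 2 * quad G x := by
  simp [quad, mulVec_smul]; ring

lemma dotProduct_mulVec_symm (hG : Gᵀ = G) (x y : Fin n → ℝ) :
    x ⬝ᵥ G *ᵥ y = y ⬝ᵥ G *ᵥ x := by
  rw [dotProduct_comm, ← vecMul_transpose, hG, dotProduct_mulVec]

lemma quad_add_right (hG : Gᵀ = G) (x y : Fin n → ℝ) :
    quad G (x + y) = quad G x + 2 * (x ⬝ᵥ G *ᵥ y) + quad G y := by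
  have := dotProduct_mulVec_symm hG x y
  simp only [quad, mulVec_add, dotProduct_add, add_dotProduct]
  linarith

lemma quad_conj (N : Matrix (Fin n) (Fin k) ℝ) (x : Fin k → ℝ) :
    quad (Nᵀ * G * N) x = quad G (N *ᵥ x) := by
  simp only [quad, ← mulVec_mulVec]
  rw [dotProduct_mulVec, vecMul_transpose]

/-- Polarization: the values at `x`, `y` and `x + y` determine the bilinear form, which gives the
entries on unit vectors. -/
lemma eq_of_quad_eq (hG : Gᵀ = G) (hH : Hᵀ = H) (h : ∀ x, quad G x = quad H x) : G = H := by
  have key : ∀ x y, x ⬝ᵥ G *ᵥ y = x ⬝ᵥ H *ᵥ y := fun x y => by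
    have := h (x + y)
    rw [quad_add_right hG, quad_add_right hH, h x, h y] at this
    linarith
  ext i j
  simpa using key (Pi.single i 1) (Pi.single j 1)

lemma continuous_quad (G : Matrix (Fin n) (Fin n) ℝ) : Continuous (quad G) := by
  unfold quad
  fun_prop

/-- A positive definite form dominates every other form. -/
lemma exists_quad_le_mul (hG : G.PosDef) (H : Matrix (Fin n) (Fin n) ℝ) :
    ∃ c : ℝ, 0 < c ∧ ∀ x, quad H x ≤ c * quad G x := by
  -- The quotient of the two forms is continuous on the compact unit sphere, hence bounded there;
  -- homogeneity extends the bound to all vectors.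
  have hcomp : IsCompact (Metric.sphere (0 : Fin n → ℝ) 1) := isCompact_sphere _ _
  have hne : ∀ x ∈ Metric.sphere (0 : Fin n → ℝ) 1, 0 < quad G x := fun x hx =>
    quad_pos hG (by rintro rfl; simp at hx)
  have hcont : ContinuousOn (fun x => quad H x / quad G x) (Metric.sphere (0 : Fin n → ℝ) 1) :=
    (continuous_quad H).continuousOn.div (continuous_quad G).continuousOn
      fun x hx => (hne x hx).ne'
  obtain ⟨c, hc⟩ := (hcomp.image_of_continuousOn hcont).bddAbove
  -- The maximum with `1` keeps the constant positive even if `H` is negative or the sphere is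
  -- empty.
  refine ⟨max c 1, by positivity, fun x => ?_⟩
  rcases eq_or_ne x 0 with rfl | hx
  · simp
  have hx' : ‖x‖ ≠ 0 := norm_ne_zero_iff.2 hx
  set y := ‖x‖⁻¹ • x with hy
  have hys : y ∈ Metric.sphere (0 : Fin n → ℝ) 1 := by
    simp [hy, norm_smul, hx']
  have hxy : x = ‖x‖ • y := by simp [hy, smul_smul, hx']
  have h1 : quad H y / quad G y ≤ c := hc ⟨y, hys, rfl⟩
  rw [div_le_iff₀ (hne y hys)] at h1
  have h2 : quad H y ≤ max c 1 * quad G y :=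
    h1.trans (mul_le_mul_of_nonneg_right (le_max_left _ _) (hne y hys).le)
  have h3 : quad H x = ‖x‖ ^ 2 * quad H y := by rw [← quad_smul_right, ← hxy]
  have h4 : quad G x = ‖x‖ ^ 2 * quad G y := by rw [← quad_smul_right, ← hxy]
  rw [h3, h4]
  nlinarith [sq_nonneg ‖x‖]

end Quad

/-! ### The Riccati operator -/

section Riccati

variable {q p m : ℕ} (D : Data q p m)

/-- `R + β B' P B`. -/
def gainWeight (P : Matrix (Fin q) (Fin q) ℝ) : Matrix (Fin p) (Fin p) ℝ :=
  D.R + D.β • (D.Bᵀ * P * D.B)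

/-- The feedback gain `(R + β B' P B)⁻¹ β B' P A`. -/
noncomputable def gain (P : Matrix (Fin q) (Fin q) ℝ) : Matrix (Fin p) (Fin q) ℝ :=
  (gainWeight D P)⁻¹ * (D.β • (D.Bᵀ * P * D.A))

/-- The right-hand side of the Riccati equation. -/
noncomputable def riccati (P : Matrix (Fin q) (Fin q) ℝ) : Matrix (Fin q) (Fin q) ℝ :=
  D.Q + D.β • (D.Aᵀ * P * D.A) - phi D P

/-- The matrix `A - B K` of the optimally controlled system. -/
noncomputable def closedLoopMatrix (P : Matrix (Fin q) (Fin q) ℝ) : Matrix (Fin q) (Fin q) ℝ :=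
  D.A - D.B * gain D P

variable {D} (hD : StandingAssumptions D) {P P' : Matrix (Fin q) (Fin q) ℝ}

lemma solvesRiccati_iff : SolvesRiccati D P ↔ P = riccati D P := Iff.rfl

include hD

lemma StandingAssumptions.gainWeight_posDef (hP : P.PosSemidef) : (gainWeight D P).PosDef := by
  refine hD.R_posDef.add_posSemidef (Matrix.PosSemidef.smul ?_ hD.beta_pos.le)
  simpa using hP.conjTranspose_mul_mul_same D.B

lemma StandingAssumptions.gainWeight_mul_gain (hP : P.PosSemidef) :
    gainWeight D P * gain D P = D.β • (D.Bᵀ * P * D.A) := by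
  rw [gain, Matrix.mul_nonsing_inv_cancel_left]
  exact (Matrix.isUnit_iff_isUnit_det _).1 (hD.gainWeight_posDef hP).isUnit

/-- Written as a congruence of the weight `R + β B' P B` by the gain, `φ` is visibly positive
semidefinite, and its form is the loss caused by a prediction error. -/
lemma StandingAssumptions.phi_eq (hP : P.PosSemidef) :
    phi D P = (gain D P)ᵀ * gainWeight D P * gain D P := by
  have hPt := transpose_eq_of_posSemidef hP
  have hM := transpose_eq_of_posSemidef (hD.gainWeight_posDef hP).posSemidef
  rw [Matrix.mul_assoc, hD.gainWeight_mul_gain hP, gain, transpose_mul, transpose_nonsing_inv, hM]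
  simp only [phi, gainWeight, transpose_smul, transpose_mul, transpose_transpose, hPt,
    Matrix.smul_mul, Matrix.mul_smul, Matrix.mul_assoc]

lemma StandingAssumptions.quad_phi (hP : P.PosSemidef) (x : Fin q → ℝ) :
    quad (phi D P) x = quad (gainWeight D P) (gain D P *ᵥ x) := by
  rw [hD.phi_eq hP, quad_conj]

lemma StandingAssumptions.phi_posSemidef (hP : P.PosSemidef) : (phi D P).PosSemidef := by
  rw [hD.phi_eq hP]
  simpa using (hD.gainWeight_posDef hP).posSemidef.conjTranspose_mul_mul_same (gain D P)

/-- Completing the square in the Bellman equation. -/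
lemma StandingAssumptions.bellman_identity (hP : P.PosSemidef) (x : Fin q → ℝ) (u : Fin p → ℝ) :
    quad D.Q x + quad D.R u + D.β * quad P (D.A *ᵥ x + D.B *ᵥ u)
      = quad (riccati D P) x + quad (gainWeight D P) (u + gain D P *ᵥ x) := by
  have hPt := transpose_eq_of_posSemidef hP
  have hM := transpose_eq_of_posSemidef (hD.gainWeight_posDef hP).posSemidef
  have hcross : u ⬝ᵥ gainWeight D P *ᵥ (gain D P *ᵥ x)
      = D.β * ((D.A *ᵥ x) ⬝ᵥ P *ᵥ (D.B *ᵥ u)) := by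
    rw [mulVec_mulVec, hD.gainWeight_mul_gain hP, dotProduct_mulVec_symm hPt, smul_mulVec,
      dotProduct_smul, smul_eq_mul, ← mulVec_mulVec, ← mulVec_mulVec, dotProduct_mulVec,
      vecMul_transpose]
  rw [quad_add_right hPt, quad_add_right hM, riccati, quad_sub_left, quad_add_left,
    quad_smul_left, quad_conj, hD.quad_phi hP, hcross]
  have : quad (gainWeight D P) u = quad D.R u + D.β * quad P (D.B *ᵥ u) := by
    rw [gainWeight, quad_add_left, quad_smul_left, quad_conj]
  rw [this]
  ring

/-- The Riccati operator is the minimum over `u` of the one-step cost: the square left over in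
`bellman_identity` is nonnegative, and it vanishes at `u = -K x`, which is the next lemma. -/
lemma StandingAssumptions.quad_riccati_le (hP : P.PosSemidef) (x : Fin q → ℝ) (u : Fin p → ℝ) :
    quad (riccati D P) x
      ≤ quad D.Q x + quad D.R u + D.β * quad P (D.A *ᵥ x + D.B *ᵥ u) := by
  rw [hD.bellman_identity hP]
  linarith [quad_nonneg (hD.gainWeight_posDef hP).posSemidef (u + gain D P *ᵥ x)]

lemma StandingAssumptions.quad_riccati_eq (hP : P.PosSemidef) (x : Fin q → ℝ) :
    quad (riccati D P) x = quad D.Q x + quad D.R (-(gain D P *ᵥ x))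
      + D.β * quad P (D.A *ᵥ x + D.B *ᵥ (-(gain D P *ᵥ x))) := by
  rw [hD.bellman_identity hP]
  simp

lemma StandingAssumptions.riccati_posSemidef (hP : P.PosSemidef) : (riccati D P).PosSemidef := by
  refine posSemidef_of_quad ?_ fun x => ?_
  · have h1 := transpose_eq_of_posSemidef hD.Q_posSemidef
    have h2 := transpose_eq_of_posSemidef (hD.phi_posSemidef hP)
    have h3 := transpose_eq_of_posSemidef hP
    simp [riccati, h1, h2, h3, Matrix.mul_assoc]
  · rw [hD.quad_riccati_eq hP]
    have := quad_nonneg hP (D.A *ᵥ x + D.B *ᵥ (-(gain D P *ᵥ x)))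
    have := quad_nonneg hD.Q_posSemidef x
    have := quad_nonneg hD.R_posDef.posSemidef (-(gain D P *ᵥ x))
    have := hD.beta_pos
    positivity

/-- The control that is optimal for `P'` is only one candidate in the minimum for `P`. -/
lemma StandingAssumptions.riccati_mono (hP : P.PosSemidef) (hP' : P'.PosSemidef)
    (h : ∀ x, quad P x ≤ quad P' x) (x : Fin q → ℝ) :
    quad (riccati D P) x ≤ quad (riccati D P') x := by
  rw [hD.quad_riccati_eq hP']
  refine (hD.quad_riccati_le hP x (-(gain D P' *ᵥ x))).trans ?_
  have := mul_le_mul_of_nonneg_left (h (D.A *ᵥ x + D.B *ᵥ (-(gain D P' *ᵥ x)))) hD.beta_pos.le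
  linarith

end Riccati

/-! ### Value iteration -/

section ValueIteration

variable {q p m : ℕ}

/-- The quadratic part of the optimal cost over `n` time steps. -/
noncomputable def valueIter (D : Data q p m) (n : ℕ) : Matrix (Fin q) (Fin q) ℝ :=
  (riccati D)^[n] 0

lemma valueIter_succ (D : Data q p m) (n : ℕ) :
    valueIter D (n + 1) = riccati D (valueIter D n) := Function.iterate_succ_apply' _ _ _

variable {D : Data q p m} (hD : StandingAssumptions D)
include hD

lemma StandingAssumptions.valueIter_posSemidef (n : ℕ) : (valueIter D n).PosSemidef := by
  induction n with
  | zero => exact Matrix.PosSemidef.zero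
  | succ n ih => rw [valueIter_succ]; exact hD.riccati_posSemidef ih

lemma StandingAssumptions.valueIter_le_succ (n : ℕ) (x : Fin q → ℝ) :
    quad (valueIter D n) x ≤ quad (valueIter D (n + 1)) x := by
  induction n generalizing x with
  | zero =>
    refine le_of_eq_of_le ?_ (quad_nonneg (hD.valueIter_posSemidef 1) x)
    simp [valueIter]
  | succ n ih =>
    rw [valueIter_succ, valueIter_succ D (n + 1)]
    exact hD.riccati_mono (hD.valueIter_posSemidef _) (hD.valueIter_posSemidef _) ih x

lemma StandingAssumptions.valueIter_le_solution {P : Matrix (Fin q) (Fin q) ℝ}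
    (hP : P.PosSemidef) (hR : SolvesRiccati D P) (n : ℕ) (x : Fin q → ℝ) :
    quad (valueIter D n) x ≤ quad P x := by
  induction n generalizing x with
  | zero => simpa [valueIter] using quad_nonneg hP x
  | succ n ih =>
    have h := hD.riccati_mono (hD.valueIter_posSemidef n) hP ih x
    rwa [← solvesRiccati_iff.1 hR, ← valueIter_succ] at h

/-- If the initial state can be steered to zero, the value iteration stays bounded. -/
lemma StandingAssumptions.valueIter_bddAbove (hAB : Controllable D.A D.B) (x : Fin q → ℝ) :
    ∃ c, ∀ n, quad (valueIter D n) x ≤ c := by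
  -- Induction on the steering horizon. In this indexing `u k` carries the highest power of `A`, so
  -- that it is the control applied first.
  have aux : ∀ k : ℕ, ∀ y : Fin q → ℝ,
      (∃ u : ℕ → Fin p → ℝ, (D.A ^ k) *ᵥ y + ∑ i ∈ Finset.range k, (D.A ^ i * D.B) *ᵥ u i = 0) →
      ∃ c, ∀ n, quad (valueIter D n) y ≤ c := by
    intro k
    induction k with
    | zero =>
      rintro y ⟨u, hu⟩
      refine ⟨0, fun n => ?_⟩
      have : y = 0 := by simpa using hu
      simp [this]
    | succ k ih =>
      rintro y ⟨u, hu⟩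
      obtain ⟨c, hc⟩ := ih (D.A *ᵥ y + D.B *ᵥ u k) ⟨u, by
        rw [Finset.sum_range_succ] at hu
        rw [mulVec_add, mulVec_mulVec, mulVec_mulVec, ← pow_succ, ← hu]
        abel⟩
      have hc0 : 0 ≤ c := by simpa [valueIter] using hc 0
      refine ⟨quad D.Q y + quad D.R (u k) + D.β * c, fun n => ?_⟩
      have h1 := quad_nonneg hD.Q_posSemidef y
      have h2 := quad_nonneg hD.R_posDef.posSemidef (u k)
      have h3 := hD.beta_pos
      cases n with
      | zero => simp only [valueIter, Function.iterate_zero, id, quad_zero_left]; positivity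
      | succ n =>
        rw [valueIter_succ]
        refine (hD.quad_riccati_le (hD.valueIter_posSemidef n) y (u k)).trans ?_
        have := mul_le_mul_of_nonneg_left (hc n) h3.le
        linarith
  refine aux q x ?_
  -- Full rank makes the controllability matrix surjective, so that some controls cancel `A ^ q x`.
  set N := Matrix.of fun (i : Fin q) (k : Fin q × Fin p) => (D.A ^ (k.1 : ℕ) * D.B) i k.2 with hN
  have hsurj : LinearMap.range N.mulVecLin = ⊤ :=
    Submodule.eq_top_of_finrank_eq (by rw [Module.finrank_fin_fun]; exact hAB)
  obtain ⟨v, hv⟩ := LinearMap.range_eq_top.1 hsurj (-((D.A ^ q) *ᵥ x))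
  refine ⟨fun i => if h : i < q then fun j => v (⟨i, h⟩, j) else 0, ?_⟩
  rw [Finset.sum_range]
  have : ∑ i : Fin q, (D.A ^ (i : ℕ) * D.B) *ᵥ
      (if h : (i : ℕ) < q then fun j => v (⟨i, h⟩, j) else 0) = N.mulVecLin v := by
    ext j
    simp [hN, mulVec, dotProduct, Fintype.sum_prod_type, Finset.sum_apply]
  rw [this, hv]
  simp

/-- A vanishing optimal cost over `q` steps forces all controls to be zero, since `R` is positive
definite. The uncontrolled path then satisfies `J A^k x = 0` for `k < q`, and observability gives `x
= 0`. -/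
lemma StandingAssumptions.valueIter_posDef {l : ℕ} {J : Matrix (Fin l) (Fin q) ℝ}
    (hJ : D.Q = Jᵀ * J) (hAJ : Observable D.A J) : (valueIter D q).PosDef := by
  refine posDef_of_quad (transpose_eq_of_posSemidef (hD.valueIter_posSemidef q)) fun x hx => ?_
  refine lt_of_le_of_ne (quad_nonneg (hD.valueIter_posSemidef q) x) fun h0 => hx ?_
  have aux : ∀ n : ℕ, ∀ y : Fin q → ℝ, quad (valueIter D n) y = 0 →
      ∀ k < n, (J * D.A ^ k) *ᵥ y = 0 := by
    intro n
    induction n with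
    | zero => intro y _ k hk; omega
    | succ n ih =>
      intro y hy k hk
      have hV := hD.valueIter_posSemidef n
      rw [valueIter_succ, hD.quad_riccati_eq hV] at hy
      set u := -(gain D (valueIter D n) *ᵥ y)
      have h1 := quad_nonneg hD.Q_posSemidef y
      have h2 := quad_nonneg hD.R_posDef.posSemidef u
      have h3 := mul_nonneg hD.beta_pos.le (quad_nonneg hV (D.A *ᵥ y + D.B *ᵥ u))
      have hu : u = 0 := by
        by_contra hne
        linarith [quad_pos hD.R_posDef hne]
      have hQ : quad D.Q y = 0 := by linarith
      have hnext : quad (valueIter D n) (D.A *ᵥ y) = 0 := by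
        have : D.β * quad (valueIter D n) (D.A *ᵥ y + D.B *ᵥ u) = 0 := by linarith
        rcases mul_eq_zero.1 this with h | h
        · exact absurd h hD.beta_pos.ne'
        · simpa [hu] using h
      cases k with
      | zero =>
        have : quad (Jᵀ * (1 : Matrix (Fin l) (Fin l) ℝ) * J) y = 0 := by simpa [hJ] using hQ
        rw [quad_conj] at this
        simpa [quad] using this
      | succ k =>
        have := ih _ hnext k (by omega)
        rwa [mulVec_mulVec, Matrix.mul_assoc, ← pow_succ] at this
  set N := Matrix.of fun (k : Fin q × Fin l) (j : Fin q) => (J * D.A ^ (k.1 : ℕ)) k.2 j with hN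
  have hker : LinearMap.ker N.mulVecLin = ⊥ := by
    have h1 := LinearMap.finrank_range_add_finrank_ker N.mulVecLin
    have h2 : Module.finrank ℝ (LinearMap.range N.mulVecLin) = q := hAJ
    rw [h2, Module.finrank_fin_fun] at h1
    exact Submodule.finrank_eq_zero.1 (by omega)
  refine LinearMap.ker_eq_bot.1 hker ?_
  rw [map_zero]
  ext ⟨k, i⟩
  exact congrFun (aux q x h0.symm k k.2) i

/-- The value iteration converges to a positive semidefinite solution of the Riccati equation. -/
lemma StandingAssumptions.exists_riccati_solution (hAB : Controllable D.A D.B) :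
    ∃ P : Matrix (Fin q) (Fin q) ℝ, P.PosSemidef ∧ SolvesRiccati D P := by
  have hconv : ∀ x, ∃ l, Tendsto (fun n => quad (valueIter D n) x) atTop (𝓝 l) := fun x => by
    obtain ⟨c, hc⟩ := hD.valueIter_bddAbove hAB x
    exact ⟨_, tendsto_atTop_ciSup (monotone_nat_of_le_succ fun n => hD.valueIter_le_succ n x)
      ⟨c, by rintro _ ⟨n, rfl⟩; exact hc n⟩⟩
  choose v hv using hconv
  set e : Fin q → Fin q → ℝ := fun i => Pi.single i 1
  -- The forms converge pointwise by monotonicity and boundedness; polarization on unit vectors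
  -- turns this into convergence of the entries.
  set P : Matrix (Fin q) (Fin q) ℝ := fun i j => (v (e i + e j) - v (e i) - v (e j)) / 2
  have hlim : Tendsto (valueIter D) atTop (𝓝 P) := by
    refine tendsto_pi_nhds.2 fun i => tendsto_pi_nhds.2 fun j => ?_
    refine ((((hv (e i + e j)).sub (hv (e i))).sub (hv (e j))).div_const 2).congr fun n => ?_
    rw [quad_add_right (transpose_eq_of_posSemidef (hD.valueIter_posSemidef n))]
    simp [e]
    ring
  have hPt : Pᵀ = P := by
    ext i j
    change (v (e j + e i) - v (e j) - v (e i)) / 2 = (v (e i + e j) - v (e i) - v (e j)) / 2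
    rw [add_comm (e j)]
    ring
  have hquad : ∀ x, 0 ≤ quad P x := fun x => by
    have hc : Continuous fun G : Matrix (Fin q) (Fin q) ℝ => quad G x := by
      unfold quad
      fun_prop
    exact ge_of_tendsto' ((hc.tendsto P).comp hlim)
      fun n => quad_nonneg (hD.valueIter_posSemidef n) x
  have hP : P.PosSemidef := posSemidef_of_quad hPt hquad
  refine ⟨P, hP, solvesRiccati_iff.2 ?_⟩
  have hdet : (gainWeight D P).det ≠ 0 :=
    ((Matrix.isUnit_iff_isUnit_det _).1 (hD.gainWeight_posDef hP).isUnit).ne_zero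
  -- The limit is positive semidefinite, so its gain weight is invertible and the inverse is
  -- continuous there; the iteration passes to the limit.
  have hinv : ContinuousAt (fun G : Matrix (Fin q) (Fin q) ℝ => (gainWeight D G)⁻¹) P := by
    have h1 : Continuous fun G : Matrix (Fin q) (Fin q) ℝ => gainWeight D G := by
      unfold gainWeight
      fun_prop
    simp only [Matrix.inv_def, Ring.inverse_eq_inv']
    exact (ContinuousAt.inv₀ h1.matrix_det.continuousAt hdet).smul
      h1.matrix_adjugate.continuousAt
  have hric : ContinuousAt (riccati D) P := by
    have h1 : Continuous fun z : Matrix (Fin q) (Fin q) ℝ × Matrix (Fin p) (Fin p) ℝ =>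
        D.Q + D.β • (D.Aᵀ * z.1 * D.A)
          - (D.Aᵀ * z.1 * D.B * (D.β • z.2)) * (D.β • (D.Bᵀ * z.1 * D.A)) := by
      fun_prop
    exact ContinuousAt.comp (f := fun G => (G, (gainWeight D G)⁻¹)) h1.continuousAt
      (continuousAt_id.prodMk hinv)
  refine tendsto_nhds_unique (hlim.comp (tendsto_add_atTop_nat 1)) ?_
  refine (hric.tendsto.comp hlim).congr fun n => ?_
  simp [valueIter_succ]

/-- All positive semidefinite solutions are dominated by a given one. -/
lemma StandingAssumptions.riccati_solution_le {l : ℕ} {J : Matrix (Fin l) (Fin q) ℝ}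
    (hJ : D.Q = Jᵀ * J) (hAJ : Observable D.A J) {P P' : Matrix (Fin q) (Fin q) ℝ}
    (hP : P.PosSemidef) (hR : SolvesRiccati D P) (hP' : P'.PosSemidef)
    (hR' : SolvesRiccati D P') (x : Fin q → ℝ) : quad P' x ≤ quad P x := by
  -- Along the closed loop of `P` the Bellman equation holds with equality for `P`, but only as an
  -- inequality for `P'`. Summing both leaves the remainder `β ^ n * quad P' (X n)`.
  set X : ℕ → Fin q → ℝ := fun n => (closedLoopMatrix D P ^ n) *ᵥ x with hX
  set U : ℕ → Fin p → ℝ := fun n => -(gain D P *ᵥ X n)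
  have hstep : ∀ n, D.A *ᵥ X n + D.B *ᵥ U n = X (n + 1) := fun n => by
    simp only [hX, U, pow_succ', ← mulVec_mulVec, closedLoopMatrix, sub_mulVec, mulVec_neg]
    abel
  set a : ℕ → ℝ := fun n => D.β ^ n * (quad D.Q (X n) + quad D.R (U n)) with ha
  have hβ := hD.beta_pos
  have ha0 : ∀ n, 0 ≤ a n := fun n => by
    have := quad_nonneg hD.Q_posSemidef (X n)
    have := quad_nonneg hD.R_posDef.posSemidef (U n)
    positivity
  have hbell : ∀ n, a n + D.β ^ (n + 1) * quad P (X (n + 1)) = D.β ^ n * quad P (X n) := by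
    intro n
    have h := hD.quad_riccati_eq hP (X n)
    rw [← solvesRiccati_iff.1 hR, hstep n] at h
    rw [h]; simp only [ha, U]; ring
  have hsum : ∀ n, ∑ t ∈ Finset.range n, a t + D.β ^ n * quad P (X n) = quad P x := by
    intro n
    induction n with
    | zero => simp [hX]
    | succ n ih => rw [Finset.sum_range_succ, add_assoc, hbell, ih]
  have hsummable : Summable a := by
    refine summable_of_sum_range_le ha0 (c := quad P x) fun n => ?_
    have := mul_nonneg (pow_nonneg hβ.le n) (quad_nonneg hP (X n))
    linarith [hsum n]
  -- The `k`-step optimal value is at most the cost of the next `k` stages. With `k = q` and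
  -- positive definiteness this bounds the remainder by terms of a summable series.
  have hcost : ∀ k n, D.β ^ n * quad (valueIter D k) (X n)
      ≤ ∑ j ∈ Finset.range k, a (n + j) := by
    intro k
    induction k with
    | zero => intro n; simp [valueIter]
    | succ k ih =>
      intro n
      rw [valueIter_succ, Finset.sum_range_succ']
      have h1 := mul_le_mul_of_nonneg_left
        (hD.quad_riccati_le (hD.valueIter_posSemidef k) (X n) (U n)) (pow_nonneg hβ.le n)
      rw [hstep n] at h1
      have h2 := ih (n + 1)
      simp only [add_zero, pow_succ, add_assoc, add_comm 1] at h2 ⊢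
      simp only [ha] at h1 h2 ⊢
      linarith
  obtain ⟨c, hc, hcP⟩ := exists_quad_le_mul (hD.valueIter_posDef hJ hAJ) P'
  have htail : Tendsto (fun n => c * ∑ j ∈ Finset.range q, a (n + j)) atTop (𝓝 0) := by
    rw [← mul_zero c]
    refine Tendsto.const_mul c ?_
    rw [← Finset.sum_const_zero (s := Finset.range q) (ι := ℕ)]
    exact tendsto_finsetSum _ fun j _ =>
      hsummable.tendsto_atTop_zero.comp (tendsto_add_atTop_nat j)
  have hle : ∀ n, quad P' x ≤ ∑ t ∈ Finset.range n, a t + D.β ^ n * quad P' (X n) := by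
    intro n
    induction n with
    | zero => simp [hX]
    | succ n ih =>
      have h := hD.quad_riccati_le hP' (X n) (U n)
      rw [← solvesRiccati_iff.1 hR', hstep n] at h
      have := mul_le_mul_of_nonneg_left h (pow_nonneg hβ.le n)
      rw [Finset.sum_range_succ, pow_succ]
      simp only [ha] at ih ⊢
      linarith
  have hbound : ∀ n, quad P' x ≤ quad P x + c * ∑ j ∈ Finset.range q, a (n + j) := by
    intro n
    have h1 := mul_nonneg (pow_nonneg hβ.le n) (quad_nonneg hP (X n))
    have h2 := mul_le_mul_of_nonneg_left (hcP (X n)) (pow_nonneg hβ.le n)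
    have h3 := mul_le_mul_of_nonneg_left (hcost q n) hc.le
    linarith [hsum n, hle n]
  simpa using ge_of_tendsto' (htail.const_add (quad P x)) hbound

/-- The Riccati equation has exactly one positive semidefinite solution, which is positive
definite. -/
theorem StandingAssumptions.existsUnique_riccati {l : ℕ} {J : Matrix (Fin l) (Fin q) ℝ}
    (hJ : D.Q = Jᵀ * J) (hAB : Controllable D.A D.B) (hAJ : Observable D.A J) :
    ∃ P : Matrix (Fin q) (Fin q) ℝ, P.PosDef ∧ SolvesRiccati D P ∧
      ∀ P' : Matrix (Fin q) (Fin q) ℝ, P'.PosSemidef → SolvesRiccati D P' → P' = P := by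
  obtain ⟨P, hP, hR⟩ := hD.exists_riccati_solution hAB
  refine ⟨P, posDef_of_quad (transpose_eq_of_posSemidef hP) fun x hx =>
    (quad_pos (hD.valueIter_posDef hJ hAJ) hx).trans_le (hD.valueIter_le_solution hP hR q x), hR,
    fun P' hP' hR' => eq_of_quad_eq (transpose_eq_of_posSemidef hP')
      (transpose_eq_of_posSemidef hP) fun x => ?_⟩
  exact le_antisymm (hD.riccati_solution_le hJ hAJ hP hR hP' hR' x)
    (hD.riccati_solution_le hJ hAJ hP' hR' hP hR x)

end ValueIteration

/-! ### The deterministic waiting problem -/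

section Waiting

/-- Discounted cost of waiting `T` steps with running cost `g` and then restarting at cost
`x + O`. -/
noncomputable def waitCost (β O : ℝ) (g : ℕ → ℝ) (x : ℝ) (T : ℕ) : ℝ :=
  ∑ t ∈ Finset.range T, β ^ t * g t + β ^ T * (x + O)

/-- Weighted partial sums of the increments `a` of the running cost. -/
noncomputable def weightedSum (β : ℝ) (a : ℕ → ℝ) (n : ℕ) : ℝ :=
  ∑ t ∈ Finset.range n, (1 - β ^ (t + 1)) / (1 - β) * a t

variable {β O x : ℝ} {a g : ℕ → ℝ}

/-- Summation by parts. It translates a comparison of the weighted sum with `O` into one of `g n`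
with `(1 - β) (x + O)`. -/
lemma weightedSum_eq (hβ : β < 1) (hg : ∀ t, g t = ∑ s ∈ Finset.range t, a s) (n : ℕ) :
    weightedSum β a n = (1 - β ^ n) / (1 - β) * g n - ∑ t ∈ Finset.range n, β ^ t * g t := by
  have h1 : 1 - β ≠ 0 := by linarith
  induction n with
  | zero => simp [weightedSum]
  | succ n ih =>
    have hgn : g (n + 1) = g n + a n := by rw [hg, hg, Finset.sum_range_succ]
    have : weightedSum β a (n + 1)
        = weightedSum β a n + (1 - β ^ (n + 1)) / (1 - β) * a n := Finset.sum_range_succ _ _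
    rw [this, ih, Finset.sum_range_succ, hgn]
    field_simp
    ring

lemma one_le_weight (hβ0 : 0 < β) (hβ : β < 1) (t : ℕ) : 1 ≤ (1 - β ^ (t + 1)) / (1 - β) := by
  rw [le_div_iff₀ (by linarith), pow_succ]
  have := mul_le_of_le_one_left hβ0.le (pow_le_one₀ hβ0.le hβ.le (n := t))
  linarith

lemma weight_nonneg (hβ0 : 0 < β) (hβ : β < 1) (t : ℕ) : 0 ≤ (1 - β ^ (t + 1)) / (1 - β) :=
  zero_le_one.trans (one_le_weight hβ0 hβ t)

lemma monotone_weightedSum (hβ0 : 0 < β) (hβ : β < 1) (ha : ∀ t, 0 ≤ a t) :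
    Monotone (weightedSum β a) :=
  monotone_nat_of_le_succ fun n => by
    rw [weightedSum, weightedSum, Finset.sum_range_succ]
    linarith [mul_nonneg (weight_nonneg hβ0 hβ n) (ha n)]

lemma sum_le_weightedSum (hβ0 : 0 < β) (hβ : β < 1) (ha : ∀ t, 0 ≤ a t) (n : ℕ) :
    ∑ t ∈ Finset.range n, a t ≤ weightedSum β a n :=
  Finset.sum_le_sum fun t _ => le_mul_of_one_le_left (ha t) (one_le_weight hβ0 hβ t)

/-- The sign of the increment decides whether to wait longer: the running cost `g T` competes with
`(1 - β) (x + O)`, the gain from postponing the restart by one step. -/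
lemma waitCost_succ (T : ℕ) :
    waitCost β O g x (T + 1) = waitCost β O g x T + β ^ T * (g T - (1 - β) * (x + O)) := by
  rw [waitCost, waitCost, Finset.sum_range_succ]
  ring

lemma waitCost_eq_of_finite {T : ℕ} (hT : β ^ T ≠ 1)
    (hx : x = (∑ t ∈ Finset.range T, β ^ t * g t + β ^ T * O) / (1 - β ^ T)) :
    waitCost β O g x T = x := by
  have h : 1 - β ^ T ≠ 0 := sub_ne_zero.2 hT.symm
  rw [eq_div_iff h] at hx
  rw [waitCost]
  linarith

/-- As `g` is nondecreasing, the increments of `waitCost` change sign at most once. The two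
threshold conditions place this change at `T`, so that `T` is a minimizer, with value `x`. -/
lemma waitCost_ge_of_finite (hβ0 : 0 < β) (hβ : β < 1) (ha : ∀ t, 0 ≤ a t)
    (hg : ∀ t, g t = ∑ s ∈ Finset.range t, a s) {T : ℕ} (hT : 1 ≤ T)
    (h1 : weightedSum β a (T - 1) ≤ O) (h2 : O < weightedSum β a T)
    (hx : x = (∑ t ∈ Finset.range T, β ^ t * g t + β ^ T * O) / (1 - β ^ T)) (n : ℕ) :
    x ≤ waitCost β O g x n := by
  have hpow : β ^ T < 1 := pow_lt_one₀ hβ0.le hβ (by omega)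
  have hmono : Monotone g := monotone_nat_of_le_succ fun n => by
    rw [hg, hg, Finset.sum_range_succ]; linarith [ha n]
  have hxO : (x + O) * (1 - β ^ T) = ∑ t ∈ Finset.range T, β ^ t * g t + O := by
    rw [hx]
    field_simp [(sub_pos.2 hpow).ne']
    ring
  have hupper : (1 - β) * (x + O) ≤ g T := by
    rw [weightedSum_eq hβ hg, div_mul_eq_mul_div, lt_sub_iff_add_lt,
      lt_div_iff₀ (by linarith)] at h2
    refine le_of_mul_le_mul_right ?_ (sub_pos.2 hpow)
    rw [mul_assoc, hxO]
    linarith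
  have hlower : g (T - 1) ≤ (1 - β) * (x + O) := by
    obtain ⟨k, rfl⟩ : ∃ k, T = k + 1 := ⟨T - 1, by omega⟩
    rw [Nat.add_sub_cancel] at h1 ⊢
    rw [weightedSum_eq hβ hg, div_mul_eq_mul_div, sub_le_iff_le_add,
      div_le_iff₀ (by linarith)] at h1
    -- With `T = k + 1`, the extra summand `β ^ k * g k` turns the weight `1 - β ^ k` from the
    -- threshold into the required `1 - β ^ (k + 1)`.
    rw [Finset.sum_range_succ] at hxO
    refine le_of_mul_le_mul_right ?_ (sub_pos.2 hpow)
    rw [mul_assoc, hxO, pow_succ]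
    linarith
  have hfix := waitCost_eq_of_finite (O := O) (g := g) hpow.ne hx
  rcases le_total n T with hn | hn
  · rw [← hfix, hfix]
    refine Nat.decreasingInduction' (P := fun n => x ≤ waitCost β O g x n)
      (fun k hk _ ih => ?_) hn hfix.ge
    rw [waitCost_succ] at ih
    have hk' := hmono (show k ≤ T - 1 by omega)
    have := mul_nonneg (pow_nonneg hβ0.le k)
      (show 0 ≤ (1 - β) * (x + O) - g k by linarith)
    linarith
  · induction n, hn using Nat.le_induction with
    | base => exact hfix.ge
    | succ k hk ih =>
      rw [waitCost_succ]
      have hk' := hmono hk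
      have := mul_nonneg (pow_nonneg hβ0.le k)
        (show 0 ≤ g k - (1 - β) * (x + O) by linarith)
      linarith

lemma isGLB_waitCost_of_finite (hβ0 : 0 < β) (hβ : β < 1) (ha : ∀ t, 0 ≤ a t)
    (hg : ∀ t, g t = ∑ s ∈ Finset.range t, a s) {T : ℕ} (hT : 1 ≤ T)
    (h1 : weightedSum β a (T - 1) ≤ O) (h2 : O < weightedSum β a T)
    (hx : x = (∑ t ∈ Finset.range T, β ^ t * g t + β ^ T * O) / (1 - β ^ T)) :
    IsGLB {c | ∃ T : ℕ, 1 ≤ T ∧ c = waitCost β O g x T} x := by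
  refine IsLeast.isGLB ⟨⟨T, hT, ?_⟩, ?_⟩
  · exact (waitCost_eq_of_finite (pow_lt_one₀ hβ0.le hβ (by omega)).ne hx).symm
  · rintro _ ⟨n, _, rfl⟩
    exact waitCost_ge_of_finite hβ0 hβ ha hg hT h1 h2 hx n

lemma summable_of_weightedSum_le (hβ0 : 0 < β) (hβ : β < 1) (ha : ∀ t, 0 ≤ a t)
    (hg : ∀ t, g t = ∑ s ∈ Finset.range t, a s) (h : ∀ n, weightedSum β a n ≤ O) :
    Summable fun t => β ^ t * g t := by
  refine Summable.of_nonneg_of_le (fun t => mul_nonneg (pow_nonneg hβ0.le t) ?_) (fun t => ?_)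
    ((summable_geometric_of_lt_one hβ0.le hβ).mul_right O)
  · rw [hg]; exact Finset.sum_nonneg fun s _ => ha s
  · refine mul_le_mul_of_nonneg_left ?_ (pow_nonneg hβ0.le t)
    rw [hg]; exact (sum_le_weightedSum hβ0 hβ ha t).trans (h t)

lemma tendsto_waitCost (hβ0 : 0 < β) (hβ : β < 1) (hs : Summable fun t => β ^ t * g t) (y : ℝ) :
    Tendsto (waitCost β O g y) atTop (𝓝 (∑' t, β ^ t * g t)) := by
  have h := hs.hasSum.tendsto_sum_nat.add
    ((tendsto_pow_atTop_nhds_zero_of_lt_one hβ0.le hβ).mul_const (y + O))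
  rw [zero_mul, add_zero] at h
  exact h

/-- Letting `n` tend to infinity in the threshold condition, with `g n` replaced by the smaller `g
T`, gives `g T ≤ (1 - β) (x + O)` for every `T`. Hence `waitCost` decreases to its limit `x`. -/
lemma waitCost_ge_of_infinite (hβ0 : 0 < β) (hβ : β < 1) (ha : ∀ t, 0 ≤ a t)
    (hg : ∀ t, g t = ∑ s ∈ Finset.range t, a s) (h : ∀ n, weightedSum β a n ≤ O)
    (hx : x = ∑' t, β ^ t * g t) (n : ℕ) : x ≤ waitCost β O g x n := by
  have hs := summable_of_weightedSum_le hβ0 hβ ha hg h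
  have hmono : Monotone g := monotone_nat_of_le_succ fun n => by
    rw [hg, hg, Finset.sum_range_succ]; linarith [ha n]
  have hlim := tendsto_waitCost (O := O) hβ0 hβ hs x
  rw [← hx] at hlim
  have hgT : ∀ T, g T ≤ (1 - β) * (x + O) := fun T => by
    have hl : Tendsto (fun n => (1 - β ^ n) / (1 - β) * g T - ∑ t ∈ Finset.range n, β ^ t * g t)
        atTop (𝓝 ((1 - 0) / (1 - β) * g T - x)) := by
      rw [hx]
      exact ((((tendsto_pow_atTop_nhds_zero_of_lt_one hβ0.le hβ).const_sub 1).div_const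
        _).mul_const _).sub hs.hasSum.tendsto_sum_nat
    have hle : (1 - 0) / (1 - β) * g T - x ≤ O := by
      refine le_of_tendsto hl ?_
      filter_upwards [eventually_ge_atTop T] with n hn
      refine le_trans ?_ (h n)
      rw [weightedSum_eq hβ hg]
      have : 0 ≤ (1 - β ^ n) / (1 - β) :=
        div_nonneg (sub_nonneg.2 (pow_le_one₀ hβ0.le hβ.le)) (by linarith)
      linarith [mul_le_mul_of_nonneg_left (hmono hn) this]
    rw [sub_zero, div_mul_eq_mul_div, one_mul, sub_le_iff_le_add, div_le_iff₀ (by linarith)] at hle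
    linarith
  refine Antitone.le_of_tendsto (antitone_nat_of_succ_le fun T => ?_) hlim n
  rw [waitCost_succ]
  have := mul_nonneg (pow_nonneg hβ0.le T) (sub_nonneg.2 (hgT T))
  linarith

/-- Here the infimum is a limit and need not be attained at any finite waiting time. -/
lemma isGLB_waitCost_of_infinite (hβ0 : 0 < β) (hβ : β < 1) (ha : ∀ t, 0 ≤ a t)
    (hg : ∀ t, g t = ∑ s ∈ Finset.range t, a s) (h : ∀ n, weightedSum β a n ≤ O)
    (hx : x = ∑' t, β ^ t * g t) :
    IsGLB {c | ∃ T : ℕ, 1 ≤ T ∧ c = waitCost β O g x T} x := by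
  have hlim := tendsto_waitCost (O := O) hβ0 hβ (summable_of_weightedSum_le hβ0 hβ ha hg h) x
  rw [← hx] at hlim
  refine ⟨?_, fun b hb => ge_of_tendsto hlim ?_⟩
  · rintro _ ⟨n, _, rfl⟩
    exact waitCost_ge_of_infinite hβ0 hβ ha hg h hx n
  · filter_upwards [eventually_ge_atTop 1] with n hn using hb ⟨n, hn, rfl⟩

/-- Since `T ≥ 1`, the infimum depends on the restart value through the factor `β ^ T ≤ β < 1`: a
contraction has at most one fixed point. -/
lemma isGLB_waitCost_unique (hβ0 : 0 < β) (hβ : β < 1) {x y : ℝ}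
    (hx : IsGLB {c | ∃ T : ℕ, 1 ≤ T ∧ c = waitCost β O g x T} x)
    (hy : IsGLB {c | ∃ T : ℕ, 1 ≤ T ∧ c = waitCost β O g y T} y) : x = y := by
  have key : ∀ {x y : ℝ}, IsGLB {c | ∃ T : ℕ, 1 ≤ T ∧ c = waitCost β O g x T} x →
      IsGLB {c | ∃ T : ℕ, 1 ≤ T ∧ c = waitCost β O g y T} y → x ≤ y := by
    intro x y hx hy
    by_contra! hlt
    have : x - β * (x - y) ≤ y := by
      refine hy.2 ?_
      rintro _ ⟨T, hT, rfl⟩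
      have h1 := hx.1 ⟨T, hT, rfl⟩
      have h2 : β ^ T ≤ β := pow_le_of_le_one hβ0.le hβ.le (by omega)
      have h3 := mul_le_mul_of_nonneg_right h2 (sub_nonneg.2 hlt.le)
      simp only [waitCost] at h1 ⊢
      linarith
    nlinarith
  exact le_antisymm (key hx hy) (key hy hx)

/-! ### Sequences of measurement times -/

/-- `L t` is the time of the last measurement up to time `t`, where time `0` counts as one. -/
structure IsLastTime (L : ℕ → ℕ) : Prop where
  zero : L 0 = 0
  succ : ∀ t, L (t + 1) = t + 1 ∨ L (t + 1) = L t

lemma IsLastTime.le {L : ℕ → ℕ} (hL : IsLastTime L) (t : ℕ) : L t ≤ t := by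
  induction t with
  | zero => exact hL.zero.le
  | succ t ih => rcases hL.succ t with h | h <;> omega

lemma IsLastTime.monotone {L : ℕ → ℕ} (hL : IsLastTime L) : Monotone L :=
  monotone_nat_of_le_succ fun t => by
    have := hL.le t
    rcases hL.succ t with h | h <;> omega

/-- The part of the cost at time `t` that depends on the measurement times. -/
noncomputable def lagCost (β O : ℝ) (g : ℕ → ℝ) (L : ℕ → ℕ) (t : ℕ) : ℝ :=
  β ^ t * g (t - L t) + if 0 < t ∧ L t = t then β ^ t * O else 0

/-- Total discounted cost before time `n` of the measurement times `L`. -/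
noncomputable def scheduleCost (β O : ℝ) (g : ℕ → ℝ) (L : ℕ → ℕ) (n : ℕ) : ℝ :=
  ∑ t ∈ Finset.range n, lagCost β O g L t

lemma scheduleCost_succ (L : ℕ → ℕ) (n : ℕ) :
    scheduleCost β O g L (n + 1) = scheduleCost β O g L n + lagCost β O g L n :=
  Finset.sum_range_succ _ _

/-- The second summand is a potential: the value of the open waiting period, less the running cost
already charged to it. It is balanced between measurements, and at a measurement the hypothesis on
`x` says that closing the period cannot bring a gain. -/
lemma IsLastTime.le_scheduleCost_aux {L : ℕ → ℕ} (hL : IsLastTime L) (hβ0 : 0 < β)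
    (hx : ∀ T, 1 ≤ T → x ≤ waitCost β O g x T) (n : ℕ) :
    x ≤ scheduleCost β O g L (n + 1)
      + β ^ L n * (x - ∑ t ∈ Finset.range (n + 1 - L n), β ^ t * g t) := by
  induction n with
  | zero => simp [scheduleCost, lagCost, hL.zero]
  | succ n ih =>
    rw [scheduleCost_succ]
    have hle := hL.le n
    rcases hL.succ n with h | h
    -- The period that has just ended has length `n + 1 - L n ≥ 1`. The running cost at lag zero
    -- appears both in `lagCost` and in the new bracket, and cancels.
    · have h1 := mul_le_mul_of_nonneg_left (hx (n + 1 - L n) (by omega))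
        (pow_nonneg hβ0.le (L n))
      have h2 : β ^ (n + 1) = β ^ L n * β ^ (n + 1 - L n) := by
        rw [← pow_add]; congr 1; omega
      rw [waitCost, mul_add, ← mul_assoc, ← h2] at h1
      simp only [lagCost, h, Nat.sub_self, show n + 1 + 1 - (n + 1) = 1 by omega,
        Finset.sum_range_one, pow_zero, one_mul, and_true, Nat.succ_pos, if_true]
      linarith
    · have h2 : β ^ (n + 1) = β ^ L n * β ^ (n + 1 - L n) := by
        rw [← pow_add]; congr 1; omega
      have h3 : ¬ (0 < n + 1 ∧ L n = n + 1) := by omega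
      rw [lagCost, h, show n + 1 + 1 - L n = (n + 1 - L n) + 1 by omega, Finset.sum_range_succ,
        if_neg h3, h2]
      linarith

/-- Closing the open period at time `n + 1` removes the partial sum from the potential; the error
left over is of order `β ^ (n + 1)`. -/
lemma IsLastTime.le_scheduleCost {L : ℕ → ℕ} (hL : IsLastTime L) (hβ0 : 0 < β)
    (hx : ∀ T, 1 ≤ T → x ≤ waitCost β O g x T) (n : ℕ) :
    x ≤ scheduleCost β O g L (n + 1) + β ^ (n + 1) * (x + O) := by
  have h := hL.le_scheduleCost_aux hβ0 hx n
  have hle := hL.le n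
  have h1 := mul_le_mul_of_nonneg_left (hx (n + 1 - L n) (by omega)) (pow_nonneg hβ0.le (L n))
  have h2 : β ^ (n + 1) = β ^ L n * β ^ (n + 1 - L n) := by
    rw [← pow_add]; congr 1; omega
  rw [waitCost, mul_add, ← mul_assoc, ← h2] at h1
  linarith

/-- The last measurement time up to `t` when measurements are made at all multiples of `T`. -/
noncomputable def periodicLast (T : ℕ∞) (t : ℕ) : ℕ := if T = ⊤ then 0 else t - t % T.toNat

lemma periodicLast_top (t : ℕ) : periodicLast ⊤ t = 0 := by simp [periodicLast]

lemma periodicLast_coe (T t : ℕ) : periodicLast T t = t - t % T := by simp [periodicLast]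

lemma isLastTime_periodicLast {T : ℕ∞} (hT : 1 ≤ T) : IsLastTime (periodicLast T) := by
  induction T with
  | top => exact ⟨periodicLast_top 0, fun t => Or.inr (by simp [periodicLast_top])⟩
  | coe T =>
    have hT' : 0 < T := by exact_mod_cast hT
    refine ⟨by simp [periodicLast_coe], fun t => ?_⟩
    rw [periodicLast_coe, periodicLast_coe]
    have h1 := Nat.mod_lt t hT'
    have h2 : (t + 1) % T = if t % T + 1 = T then 0 else t % T + 1 := by
      rw [Nat.add_mod_eq_ite]
      rcases Nat.lt_or_ge 1 T with h | h
      · rw [Nat.mod_eq_of_lt h]; split_ifs <;> omega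
      -- The period `1` is separate because `1 % T` is then `0`.
      · have : T = 1 := by omega
        subst this; simp [Nat.mod_one]
    rw [h2]
    have := Nat.mod_le t T
    split_ifs <;> omega

lemma periodicLast_eq_self_iff {T : ℕ∞} (hT : 1 ≤ T) {t : ℕ} (ht : 0 < t) :
    periodicLast T t = t ↔ ∃ n : ℕ, T = n ∧ n ∣ t := by
  induction T with
  | top => simp [periodicLast_top]; omega
  | coe T =>
    rw [periodicLast_coe]
    have := Nat.mod_le t T
    constructor
    · intro h
      exact ⟨T, rfl, Nat.dvd_of_mod_eq_zero (by omega)⟩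
    · rintro ⟨n, hn, hd⟩
      obtain rfl : T = n := by exact_mod_cast hn
      rw [Nat.mod_eq_zero_of_dvd hd, Nat.sub_zero]

/-- If the waiting time `T` attains the fixed point `x`, then the periodic schedule costs at
most `x`. -/
lemma scheduleCost_periodicLast_le (hβ0 : 0 < β) (hg : ∀ t, 0 ≤ g t) (hx0 : 0 ≤ x) (hO : 0 ≤ O)
    {T : ℕ∞} (hT : 1 ≤ T) (hfin : ∀ n : ℕ, T = n → waitCost β O g x n = x)
    (hinf : T = ⊤ → ∀ n, ∑ t ∈ Finset.range n, β ^ t * g t ≤ x) (n : ℕ) :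
    scheduleCost β O g (periodicLast T) n ≤ x := by
  have hL := isLastTime_periodicLast hT
  cases n with
  | zero => simpa [scheduleCost] using hx0
  | succ n =>
  -- The open period is no longer than `T`, so the running cost charged to it does not exceed the
  -- cost `x` of a full period with restart.
  have hpart : ∑ t ∈ Finset.range (n + 1 - periodicLast T n), β ^ t * g t ≤ x := by
    induction T with
    | top => exact hinf rfl _
    | coe T =>
      have hT' : 0 < T := by exact_mod_cast hT
      have h1 := Nat.mod_lt n hT'
      have h2 := Nat.mod_le n T
      rw [periodicLast_coe]
      refine (Finset.sum_le_sum_of_subset_of_nonneg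
        (Finset.range_mono (show n + 1 - (n - n % T) ≤ T by omega))
        fun t _ _ => mul_nonneg (pow_nonneg hβ0.le t) (hg t)).trans ?_
      have h3 := hfin T rfl
      have h4 := mul_nonneg (pow_nonneg hβ0.le T) (add_nonneg hx0 hO)
      rw [waitCost] at h3
      linarith
  -- The potential of `le_scheduleCost_aux`, now with equality: every completed period has length
  -- exactly `T`, where the fixed point is attained.
  have key : scheduleCost β O g (periodicLast T) (n + 1) + β ^ periodicLast T n *
      (x - ∑ t ∈ Finset.range (n + 1 - periodicLast T n), β ^ t * g t) = x := by
    clear hpart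
    induction n with
    | zero => simp [scheduleCost, lagCost, hL.zero]
    | succ n ih =>
      rw [scheduleCost_succ]
      set L := periodicLast T with hLdef
      have hle := hL.le n
      have h2 : β ^ (n + 1) = β ^ L n * β ^ (n + 1 - L n) := by
        rw [← pow_add]; congr 1; omega
      rcases hL.succ n with h | h
      · have hper : T = ((n + 1 - L n : ℕ) : ℕ∞) := by
          obtain ⟨k, rfl, hk⟩ := (periodicLast_eq_self_iff hT n.succ_pos).1 h
          have hk' : 0 < k := by exact_mod_cast hT
          simp only [hLdef, periodicLast_coe]
          have h1 := Nat.mod_lt n hk'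
          have h3 := Nat.mod_le n k
          have h5 : n % k + 1 = k := by
            have : k ∣ n % k + 1 := by
              have h6 := Nat.div_add_mod n k
              have : k ∣ k * (n / k) + (n % k + 1) := by rw [← add_assoc, h6]; exact hk
              exact (Nat.dvd_add_right (dvd_mul_right _ _)).1 this
            exact le_antisymm h1 (Nat.le_of_dvd (Nat.succ_pos _) this)
          congr 1
          omega
        have h1 := congrArg (β ^ L n * ·) (hfin _ hper)
        simp only [waitCost, mul_add, ← mul_assoc, ← h2] at h1
        simp only [lagCost, h, Nat.sub_self, show n + 1 + 1 - (n + 1) = 1 by omega,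
          Finset.sum_range_one, pow_zero, one_mul, and_true, Nat.succ_pos, if_true]
        linarith
      · have h3 : ¬ (0 < n + 1 ∧ L n = n + 1) := by omega
        rw [lagCost, h, show n + 1 + 1 - L n = (n + 1 - L n) + 1 by omega, Finset.sum_range_succ,
          if_neg h3, h2]
        linarith
  have := mul_nonneg (pow_nonneg hβ0.le (periodicLast T n)) (sub_nonneg.2 hpart)
  linarith

end Waiting

/-! ### Traces of products of positive semidefinite matrices -/

section Trace

variable {n k : ℕ}

lemma trace_vecMulVec_mul (G : Matrix (Fin n) (Fin n) ℝ) (v : Fin n → ℝ) :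
    (vecMulVec v v * G).trace = quad G v := by
  rw [quad_eq_sum, trace, Finset.sum_comm]
  simp only [diag_apply, mul_apply, vecMulVec_apply]
  exact Finset.sum_congr rfl fun i _ => Finset.sum_congr rfl fun j _ => by ring

/-- Decompose `X` into rank-one terms; each contributes a value of the form `G`. -/
lemma trace_mul_nonneg {X G : Matrix (Fin n) (Fin n) ℝ} (hX : X.PosSemidef)
    (hG : G.PosSemidef) : 0 ≤ (X * G).trace := by
  obtain ⟨r, v, rfl⟩ := Matrix.posSemidef_iff_eq_sum_vecMulVec.1 hX
  rw [Finset.sum_mul, trace_sum]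
  refine Finset.sum_nonneg fun i _ => ?_
  simpa only [star_trivial, trace_vecMulVec_mul] using quad_nonneg hG (v i)

lemma exists_trace_le_mul_trace {G : Matrix (Fin n) (Fin n) ℝ} (hG : G.PosDef) :
    ∃ c : ℝ, 0 < c ∧ ∀ X : Matrix (Fin n) (Fin n) ℝ, X.PosSemidef →
      X.trace ≤ c * (X * G).trace := by
  obtain ⟨c, hc, h⟩ := exists_quad_le_mul hG 1
  refine ⟨c, hc, fun X hX => ?_⟩
  have hpsd : (c • G - 1).PosSemidef := by
    refine posSemidef_of_quad ?_ fun x => ?_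
    · simp [transpose_eq_of_posSemidef hG.posSemidef]
    · rw [quad_sub_left, quad_smul_left]
      linarith [h x]
  have := trace_mul_nonneg hX hpsd
  rw [Matrix.mul_sub, Matrix.mul_one, trace_sub, Matrix.mul_smul, trace_smul, smul_eq_mul] at this
  linarith

lemma PosSemidef.conj_transpose {G : Matrix (Fin n) (Fin n) ℝ} (hG : G.PosSemidef)
    (N : Matrix (Fin k) (Fin n) ℝ) : (N * G * Nᵀ).PosSemidef := by
  simpa using hG.mul_mul_conjTranspose_same N

end Trace

/-! ### Powers of stable and unstable matrices -/

section Stability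

variable {q : ℕ} {A : Matrix (Fin q) (Fin q) ℝ}

/-- Gelfand's formula for the complexified matrix: any `r` between the spectral radius and `1`
eventually bounds the norms of the powers by `r ^ n`, and the row-sum norm bounds the entries. -/
lemma Stable.exists_entry_le (hA : Stable A) :
    ∃ r : ℝ, 0 ≤ r ∧ r < 1 ∧ ∀ᶠ n : ℕ in atTop, ∀ i j, |(A ^ n) i j| ≤ r ^ n := by
  rcases isEmpty_or_nonempty (Fin q) with hq | hq
  · exact ⟨0, le_rfl, one_pos, Eventually.of_forall fun n i => hq.elim i⟩
  let _ : NormedRing (Matrix (Fin q) (Fin q) ℂ) := Matrix.linftyOpNormedRing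
  let _ : NormedAlgebra ℂ (Matrix (Fin q) (Fin q) ℂ) := Matrix.linftyOpNormedAlgebra
  have : CompleteSpace (Matrix (Fin q) (Fin q) ℂ) := FiniteDimensional.complete ℂ _
  set B : Matrix (Fin q) (Fin q) ℂ := A.map (fun a : ℝ => (a : ℂ)) with hB
  have hBn : ∀ n, B ^ n = (A ^ n).map (fun a : ℝ => (a : ℂ)) := fun n =>
    (map_pow (Complex.ofRealHom.mapMatrix (m := Fin q)) A n).symm
  have hrad : spectralRadius ℂ B < (1 : NNReal) :=
    spectrum.spectralRadius_lt_of_forall_lt B fun z hz => by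
      have := hA z hz
      exact_mod_cast this
  obtain ⟨r, hr1, hr2⟩ := ENNReal.lt_iff_exists_nnreal_btwn.1 hrad
  refine ⟨r, r.2, by exact_mod_cast hr2, ?_⟩
  filter_upwards [(spectrum.pow_nnnorm_pow_one_div_tendsto_nhds_spectralRadius B).eventually_lt_const
    hr1, eventually_ge_atTop 1] with n hn hn1 i j
  have hn0 : (n : ℝ) ≠ 0 := by positivity
  have h1 : ‖B ^ n‖₊ ≤ r ^ n := by
    have := ENNReal.rpow_le_rpow hn.le (show (0 : ℝ) ≤ n by positivity)
    rw [← ENNReal.rpow_mul, one_div, inv_mul_cancel₀ hn0, ENNReal.rpow_one,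
      ENNReal.rpow_natCast] at this
    exact_mod_cast this
  have h2 : ‖(B ^ n) i j‖₊ ≤ ‖B ^ n‖₊ := by
    rw [Matrix.linfty_opNNNorm_def]
    refine le_trans ?_ (Finset.le_sup (f := fun i => ∑ j, ‖(B ^ n) i j‖₊) (Finset.mem_univ i))
    exact Finset.single_le_sum (f := fun j => ‖(B ^ n) i j‖₊) (fun _ _ => zero_le)
      (Finset.mem_univ j)
  have h3 : ‖(B ^ n) i j‖ ≤ (r : ℝ) ^ n := by exact_mod_cast h2.trans h1
  rwa [hBn, Matrix.map_apply, Complex.norm_real, Real.norm_eq_abs] at h3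

lemma Stable.tendsto_entry (hA : Stable A) (i j : Fin q) :
    Tendsto (fun n => (A ^ n) i j) atTop (𝓝 0) := by
  obtain ⟨r, hr0, hr1, h⟩ := hA.exists_entry_le
  refine squeeze_zero_norm' (h.mono fun n hn => ?_) (tendsto_pow_atTop_nhds_zero_of_lt_one hr0 hr1)
  simpa using hn i j

/-- If `|z| ≥ 1` for an eigenvalue `z`, then `z ^ n` lies in the spectrum of the `n`-th power, which
keeps the norms of the powers away from zero. -/
lemma not_tendsto_entry_of_not_stable (hA : ¬ Stable A) :
    ¬ ∀ i j, Tendsto (fun n => (A ^ n) i j) atTop (𝓝 0) := by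
  intro h
  rw [Stable] at hA
  push Not at hA
  obtain ⟨z, hz, hz1⟩ := hA
  let _ : NormedRing (Matrix (Fin q) (Fin q) ℂ) := Matrix.linftyOpNormedRing
  let _ : NormedAlgebra ℂ (Matrix (Fin q) (Fin q) ℂ) := Matrix.linftyOpNormedAlgebra
  have : CompleteSpace (Matrix (Fin q) (Fin q) ℂ) := FiniteDimensional.complete ℂ _
  set B : Matrix (Fin q) (Fin q) ℂ := A.map (fun a : ℝ => (a : ℂ)) with hB
  have hBn : ∀ n, B ^ n = (A ^ n).map (fun a : ℝ => (a : ℂ)) := fun n =>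
    (map_pow (Complex.ofRealHom.mapMatrix (m := Fin q)) A n).symm
  have hnorm : ∀ n, ‖B ^ n‖ ≤ ∑ i, ∑ j, |(A ^ n) i j| := fun n => by
    have h1 : ‖B ^ n‖₊ ≤ ∑ i, ∑ j, ‖(A ^ n) i j‖₊ := by
      rw [Matrix.linfty_opNNNorm_def, Finset.sup_le_iff]
      intro i _
      refine le_trans (le_of_eq ?_) (Finset.single_le_sum
        (f := fun i => ∑ j, ‖(A ^ n) i j‖₊) (fun _ _ => zero_le) (Finset.mem_univ i))
      refine Finset.sum_congr rfl fun j _ => ?_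
      rw [hBn, Matrix.map_apply]
      exact Complex.nnnorm_real _
    simpa using NNReal.coe_le_coe.2 h1
  -- The factor `‖1‖` is carried along because this norm is `1` only in positive dimension.
  have hlim : Tendsto (fun n => (∑ i, ∑ j, |(A ^ n) i j|) * ‖(1 : Matrix (Fin q) (Fin q) ℂ)‖)
      atTop (𝓝 0) := by
    have h1 : Tendsto (fun n => ∑ i, ∑ j, |(A ^ n) i j|) atTop
        (𝓝 (∑ i : Fin q, ∑ j : Fin q, |(0 : ℝ)|)) :=
      tendsto_finsetSum _ fun i _ => tendsto_finsetSum _ fun j _ => (h i j).abs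
    simpa using h1.mul_const ‖(1 : Matrix (Fin q) (Fin q) ℂ)‖
  refine absurd (ge_of_tendsto' hlim fun n => ?_) (not_le.2 one_pos)
  calc (1 : ℝ) ≤ ‖z‖ ^ n := one_le_pow₀ hz1
    _ = ‖z ^ n‖ := (norm_pow z n).symm
    _ ≤ ‖B ^ n‖ * ‖(1 : Matrix (Fin q) (Fin q) ℂ)‖ :=
      spectrum.norm_le_norm_mul_of_mem (spectrum.pow_mem_pow B n hz)
    _ ≤ _ := mul_le_mul_of_nonneg_right (hnorm n) (norm_nonneg _)

end Stability

/-! ### The error covariances -/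

section ErrorCov

variable {q p m : ℕ} (D : Data q p m)

/-- The increments of the error covariances. -/
def covIncrement (s : ℕ) : Matrix (Fin q) (Fin q) ℝ :=
  D.A ^ s * (D.C * D.S * D.Cᵀ) * D.Aᵀ ^ s

/-- The increments of the cost of not measuring. -/
noncomputable def lagIncrement (P : Matrix (Fin q) (Fin q) ℝ) (s : ℕ) : ℝ :=
  (covIncrement D s * phi D P).trace

/-- The running cost `t` steps after a measurement. -/
noncomputable def runCost (P : Matrix (Fin q) (Fin q) ℝ) (t : ℕ) : ℝ :=
  (errorCov D t * phi D P).trace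

lemma threshold_eq (P : Matrix (Fin q) (Fin q) ℝ) :
    threshold D P = weightedSum D.β (lagIncrement D P) := rfl

lemma covIncrement_succ (s : ℕ) : covIncrement D (s + 1) = D.A * covIncrement D s * D.Aᵀ := by
  simp only [covIncrement, pow_succ' D.A, pow_succ D.Aᵀ, Matrix.mul_assoc]

/-- Unrolling the recursion exhibits positive semidefinite increments; this is why the running cost
is nondecreasing in the lag. -/
lemma errorCov_eq_sum (t : ℕ) : errorCov D t = ∑ s ∈ Finset.range t, covIncrement D s := by
  induction t with
  | zero => rfl
  | succ t ih =>
    rw [errorCov, ih, Finset.sum_range_succ', Matrix.mul_sum, Matrix.sum_mul]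
    simp only [covIncrement_succ]
    simp [covIncrement]

lemma runCost_eq_sum (P : Matrix (Fin q) (Fin q) ℝ) (t : ℕ) :
    runCost D P t = ∑ s ∈ Finset.range t, lagIncrement D P s := by
  rw [runCost, errorCov_eq_sum, Finset.sum_mul, trace_sum]
  rfl

variable {D} (hD : StandingAssumptions D) {P : Matrix (Fin q) (Fin q) ℝ}
include hD

lemma StandingAssumptions.covIncrement_posSemidef (s : ℕ) : (covIncrement D s).PosSemidef := by
  have := PosSemidef.conj_transpose hD.noise_posDef.posSemidef (D.A ^ s)
  rwa [transpose_pow] at this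

lemma StandingAssumptions.lagIncrement_nonneg (hP : P.PosSemidef) (s : ℕ) :
    0 ≤ lagIncrement D P s :=
  trace_mul_nonneg (hD.covIncrement_posSemidef s) (hD.phi_posSemidef hP)

lemma StandingAssumptions.runCost_nonneg (hP : P.PosSemidef) (t : ℕ) : 0 ≤ runCost D P t := by
  rw [runCost_eq_sum]
  exact Finset.sum_nonneg fun s _ => hD.lagIncrement_nonneg hP s

lemma StandingAssumptions.threshold_mono (hP : P.PosSemidef) : Monotone (threshold D P) :=
  monotone_weightedSum hD.beta_pos hD.beta_lt_one (hD.lagIncrement_nonneg hP)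

lemma StandingAssumptions.exists_threshold
    (h : ∃ n, D.O < threshold D P n) :
    ∃ T : ℕ, 1 ≤ T ∧ threshold D P (T - 1) ≤ D.O ∧ D.O < threshold D P T := by
  classical
  have h0 : Nat.find h ≠ 0 := fun h0 => by
    have := Nat.find_spec h
    rw [h0] at this
    simp only [threshold, Finset.range_zero, Finset.sum_empty] at this
    exact absurd hD.O_nonneg (not_le.2 this)
  exact ⟨Nat.find h, by omega, not_lt.1 (Nat.find_min h (by omega)), Nat.find_spec h⟩

/-- The thresholds increase from `0`, so the half-open intervals between consecutive ones are
disjoint and `O` lies in at most one; if it lies in none, it bounds all thresholds. -/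
lemma StandingAssumptions.existsUnique_thresholdIndex (hP : P.PosSemidef) :
    ∃! T : ℕ∞, IsThresholdIndex D P T := by
  have hmono := hD.threshold_mono hP
  by_cases h : ∃ n, D.O < threshold D P n
  · obtain ⟨T, hT, h1, h2⟩ := hD.exists_threshold h
    refine ⟨T, ⟨by exact_mod_cast hT, fun n hn => ?_, fun hn => by simp at hn⟩, ?_⟩
    · obtain rfl : T = n := by exact_mod_cast hn
      exact ⟨h1, h2⟩
    · rintro T' ⟨hT', hfin, hinf⟩
      induction T' with
      | top => exact absurd h2 (not_lt.2 (hinf rfl T))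
      | coe T' =>
        obtain ⟨h1', h2'⟩ := hfin T' rfl
        congr 1
        by_contra hne
        rcases Nat.lt_or_gt_of_ne hne with hlt | hlt
        · exact absurd ((h2'.trans_le (hmono (show T' ≤ T - 1 by omega))).trans_le h1)
            (lt_irrefl _)
        · exact absurd ((h2.trans_le (hmono (show T ≤ T' - 1 by omega))).trans_le h1')
            (lt_irrefl _)
  · push Not at h
    refine ⟨⊤, ⟨le_top, fun n hn => by simp at hn, fun _ => h⟩, ?_⟩
    rintro T' ⟨-, hfin, -⟩
    induction T' with
    | top => rfl
    | coe T' => exact absurd (hfin T' rfl).2 (not_lt.2 (h T'))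

/-- Bounded thresholds would make the increments summable, as all weights are at least `1`. Positive
definiteness of `φ` and of the noise covariance lets the increments dominate the squared entries of
`A ^ n`, so that `A ^ n` would tend to zero. -/
lemma StandingAssumptions.exists_lt_threshold_of_not_stable (hP : P.PosSemidef)
    (hA : ¬ Stable D.A) (hphi : (phi D P).PosDef) : ∃ n, D.O < threshold D P n := by
  by_contra! h
  have ha := hD.lagIncrement_nonneg hP
  have hsum : Summable (lagIncrement D P) := summable_of_sum_range_le ha fun n =>
    (sum_le_weightedSum hD.beta_pos hD.beta_lt_one ha n).trans (h n)
  obtain ⟨c₁, hc₁, h₁⟩ := exists_trace_le_mul_trace hphi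
  obtain ⟨c₂, hc₂, h₂⟩ := exists_trace_le_mul_trace hD.noise_posDef
  have hsq : ∀ n i j, ((D.A ^ n) i j) ^ 2 ≤ c₂ * (c₁ * lagIncrement D P n) := fun n i j => by
    have hX : ((D.A ^ n)ᵀ * D.A ^ n).PosSemidef := by
      simpa using Matrix.posSemidef_conjTranspose_mul_self (D.A ^ n)
    have e1 : ((D.A ^ n)ᵀ * D.A ^ n).trace = ∑ j, ∑ i, ((D.A ^ n) i j) ^ 2 := by
      simp only [trace, diag_apply, mul_apply, transpose_apply, sq]
    have e2 : (((D.A ^ n)ᵀ * D.A ^ n) * (D.C * D.S * D.Cᵀ)).trace = (covIncrement D n).trace := by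
      rw [Matrix.mul_assoc, trace_mul_comm, covIncrement, transpose_pow]
    have h3 : ((D.A ^ n) i j) ^ 2 ≤ ∑ j, ∑ i, ((D.A ^ n) i j) ^ 2 :=
      (Finset.single_le_sum (f := fun i => ((D.A ^ n) i j) ^ 2) (fun _ _ => sq_nonneg _)
        (Finset.mem_univ i)).trans (Finset.single_le_sum
        (f := fun j => ∑ i, ((D.A ^ n) i j) ^ 2)
        (fun _ _ => Finset.sum_nonneg fun _ _ => sq_nonneg _) (Finset.mem_univ j))
    rw [← e1] at h3
    refine h3.trans ((h₂ _ hX).trans (mul_le_mul_of_nonneg_left ?_ hc₂.le))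
    rw [e2]
    exact h₁ _ (hD.covIncrement_posSemidef n)
  refine not_tendsto_entry_of_not_stable hA fun i j => ?_
  have hlim : Tendsto (fun n => c₂ * (c₁ * lagIncrement D P n)) atTop (𝓝 0) := by
    simpa using (hsum.tendsto_atTop_zero.const_mul c₁).const_mul c₂
  have hsq0 := squeeze_zero (fun n => sq_nonneg ((D.A ^ n) i j)) (fun n => hsq n i j) hlim
  have := hsq0.sqrt
  simp only [Real.sqrt_sq_eq_abs, Real.sqrt_zero] at this
  exact (tendsto_zero_iff_abs_tendsto_zero _).2 this

omit hD in
/-- If `A` is stable, the error covariances converge to the unique solution of the Lyapunov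
equation. -/
lemma exists_lyapunov (hA : Stable D.A) :
    ∃ W : Matrix (Fin q) (Fin q) ℝ, SolvesLyapunov D W ∧
      (∀ W' : Matrix (Fin q) (Fin q) ℝ, SolvesLyapunov D W' → W' = W) ∧
      Tendsto (errorCov D) atTop (𝓝 W) := by
  obtain ⟨r, hr0, hr1, hr⟩ := hA.exists_entry_le
  have hsum : ∀ i j, Summable fun s => covIncrement D s i j := fun i j => by
    -- One of the two powers of `A` gives the geometric factor; bounding the other by `1` is enough.
    have hb : ∀ᶠ s in atTop, ‖covIncrement D s i j‖
        ≤ (∑ k, ∑ l, |(D.C * D.S * D.Cᵀ) l k|) * r ^ s := by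
      filter_upwards [hr] with s hs
      have hrs : r ^ s ≤ 1 := pow_le_one₀ hr0 hr1.le
      rw [covIncrement, mul_apply, Real.norm_eq_abs, Finset.sum_mul]
      refine (Finset.abs_sum_le_sum_abs _ _).trans (Finset.sum_le_sum fun k _ => ?_)
      rw [mul_apply, Finset.sum_mul, Finset.sum_mul, ← transpose_pow, transpose_apply]
      refine (Finset.abs_sum_le_sum_abs _ _).trans (Finset.sum_le_sum fun l _ => ?_)
      rw [abs_mul, abs_mul]
      have h1 := hs i l
      have h2 := (hs j k).trans hrs
      calc |(D.A ^ s) i l| * |(D.C * D.S * D.Cᵀ) l k| * |(D.A ^ s) j k|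
          ≤ r ^ s * |(D.C * D.S * D.Cᵀ) l k| * 1 := by gcongr
        _ = _ := by ring
    exact Summable.of_norm_bounded_eventually_nat
      ((summable_geometric_of_lt_one hr0 hr1).mul_left _) hb
  set W : Matrix (Fin q) (Fin q) ℝ := fun i j => ∑' s, covIncrement D s i j
  have hlim : Tendsto (errorCov D) atTop (𝓝 W) := by
    refine tendsto_pi_nhds.2 fun i => tendsto_pi_nhds.2 fun j => ?_
    refine (hsum i j).hasSum.tendsto_sum_nat.congr fun n => ?_
    rw [errorCov_eq_sum, Matrix.sum_apply]
  have hW : SolvesLyapunov D W := by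
    have hc : Continuous fun X : Matrix (Fin q) (Fin q) ℝ =>
        D.A * X * D.Aᵀ + D.C * D.S * D.Cᵀ := by fun_prop
    have h1 := tendsto_nhds_unique (hlim.comp (tendsto_add_atTop_nat 1))
      ((hc.tendsto W).comp hlim)
    rw [SolvesLyapunov, sub_eq_iff_eq_add']
    exact h1
  refine ⟨W, hW, fun W' hW' => ?_, hlim⟩
  set E := W' - W with hE
  have hfix : E = D.A * E * D.Aᵀ := by
    rw [SolvesLyapunov] at hW hW'
    rw [hE, Matrix.mul_sub, Matrix.sub_mul]
    have := hW'.trans hW.symm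
    rw [sub_eq_sub_iff_sub_eq_sub] at this
    exact this
  -- The difference of two solutions is invariant under `E ↦ A E A'`, while iterating this map sends
  -- it to zero.
  have hpow : ∀ n, E = D.A ^ n * E * D.Aᵀ ^ n := fun n => by
    induction n with
    | zero => simp
    | succ n ih =>
      conv_lhs => rw [hfix, ih]
      simp only [pow_succ' D.A, pow_succ D.Aᵀ, Matrix.mul_assoc]
  have hA0 : Tendsto (fun n => D.A ^ n) atTop (𝓝 0) :=
    tendsto_pi_nhds.2 fun i => tendsto_pi_nhds.2 fun j => hA.tendsto_entry i j
  have hE0 : Tendsto (fun n => D.A ^ n * E * D.Aᵀ ^ n) atTop (𝓝 0) := by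
    have hc : Continuous fun X : Matrix (Fin q) (Fin q) ℝ => X * E * Xᵀ := by fun_prop
    have := (hc.tendsto 0).comp hA0
    simpa [Function.comp_def, transpose_pow] using this
  exact sub_eq_zero.1 (tendsto_nhds_unique (tendsto_const_nhds.congr hpow) hE0)

/-- The running cost increases to `Tr (W φ)`, and the limit is taken in `weightedSum_eq`. It is the
smallest price at which measuring never pays. -/
lemma StandingAssumptions.summable_and_tendsto_threshold (hP : P.PosSemidef)
    {W : Matrix (Fin q) (Fin q) ℝ} (hW : Tendsto (errorCov D) atTop (𝓝 W)) :
    Summable (fun t => D.β ^ t * runCost D P t) ∧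
      Tendsto (threshold D P) atTop
        (𝓝 ((W * phi D P).trace / (1 - D.β) - ∑' t, D.β ^ t * runCost D P t)) := by
  have hg : Tendsto (runCost D P) atTop (𝓝 (W * phi D P).trace) := by
    have hc : Continuous fun X : Matrix (Fin q) (Fin q) ℝ => (X * phi D P).trace := by fun_prop
    exact (hc.tendsto W).comp hW
  have hmono : Monotone (runCost D P) := monotone_nat_of_le_succ fun n => by
    rw [runCost_eq_sum, runCost_eq_sum, Finset.sum_range_succ]
    linarith [hD.lagIncrement_nonneg hP n]
  have hs : Summable (fun t => D.β ^ t * runCost D P t) :=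
    Summable.of_nonneg_of_le
      (fun t => mul_nonneg (pow_nonneg hD.beta_pos.le t) (hD.runCost_nonneg hP t))
      (fun t => mul_le_mul_of_nonneg_left (hmono.ge_of_tendsto hg t)
        (pow_nonneg hD.beta_pos.le t))
      ((summable_geometric_of_lt_one hD.beta_pos.le hD.beta_lt_one).mul_right _)
  refine ⟨hs, ?_⟩
  have h1 := (((tendsto_pow_atTop_nhds_zero_of_lt_one hD.beta_pos.le hD.beta_lt_one).const_sub
    1).div_const (1 - D.β)).mul hg |>.sub hs.hasSum.tendsto_sum_nat
  rw [sub_zero, div_mul_eq_mul_div, one_mul] at h1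
  refine h1.congr fun n => ?_
  rw [threshold_eq, weightedSum_eq hD.beta_lt_one (runCost_eq_sum D P)]

end ErrorCov

/-! ### Quadratic forms of centered random vectors -/

section Centered

variable {Ω : Type*} [MeasurableSpace Ω] {Pr : Measure Ω} {n k : ℕ}

/-- A square-integrable random vector with mean zero. -/
structure IsCentered (Pr : Measure Ω) (e : Ω → Fin n → ℝ) : Prop where
  measurable : Measurable e
  memLp : ∀ i, MemLp (fun ω => e ω i) 2 Pr
  mean_zero : ∀ i, ∫ ω, e ω i ∂Pr = 0

lemma measurable_mulVec (N : Matrix (Fin k) (Fin n) ℝ) : Measurable fun x => N *ᵥ x :=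
  (by fun_prop : Continuous fun x => N *ᵥ x).measurable

lemma measurable_ofReal_quad (G : Matrix (Fin n) (Fin n) ℝ) :
    Measurable fun x => ENNReal.ofReal (quad G x) :=
  (continuous_quad G).measurable.ennreal_ofReal

namespace IsCentered

variable {e f : Ω → Fin n → ℝ}

protected lemma zero : IsCentered Pr (fun _ => (0 : Fin n → ℝ)) :=
  ⟨measurable_const, fun i => by simp, fun i => by simp⟩

lemma add [IsFiniteMeasure Pr] (he : IsCentered Pr e) (hf : IsCentered Pr f) :
    IsCentered Pr (fun ω => e ω + f ω) := by
  refine ⟨he.measurable.add hf.measurable, fun i => (he.memLp i).add (hf.memLp i), fun i => ?_⟩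
  simp only [Pi.add_apply]
  rw [integral_add ((he.memLp i).integrable one_le_two) ((hf.memLp i).integrable one_le_two),
    he.mean_zero, hf.mean_zero, add_zero]

lemma mulVec [IsFiniteMeasure Pr] (he : IsCentered Pr e) (N : Matrix (Fin k) (Fin n) ℝ) :
    IsCentered Pr (fun ω => N *ᵥ e ω) := by
  refine ⟨(measurable_mulVec N).comp he.measurable, fun i => ?_, fun i => ?_⟩
  · simp only [Matrix.mulVec, dotProduct]
    exact memLp_finsetSum _ fun j _ => (he.memLp j).const_mul _
  · simp only [Matrix.mulVec, dotProduct]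
    rw [integral_finsetSum _ fun j _ => ((he.memLp j).integrable one_le_two).const_mul _]
    simp [integral_const_mul, he.mean_zero]

lemma integrable_mul (he : IsCentered Pr e) (i j : Fin n) :
    Integrable (fun ω => e ω i * e ω j) Pr := (he.memLp i).integrable_mul (he.memLp j)

lemma integrable_quad (he : IsCentered Pr e) (G : Matrix (Fin n) (Fin n) ℝ) :
    Integrable (fun ω => quad G (e ω)) Pr := by
  simp only [quad_eq_sum]
  exact integrable_finsetSum _ fun i _ => integrable_finsetSum _ fun j _ =>
    (he.integrable_mul i j).const_mul _

lemma integral_quad (he : IsCentered Pr e) (G : Matrix (Fin n) (Fin n) ℝ) :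
    ∫ ω, quad G (e ω) ∂Pr = ∑ i, ∑ j, G i j * ∫ ω, e ω i * e ω j ∂Pr := by
  simp only [quad_eq_sum]
  refine (integral_finsetSum _ fun i _ => integrable_finsetSum _ fun j _ =>
    (he.integrable_mul i j).const_mul _).trans ?_
  refine Finset.sum_congr rfl fun i _ => ?_
  rw [integral_finsetSum _ fun j _ => (he.integrable_mul i j).const_mul _]
  simp only [integral_const_mul]

lemma lintegral_quad_const_add [IsProbabilityMeasure Pr] (he : IsCentered Pr e)
    {G : Matrix (Fin n) (Fin n) ℝ} (hG : G.PosSemidef) (v : Fin n → ℝ) :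
    ∫⁻ ω, ENNReal.ofReal (quad G (v + e ω)) ∂Pr
      = ENNReal.ofReal (quad G v) + ∫⁻ ω, ENNReal.ofReal (quad G (e ω)) ∂Pr := by
  have hGt := transpose_eq_of_posSemidef hG
  have hlin : Integrable (fun ω => v ⬝ᵥ G *ᵥ e ω) Pr ∧ ∫ ω, v ⬝ᵥ G *ᵥ e ω ∂Pr = 0 := by
    have hGe := he.mulVec G
    have hi : ∀ i, Integrable (fun ω => v i * (G *ᵥ e ω) i) Pr := fun i =>
      ((hGe.memLp i).integrable one_le_two).const_mul _
    simp only [dotProduct]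
    refine ⟨integrable_finsetSum _ fun i _ => hi i, ?_⟩
    rw [integral_finsetSum _ fun i _ => hi i]
    simp only [integral_const_mul, hGe.mean_zero, mul_zero, Finset.sum_const_zero]
  have hq := he.integrable_quad G
  have haff : Integrable (fun ω => quad G v + 2 * (v ⬝ᵥ G *ᵥ e ω)) Pr :=
    (integrable_const _).add (hlin.1.const_mul 2)
  have hsum : Integrable (fun ω => quad G (v + e ω)) Pr := by
    simp only [quad_add_right hGt]
    exact haff.add hq
  rw [← ofReal_integral_eq_lintegral_ofReal hsum (ae_of_all _ fun ω => quad_nonneg hG _),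
    ← ofReal_integral_eq_lintegral_ofReal hq (ae_of_all _ fun ω => quad_nonneg hG _),
    ← ENNReal.ofReal_add (quad_nonneg hG v) (integral_nonneg fun ω => quad_nonneg hG _)]
  congr 1
  simp only [quad_add_right hGt]
  rw [integral_add haff hq,
    integral_add (integrable_const _) (hlin.1.const_mul 2), integral_const_mul, hlin.2]
  simp

end IsCentered

lemma lintegral_indepFun [IsProbabilityMeasure Pr] {α γ : Type*} [MeasurableSpace α]
    [MeasurableSpace γ] {X : Ω → α} {Y : Ω → γ} (hX : Measurable X) (hY : Measurable Y)
    (hXY : IndepFun X Y Pr) {F : α × γ → ℝ≥0∞} (hF : Measurable F) :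
    ∫⁻ ω, F (X ω, Y ω) ∂Pr = ∫⁻ ω, ∫⁻ ω', F (X ω, Y ω') ∂Pr ∂Pr := by
  have : IsProbabilityMeasure (Pr.map Y) := Measure.isProbabilityMeasure_map hY.aemeasurable
  have h := (indepFun_iff_map_prod_eq_prod_map_map hX.aemeasurable hY.aemeasurable).1 hXY
  rw [← lintegral_map (f := F) hF (hX.prodMk hY), h, lintegral_prod _ hF.aemeasurable,
    lintegral_map hF.lintegral_prod_right' hX]
  refine lintegral_congr fun ω => ?_
  exact lintegral_map (hF.comp measurable_prodMk_left) hY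

/-- Adding an independent centered vector to a random vector adds its own contribution to the
expectation of a quadratic form, on every event independent of it. -/
lemma setLIntegral_quad_add [IsProbabilityMeasure Pr] {α : Type*} [MeasurableSpace α]
    {X : Ω → α} {e : Ω → Fin n → ℝ} (hX : Measurable X) (he : IsCentered Pr e)
    (hXe : IndepFun X e Pr) {f : α → Fin n → ℝ} (hf : Measurable f) {s : Set α}
    (hs : MeasurableSet s) {G : Matrix (Fin n) (Fin n) ℝ} (hG : G.PosSemidef) :
    ∫⁻ ω in X ⁻¹' s, ENNReal.ofReal (quad G (f (X ω) + e ω)) ∂Pr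
      = ∫⁻ ω in X ⁻¹' s, ENNReal.ofReal (quad G (f (X ω))) ∂Pr
        + Pr (X ⁻¹' s) * ∫⁻ ω, ENNReal.ofReal (quad G (e ω)) ∂Pr := by
  have hF : Measurable fun z : α × (Fin n → ℝ) =>
      (s ×ˢ Set.univ).indicator (fun z => ENNReal.ofReal (quad G (f z.1 + z.2))) z :=
    ((measurable_ofReal_quad G).comp ((hf.comp measurable_fst).add measurable_snd)).indicator
      (hs.prod .univ)
  have h := lintegral_indepFun hX he.measurable hXe hF
  rw [← lintegral_indicator (hX hs)]
  have h1 : ∀ ω, (X ⁻¹' s).indicator (fun ω => ENNReal.ofReal (quad G (f (X ω) + e ω))) ω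
      = (s ×ˢ Set.univ).indicator (fun z : α × (Fin n → ℝ) =>
        ENNReal.ofReal (quad G (f z.1 + z.2))) (X ω, e ω) := fun ω => by
    by_cases hω : X ω ∈ s <;> simp [Set.indicator, hω]
  have hm : Measurable fun ω => ENNReal.ofReal (quad G (f (X ω))) :=
    (measurable_ofReal_quad G).comp (hf.comp hX)
  rw [lintegral_congr h1, h, mul_comm, ← setLIntegral_const, ← lintegral_add_left hm, ← lintegral_indicator (hX hs)]
  refine lintegral_congr fun ω => ?_
  by_cases hω : X ω ∈ s
  · simp [Set.indicator, hω, he.lintegral_quad_const_add hG]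
  · simp [Set.indicator, hω]

end Centered

/-! ### The noise -/

section Noise

variable {q p m : ℕ}

/-- The noise path that agrees with `w` on `I` and vanishes elsewhere. -/
def mask (I : Finset ℕ) (w : ℕ → Fin m → ℝ) : ℕ → Fin m → ℝ := fun j => if j ∈ I then w j else 0

lemma mask_of_mem {I : Finset ℕ} {j : ℕ} (hj : j ∈ I) (w : ℕ → Fin m → ℝ) : mask I w j = w j :=
  if_pos hj

/-- The estimation error at time `s + n` caused by the noise at times `s, …, s + n - 1`. -/
def err (D : Data q p m) (s : ℕ) (w : ℕ → Fin m → ℝ) : ℕ → Fin q → ℝ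
  | 0 => 0
  | n + 1 => D.A *ᵥ err D s w n + D.C *ᵥ w (s + n)

variable (D : Data q p m)

lemma err_congr {s n : ℕ} {w w' : ℕ → Fin m → ℝ} (h : ∀ j, s ≤ j → j < s + n → w j = w' j) :
    err D s w n = err D s w' n := by
  induction n with
  | zero => rfl
  | succ n ih =>
    rw [err, err, ih fun j h1 h2 => h j h1 (by omega), h (s + n) (by omega) (by omega)]

lemma err_mask (s n : ℕ) (w : ℕ → Fin m → ℝ) :
    err D s (mask (Finset.Ico s (s + n)) w) n = err D s w n :=
  err_congr D fun _ h1 h2 => mask_of_mem (Finset.mem_Ico.2 ⟨h1, h2⟩) w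

lemma measurable_err (s n : ℕ) : Measurable fun w => err D s w n := by
  induction n with
  | zero => exact measurable_const
  | succ n ih =>
    exact ((measurable_mulVec _).comp ih).add ((measurable_mulVec _).comp (measurable_pi_apply _))

variable {Ω : Type*} [MeasurableSpace Ω] {Pr : Measure Ω} {S : Matrix (Fin m) (Fin m) ℝ}
  {w : ℕ → Ω → (Fin m → ℝ)}

lemma measurable_mask (I : Finset ℕ) : Measurable (mask (m := m) I) := by
  refine measurable_pi_lambda _ fun j => ?_
  by_cases hj : j ∈ I
  · simpa [mask, hj] using measurable_pi_apply j
  · simp [mask, hj]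

namespace IsGaussianWhiteNoise

lemma measurable_path (hw : IsGaussianWhiteNoise Pr S w) :
    Measurable fun ω => fun s => w s ω := measurable_pi_lambda _ hw.measurable

lemma indepFun_mask (hw : IsGaussianWhiteNoise Pr S w) {I K : Finset ℕ} (h : Disjoint I K) :
    IndepFun (fun ω => mask I fun s => w s ω) (fun ω => mask K fun s => w s ω) Pr := by
  have hext : ∀ I : Finset ℕ, Measurable fun (z : I → Fin m → ℝ) (j : ℕ) =>
      if hj : j ∈ I then z ⟨j, hj⟩ else 0 := fun I => by
    refine measurable_pi_lambda _ fun j => ?_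
    by_cases hj : j ∈ I
    · simpa [hj] using measurable_pi_apply _
    · simp [hj]
  exact (hw.indep.indepFun_finset I K h hw.measurable).comp (hext I) (hext K)

lemma isCentered [IsProbabilityMeasure Pr] (hw : IsGaussianWhiteNoise Pr S w) (t : ℕ) :
    IsCentered Pr (w t) := by
  refine ⟨hw.measurable t, fun i => ?_, hw.mean_zero t⟩
  have := hw.gaussian t
  have h1 : MemLp (w t) 2 Pr := by
    have h := IsGaussian.memLp_two_id (μ := Pr.map (w t))
    rwa [memLp_map_measure_iff h.1 (hw.measurable t).aemeasurable] at h
  exact memLp_pi_iff.1 h1 i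

lemma lintegral_quad_noise [IsProbabilityMeasure Pr] (hw : IsGaussianWhiteNoise Pr D.S w)
    {G : Matrix (Fin q) (Fin q) ℝ} (hG : G.PosSemidef) (t : ℕ) :
    ∫⁻ ω, ENNReal.ofReal (quad G (D.C *ᵥ w t ω)) ∂Pr
      = ENNReal.ofReal (D.C * D.S * D.Cᵀ * G).trace := by
  have hc := hw.isCentered t
  have hGt := transpose_eq_of_posSemidef hG
  rw [← ofReal_integral_eq_lintegral_ofReal ((hc.mulVec D.C).integrable_quad G)
    (ae_of_all _ fun ω => quad_nonneg hG _)]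
  congr 1
  simp only [← quad_conj]
  rw [hc.integral_quad]
  have h1 : (D.C * D.S * D.Cᵀ * G).trace = (D.S * (D.Cᵀ * G * D.C)).trace := by
    rw [Matrix.mul_assoc, Matrix.mul_assoc, trace_mul_comm]
    simp only [Matrix.mul_assoc]
  have h2 : (D.Cᵀ * G * D.C)ᵀ = D.Cᵀ * G * D.C := by
    simp [hGt, Matrix.mul_assoc]
  rw [h1, trace]
  simp only [diag_apply, Matrix.mul_apply (M := D.S)]
  refine Finset.sum_congr rfl fun i _ => Finset.sum_congr rfl fun j _ => ?_
  rw [hw.cov, mul_comm]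
  congr 1
  exact (congrFun (congrFun h2 i) j).symm

lemma isCentered_err [IsProbabilityMeasure Pr] (hw : IsGaussianWhiteNoise Pr S w) (s n : ℕ) :
    IsCentered Pr fun ω => err D s (fun t => w t ω) n := by
  induction n with
  | zero => exact IsCentered.zero
  | succ n ih => exact (ih.mulVec D.A).add ((hw.isCentered (s + n)).mulVec D.C)

lemma lintegral_quad_err [IsProbabilityMeasure Pr] (hw : IsGaussianWhiteNoise Pr D.S w)
    (hN : (D.C * D.S * D.Cᵀ).PosSemidef) {G : Matrix (Fin q) (Fin q) ℝ} (hG : G.PosSemidef)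
    (s n : ℕ) :
    ∫⁻ ω, ENNReal.ofReal (quad G (err D s (fun t => w t ω) n)) ∂Pr
      = ENNReal.ofReal (errorCov D n * G).trace := by
  induction n generalizing G with
  | zero => simp [err, errorCov]
  | succ n ih =>
    have hcov : (errorCov D n).PosSemidef := by
      clear ih
      induction n with
      | zero => exact Matrix.PosSemidef.zero
      | succ n ih => exact (PosSemidef.conj_transpose ih D.A).add hN
    have hGA : (D.Aᵀ * G * D.A).PosSemidef := by simpa using hG.conjTranspose_mul_mul_same D.A
    have hX := (measurable_mask (Finset.Ico s (s + n))).comp hw.measurable_path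
    have hind : IndepFun (fun ω => mask (Finset.Ico s (s + n)) fun t => w t ω)
        (fun ω => D.C *ᵥ w (s + n) ω) Pr := by
      have h := (hw.indepFun_mask (I := Finset.Ico s (s + n)) (K := {s + n})
        (by simp)).comp measurable_id
        ((measurable_mulVec D.C).comp (measurable_pi_apply (s + n)))
      simpa [Function.comp_def, mask_of_mem] using h
    have key := setLIntegral_quad_add hX ((hw.isCentered (s + n)).mulVec D.C) hind
      (f := fun v => D.A *ᵥ err D s v n) ((measurable_mulVec D.A).comp (measurable_err D s n))
      MeasurableSet.univ hG
    simp only [Set.preimage_univ, Measure.restrict_univ, measure_univ, one_mul,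
      Function.comp_apply, err_mask] at key
    simp only [err]
    rw [key, hw.lintegral_quad_noise D hG]
    simp only [← quad_conj]
    rw [ih hGA, ← ENNReal.ofReal_add (trace_mul_nonneg hcov hGA) (trace_mul_nonneg hN hG),
      errorCov, Matrix.add_mul, trace_add]
    congr 2
    simp only [Matrix.mul_assoc]
    rw [trace_mul_comm D.A]
    simp only [Matrix.mul_assoc]

end IsGaussianWhiteNoise

end Noise

/-! ### Controlled systems with intermittent measurements -/

/-- A controlled system, as a function of the noise path `w`: states `X`, controls `U`, and the
time `L` of the last measurement. What the controller knows at time `t` depends only on the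
noise before the last measurement. -/
structure ClosedLoop {q p m : ℕ} (D : Data q p m) (x₀ : Fin q → ℝ) where
  X : (ℕ → Fin m → ℝ) → ℕ → Fin q → ℝ
  U : (ℕ → Fin m → ℝ) → ℕ → Fin p → ℝ
  L : (ℕ → Fin m → ℝ) → ℕ → ℕ
  X_zero : ∀ w, X w 0 = x₀
  X_succ : ∀ w t, X w (t + 1) = step D (X w t) (U w t) (w t)
  isLastTime : ∀ w, IsLastTime (L w)
  measurable_X : ∀ t, Measurable fun w => X w t
  measurable_U : ∀ t, Measurable fun w => U w t
  measurable_L : ∀ t, Measurable fun w => L w t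
  causal : ∀ w w' t, (∀ j < L w t, w j = w' j) → L w' t = L w t ∧ U w' t = U w t

namespace ClosedLoop

variable {q p m : ℕ} {D : Data q p m} {x₀ : Fin q → ℝ} (c : ClosedLoop D x₀)

lemma X_congr {w w' : ℕ → Fin m → ℝ} {t : ℕ} (h : ∀ j < t, w j = w' j) :
    c.X w' t = c.X w t := by
  induction t with
  | zero => rw [c.X_zero, c.X_zero]
  | succ t ih =>
    have hle := (c.isLastTime w).le t
    rw [c.X_succ, c.X_succ, ih fun j hj => h j (by omega), ← h t (by omega),
      (c.causal w w' t fun j hj => h j (by omega)).2]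

lemma U_mask (w : ℕ → Fin m → ℝ) (t : ℕ) : c.U (mask (Finset.range t) w) t = c.U w t :=
  (c.causal w _ t fun _ hj => (mask_of_mem (Finset.mem_range.2
    (hj.trans_le ((c.isLastTime w).le t))) w).symm).2

lemma X_mask (w : ℕ → Fin m → ℝ) (t : ℕ) : c.X (mask (Finset.range t) w) t = c.X w t :=
  c.X_congr fun _ hj => (mask_of_mem (Finset.mem_range.2 hj) w).symm

lemma U_mask_last {w : ℕ → Fin m → ℝ} {s t : ℕ} (hs : c.L w t ≤ s) :
    c.U (mask (Finset.range s) w) t = c.U w t :=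
  (c.causal w _ t fun _ hj => (mask_of_mem (Finset.mem_range.2 (hj.trans_le hs)) w).symm).2

lemma L_mask_iff (w : ℕ → Fin m → ℝ) (s t : ℕ) :
    c.L (mask (Finset.range s) w) t = s ↔ c.L w t = s := by
  constructor
  · intro h
    have := (c.causal (mask (Finset.range s) w) w t fun j hj => by
      rw [h] at hj
      exact mask_of_mem (Finset.mem_range.2 hj) w).1
    rw [this, h]
  · intro h
    have := (c.causal w (mask (Finset.range s) w) t fun j hj => by
      rw [h] at hj
      exact (mask_of_mem (Finset.mem_range.2 hj) w).symm).1
    rw [this, h]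

/-- The state is the sum of its prediction from the last measurement and of the error. -/
lemma X_eq_add_err (w : ℕ → Fin m → ℝ) (t : ℕ) :
    c.X w t = c.X (mask (Finset.range (c.L w t)) w) t + err D (c.L w t) w (t - c.L w t) := by
  set s := c.L w t with hs
  have hst : s ≤ t := (c.isLastTime w).le t
  have key : ∀ k, s + k ≤ t →
      c.X w (s + k) = c.X (mask (Finset.range s) w) (s + k) + err D s w k := by
    intro k
    induction k with
    | zero => intro _; simp [c.X_mask, err]
    | succ k ih =>
      intro hk
      have hL : c.L w (s + k) ≤ s := (c.isLastTime w).monotone (show s + k ≤ t by omega)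
      have h0 : mask (Finset.range s) w (s + k) = 0 := by simp [mask]
      rw [← add_assoc, c.X_succ, c.X_succ, ih (by omega), c.U_mask_last hL, h0, err, step, step,
        mulVec_add, mulVec_zero]
      abel
  have := key (t - s) (by omega)
  rwa [Nat.add_sub_cancel' hst] at this

variable {Ω : Type*} [MeasurableSpace Ω] (Pr : Measure Ω) (w : ℕ → Ω → (Fin m → ℝ))

/-- The expected value of the quadratic form `G` at time `t`. -/
noncomputable def expQuad (G : Matrix (Fin q) (Fin q) ℝ) (t : ℕ) : ℝ≥0∞ :=
  ∫⁻ ω, ENNReal.ofReal (quad G (c.X (fun s => w s ω) t)) ∂Pr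

/-- The expected stage cost of state and control at time `t`. -/
noncomputable def expStage (t : ℕ) : ℝ≥0∞ :=
  ∫⁻ ω, ENNReal.ofReal (quad D.Q (c.X (fun s => w s ω) t) + quad D.R (c.U (fun s => w s ω) t)) ∂Pr

/-- The expected loss incurred at time `t` by not applying the optimal feedback. -/
noncomputable def expLoss (P : Matrix (Fin q) (Fin q) ℝ) (t : ℕ) : ℝ≥0∞ :=
  ∫⁻ ω, ENNReal.ofReal (quad (gainWeight D P)
    (c.U (fun s => w s ω) t + gain D P *ᵥ c.X (fun s => w s ω) t)) ∂Pr

/-- The measurement cost at time `t`. -/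
noncomputable def measureCost (v : ℕ → Fin m → ℝ) (t : ℕ) : ℝ≥0∞ :=
  if 0 < t ∧ c.L v t = t then ENNReal.ofReal (D.β ^ t * D.O) else 0

/-- The expected cost. -/
noncomputable def cost : ℝ≥0∞ :=
  ∫⁻ ω, ∑' t, (ENNReal.ofReal (D.β ^ t * (quad D.Q (c.X (fun s => w s ω) t)
    + quad D.R (c.U (fun s => w s ω) t))) + c.measureCost (fun s => w s ω) t) ∂Pr

variable {Pr w} {P : Matrix (Fin q) (Fin q) ℝ}

section

variable (hw : IsGaussianWhiteNoise Pr D.S w)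
include hw

lemma measurable_state (t : ℕ) : Measurable fun ω => c.X (fun s => w s ω) t :=
  (c.measurable_X t).comp hw.measurable_path

lemma measurable_input (t : ℕ) : Measurable fun ω => c.U (fun s => w s ω) t :=
  (c.measurable_U t).comp hw.measurable_path

lemma measurable_last (t : ℕ) : Measurable fun ω => c.L (fun s => w s ω) t :=
  (c.measurable_L t).comp hw.measurable_path

lemma measurable_stage (t : ℕ) : Measurable fun ω => ENNReal.ofReal
    (quad D.Q (c.X (fun s => w s ω) t) + quad D.R (c.U (fun s => w s ω) t)) :=
  (((continuous_quad D.Q).measurable.comp (c.measurable_state hw t)).add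
    ((continuous_quad D.R).measurable.comp (c.measurable_input hw t))).ennreal_ofReal

lemma measurable_measureCost (t : ℕ) : Measurable fun ω => c.measureCost (fun s => w s ω) t := by
  refine Measurable.ite ?_ measurable_const measurable_const
  exact (MeasurableSet.const _).inter (c.measurable_last hw t (measurableSet_singleton t))

lemma cost_eq [IsProbabilityMeasure Pr] (hD : StandingAssumptions D) : c.cost Pr w = ∑' t,
    (ENNReal.ofReal D.β ^ t * c.expStage Pr w t
      + ∫⁻ ω, c.measureCost (fun s => w s ω) t ∂Pr) := by
  have h : ∀ ω t, ENNReal.ofReal (D.β ^ t * (quad D.Q (c.X (fun s => w s ω) t)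
      + quad D.R (c.U (fun s => w s ω) t))) = ENNReal.ofReal D.β ^ t * ENNReal.ofReal
      (quad D.Q (c.X (fun s => w s ω) t) + quad D.R (c.U (fun s => w s ω) t)) := fun ω t => by
    rw [ENNReal.ofReal_mul (pow_nonneg hD.beta_pos.le t), ENNReal.ofReal_pow hD.beta_pos.le]
  simp only [cost, h]
  have hm : ∀ t, Measurable fun ω => ENNReal.ofReal D.β ^ t * ENNReal.ofReal
      (quad D.Q (c.X (fun s => w s ω) t) + quad D.R (c.U (fun s => w s ω) t))
      + c.measureCost (fun s => w s ω) t := fun t =>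
    ((c.measurable_stage hw t).const_mul _).add (c.measurable_measureCost hw t)
  rw [lintegral_tsum fun t => (hm t).aemeasurable]
  refine tsum_congr fun t => ?_
  rw [lintegral_add_left ((c.measurable_stage hw t).const_mul _),
    lintegral_const_mul _ (c.measurable_stage hw t), expStage]

lemma expQuad_succ [IsProbabilityMeasure Pr] {G : Matrix (Fin q) (Fin q) ℝ}
    (hG : G.PosSemidef) (t : ℕ) :
    c.expQuad Pr w G (t + 1) = ∫⁻ ω, ENNReal.ofReal (quad G (D.A *ᵥ c.X (fun s => w s ω) t
        + D.B *ᵥ c.U (fun s => w s ω) t)) ∂Pr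
      + ENNReal.ofReal (D.C * D.S * D.Cᵀ * G).trace := by
  have hX := (measurable_mask (Finset.range t)).comp hw.measurable_path
  have hind : IndepFun (fun ω => mask (Finset.range t) fun s => w s ω)
      (fun ω => D.C *ᵥ w t ω) Pr := by
    have h := (hw.indepFun_mask (I := Finset.range t) (K := {t}) (by simp)).comp measurable_id
      ((measurable_mulVec D.C).comp (measurable_pi_apply t))
    simpa [Function.comp_def, mask_of_mem] using h
  have key := setLIntegral_quad_add hX ((hw.isCentered t).mulVec D.C) hind
    (f := fun v => D.A *ᵥ c.X v t + D.B *ᵥ c.U v t)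
    (((measurable_mulVec D.A).comp (c.measurable_X t)).add
      ((measurable_mulVec D.B).comp (c.measurable_U t))) MeasurableSet.univ hG
  simp only [Set.preimage_univ, Measure.restrict_univ, measure_univ, one_mul,
    Function.comp_apply, c.X_mask, c.U_mask] at key
  rw [hw.lintegral_quad_noise D hG] at key
  rw [← key]
  simp only [expQuad, c.X_succ, step]

/-- The Bellman equation in expectation. -/
lemma expStage_add [IsProbabilityMeasure Pr] (hD : StandingAssumptions D) (hP : P.PosSemidef)
    (hR : SolvesRiccati D P) (t : ℕ) :
    c.expStage Pr w t + ENNReal.ofReal D.β * c.expQuad Pr w P (t + 1)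
      = c.expQuad Pr w P t + c.expLoss Pr w P t
        + ENNReal.ofReal D.β * ENNReal.ofReal (D.C * D.S * D.Cᵀ * P).trace := by
  have hX := c.measurable_state hw t
  have hU := c.measurable_input hw t
  rw [c.expQuad_succ hw hP, mul_add, ← add_assoc]
  congr 1
  have hm1 : Measurable fun ω => ENNReal.ofReal (quad P (D.A *ᵥ c.X (fun s => w s ω) t
        + D.B *ᵥ c.U (fun s => w s ω) t)) :=
    (measurable_ofReal_quad P).comp (((measurable_mulVec D.A).comp hX).add
      ((measurable_mulVec D.B).comp hU))
  have hm2 : Measurable fun ω => ENNReal.ofReal (quad P (c.X (fun s => w s ω) t)) :=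
    (measurable_ofReal_quad P).comp hX
  rw [← lintegral_const_mul _ hm1, expStage, ← lintegral_add_left (c.measurable_stage hw t),
    expQuad, expLoss, ← lintegral_add_left hm2]
  refine lintegral_congr fun ω => ?_
  have hb := hD.bellman_identity hP (c.X (fun s => w s ω) t) (c.U (fun s => w s ω) t)
  rw [← solvesRiccati_iff.1 hR] at hb
  have h1 := quad_nonneg hD.Q_posSemidef (c.X (fun s => w s ω) t)
  have h2 := quad_nonneg hD.R_posDef.posSemidef (c.U (fun s => w s ω) t)
  rw [← ENNReal.ofReal_mul hD.beta_pos.le, ← ENNReal.ofReal_add (add_nonneg h1 h2)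
    (mul_nonneg hD.beta_pos.le (quad_nonneg hP _)), hb,
    ENNReal.ofReal_add (quad_nonneg hP _) (quad_nonneg (hD.gainWeight_posDef hP).posSemidef _)]

lemma sum_expStage_add [IsProbabilityMeasure Pr] (hD : StandingAssumptions D)
    (hP : P.PosSemidef) (hR : SolvesRiccati D P) (n : ℕ) :
    ∑ t ∈ Finset.range n, ENNReal.ofReal D.β ^ t * c.expStage Pr w t
        + ENNReal.ofReal D.β ^ n * c.expQuad Pr w P n
      = ENNReal.ofReal (quad P x₀)
        + ∑ t ∈ Finset.range n, ENNReal.ofReal D.β ^ t * c.expLoss Pr w P t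
        + ∑ t ∈ Finset.range n,
          ENNReal.ofReal D.β ^ (t + 1) * ENNReal.ofReal (D.C * D.S * D.Cᵀ * P).trace := by
  induction n with
  | zero => simp [expQuad, c.X_zero]
  | succ n ih =>
    have h := congrArg (ENNReal.ofReal D.β ^ n * ·) (c.expStage_add hw hD hP hR n)
    simp only [mul_add, ← mul_assoc, ← pow_succ] at h
    rw [Finset.sum_range_succ, Finset.sum_range_succ, Finset.sum_range_succ, add_assoc, h,
      ← add_assoc, ← add_assoc, ih]
    ring

lemma expQuad_valueIter_le [IsProbabilityMeasure Pr] (hD : StandingAssumptions D) (n t : ℕ) :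
    ENNReal.ofReal D.β ^ t * c.expQuad Pr w (valueIter D n) t
      ≤ ∑ k ∈ Finset.range n, ENNReal.ofReal D.β ^ (t + k) * c.expStage Pr w (t + k) := by
  induction n generalizing t with
  | zero => simp [expQuad, valueIter]
  | succ n ih =>
    have hV := hD.valueIter_posSemidef n
    have hX := c.measurable_state hw t
    have hU := c.measurable_input hw t
    have hm1 : Measurable fun ω => ENNReal.ofReal (quad (valueIter D n)
        (D.A *ᵥ c.X (fun s => w s ω) t + D.B *ᵥ c.U (fun s => w s ω) t)) :=
      (measurable_ofReal_quad _).comp (((measurable_mulVec D.A).comp hX).add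
        ((measurable_mulVec D.B).comp hU))
    have h1 : c.expQuad Pr w (valueIter D (n + 1)) t
        ≤ c.expStage Pr w t + ENNReal.ofReal D.β * c.expQuad Pr w (valueIter D n) (t + 1) := by
      rw [c.expQuad_succ hw hV, mul_add, ← add_assoc]
      refine le_trans ?_ le_self_add
      rw [← lintegral_const_mul _ hm1, expStage, ← lintegral_add_left (c.measurable_stage hw t)]
      refine lintegral_mono fun ω => ?_
      have h1 := quad_nonneg hD.Q_posSemidef (c.X (fun s => w s ω) t)
      have h2 := quad_nonneg hD.R_posDef.posSemidef (c.U (fun s => w s ω) t)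
      rw [← ENNReal.ofReal_mul hD.beta_pos.le, ← ENNReal.ofReal_add (add_nonneg h1 h2)
        (mul_nonneg hD.beta_pos.le (quad_nonneg hV _)), valueIter_succ]
      exact ENNReal.ofReal_le_ofReal (hD.quad_riccati_le hV _ _)
    rw [Finset.sum_range_succ', add_zero]
    calc ENNReal.ofReal D.β ^ t * c.expQuad Pr w (valueIter D (n + 1)) t
        ≤ ENNReal.ofReal D.β ^ t * (c.expStage Pr w t
          + ENNReal.ofReal D.β * c.expQuad Pr w (valueIter D n) (t + 1)) := by gcongr
      _ = ENNReal.ofReal D.β ^ (t + 1) * c.expQuad Pr w (valueIter D n) (t + 1)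
          + ENNReal.ofReal D.β ^ t * c.expStage Pr w t := by ring
      _ ≤ _ := by
        gcongr
        refine (ih (t + 1)).trans (le_of_eq (Finset.sum_congr rfl fun k _ => ?_))
        rw [show t + 1 + k = t + (k + 1) by omega]

/-- Transversality: finite cost forces the discounted expected squared state to vanish. -/
lemma tendsto_expQuad [IsProbabilityMeasure Pr] (hD : StandingAssumptions D)
    (hV : (valueIter D q).PosDef) (P : Matrix (Fin q) (Fin q) ℝ) (hfin : c.cost Pr w ≠ ⊤) :
    Tendsto (fun n => ENNReal.ofReal D.β ^ n * c.expQuad Pr w P n) atTop (𝓝 0) := by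
  obtain ⟨k, hk, hle⟩ := exists_quad_le_mul hV P
  have hsum : ∑' t, ENNReal.ofReal D.β ^ t * c.expStage Pr w t ≠ ⊤ := by
    refine ne_top_of_le_ne_top hfin ?_
    rw [c.cost_eq hw hD]
    exact ENNReal.tsum_le_tsum fun t => le_self_add
  have h0 := ENNReal.tendsto_atTop_zero_of_tsum_ne_top hsum
  have h1 : Tendsto (fun n => ENNReal.ofReal k * ∑ j ∈ Finset.range q,
      ENNReal.ofReal D.β ^ (n + j) * c.expStage Pr w (n + j)) atTop (𝓝 0) := by
    have h2 : Tendsto (fun n => ∑ j ∈ Finset.range q,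
        ENNReal.ofReal D.β ^ (n + j) * c.expStage Pr w (n + j)) atTop
        (𝓝 (∑ j ∈ Finset.range q, (0 : ℝ≥0∞))) :=
      tendsto_finsetSum _ fun j _ => h0.comp (tendsto_add_atTop_nat j)
    rw [Finset.sum_const_zero] at h2
    simpa using ENNReal.Tendsto.const_mul h2 (Or.inr ENNReal.ofReal_ne_top)
  refine tendsto_of_tendsto_of_tendsto_of_le_of_le tendsto_const_nhds h1
    (fun _ => zero_le) fun n => ?_
  have h3 : c.expQuad Pr w P n ≤ ENNReal.ofReal k * c.expQuad Pr w (valueIter D q) n := by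
    have hm : Measurable fun ω =>
        ENNReal.ofReal (quad (valueIter D q) (c.X (fun s => w s ω) n)) :=
      (measurable_ofReal_quad _).comp (c.measurable_state hw n)
    rw [expQuad, expQuad, ← lintegral_const_mul _ hm]
    refine lintegral_mono fun ω => ?_
    rw [← ENNReal.ofReal_mul hk.le]
    exact ENNReal.ofReal_le_ofReal (hle _)
  calc ENNReal.ofReal D.β ^ n * c.expQuad Pr w P n
      ≤ ENNReal.ofReal D.β ^ n * (ENNReal.ofReal k * c.expQuad Pr w (valueIter D q) n) := by
        gcongr
    _ = ENNReal.ofReal k * (ENNReal.ofReal D.β ^ n * c.expQuad Pr w (valueIter D q) n) := by ring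
    _ ≤ _ := by gcongr; exact c.expQuad_valueIter_le hw hD q n

/-- The error of the best prediction bounds the loss from below. -/
lemma lintegral_runCost_le_expLoss [IsProbabilityMeasure Pr] (hD : StandingAssumptions D)
    (hP : P.PosSemidef) (t : ℕ) :
    ∫⁻ ω, ENNReal.ofReal (runCost D P (t - c.L (fun s => w s ω) t)) ∂Pr
      ≤ c.expLoss Pr w P t := by
  set E : ℕ → Set Ω := fun s => {ω | c.L (fun s => w s ω) t = s} with hE
  have hEm : ∀ s, MeasurableSet (E s) := fun s =>
    c.measurable_last hw t (measurableSet_singleton s)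
  have hdisj : Pairwise (Function.onFun Disjoint E) := fun i j hij =>
    Set.disjoint_left.2 fun ω hi hj => hij (hi.symm.trans hj)
  have hun : ⋃ s, E s = Set.univ := Set.eq_univ_of_forall fun ω => Set.mem_iUnion.2 ⟨_, rfl⟩
  rw [expLoss, ← setLIntegral_univ, ← hun, lintegral_iUnion hEm hdisj,
    ← setLIntegral_univ (μ := Pr) (fun ω => ENNReal.ofReal (quad (gainWeight D P) _)), ← hun,
    lintegral_iUnion hEm hdisj]
  refine ENNReal.tsum_le_tsum fun s => ?_
  have hM := (hD.gainWeight_posDef hP).posSemidef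
  have hX := (measurable_mask (Finset.range s)).comp hw.measurable_path
  have hind : IndepFun (fun ω => mask (Finset.range s) fun s => w s ω)
      (fun ω => gain D P *ᵥ err D s (fun j => w j ω) (t - s)) Pr := by
    have hdisj : Disjoint (Finset.range s) (Finset.Ico s (s + (t - s))) :=
      Finset.disjoint_left.2 fun j h1 h2 => by
        rw [Finset.mem_range] at h1; rw [Finset.mem_Ico] at h2; omega
    have h := (hw.indepFun_mask hdisj).comp measurable_id
      ((measurable_mulVec (gain D P)).comp (measurable_err D s (t - s)))
    simpa [Function.comp_def, err_mask] using h
  have key := setLIntegral_quad_add hX ((hw.isCentered_err D s (t - s)).mulVec (gain D P)) hind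
    (f := fun v => c.U v t + gain D P *ᵥ c.X v t)
    ((c.measurable_U t).add ((measurable_mulVec _).comp (c.measurable_X t)))
    (c.measurable_L t (measurableSet_singleton s)) hM
  have hset : ((mask (Finset.range s)) ∘ fun ω s => w s ω) ⁻¹' ((fun v => c.L v t) ⁻¹' {s})
      = E s := by
    ext ω
    exact c.L_mask_iff (fun s => w s ω) s t
  rw [hset] at key
  simp only [← hD.quad_phi hP] at key
  rw [hw.lintegral_quad_err D hD.noise_posDef.posSemidef (hD.phi_posSemidef hP)] at key
  calc ∫⁻ ω in E s, ENNReal.ofReal (runCost D P (t - c.L (fun s => w s ω) t)) ∂Pr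
      = ∫⁻ ω in E s, ENNReal.ofReal (runCost D P (t - s)) ∂Pr :=
        setLIntegral_congr_fun (hEm s) fun ω hω => by
          have : c.L (fun s => w s ω) t = s := hω
          simp only [this]
    _ ≤ _ := by
        rw [setLIntegral_const, mul_comm]
        exact le_add_self
    _ = _ := key.symm
    _ = _ := setLIntegral_congr_fun (hEm s) fun ω hω => by
        have hL : c.L (fun s => w s ω) t = s := hω
        have h1 := c.X_eq_add_err (fun s => w s ω) t
        have h2 := c.U_mask_last hL.le
        rw [hL] at h1
        simp only [Function.comp_apply]
        rw [h1, h2, mulVec_add, add_assoc]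

lemma lintegral_lagCost [IsProbabilityMeasure Pr] (hD : StandingAssumptions D)
    (hP : P.PosSemidef) (t : ℕ) :
    ∫⁻ ω, ENNReal.ofReal (lagCost D.β D.O (runCost D P) (c.L (fun s => w s ω)) t) ∂Pr
      = ENNReal.ofReal D.β ^ t
          * ∫⁻ ω, ENNReal.ofReal (runCost D P (t - c.L (fun s => w s ω) t)) ∂Pr
        + ∫⁻ ω, c.measureCost (fun s => w s ω) t ∂Pr := by
  have hm : Measurable fun ω => ENNReal.ofReal (runCost D P (t - c.L (fun s => w s ω) t)) :=
    (measurable_from_nat (f := fun s => ENNReal.ofReal (runCost D P (t - s)))).comp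
      (c.measurable_last hw t)
  rw [← lintegral_const_mul _ hm, ← lintegral_add_left (hm.const_mul _)]
  refine lintegral_congr fun ω => ?_
  have h1 := pow_nonneg hD.beta_pos.le t
  rw [lagCost, ENNReal.ofReal_add (mul_nonneg h1 (hD.runCost_nonneg hP _))
    (by split_ifs; exacts [mul_nonneg h1 hD.O_nonneg, le_rfl]), ENNReal.ofReal_mul h1,
    ENNReal.ofReal_pow hD.beta_pos.le, measureCost]
  congr 1
  split_ifs <;> simp

lemma sum_lintegral_lagCost [IsProbabilityMeasure Pr] (hD : StandingAssumptions D)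
    (hP : P.PosSemidef) (n : ℕ) :
    ∑ t ∈ Finset.range n,
        ∫⁻ ω, ENNReal.ofReal (lagCost D.β D.O (runCost D P) (c.L (fun s => w s ω)) t) ∂Pr
      = ∫⁻ ω, ENNReal.ofReal
          (scheduleCost D.β D.O (runCost D P) (c.L (fun s => w s ω)) n) ∂Pr := by
  have hm : ∀ t, Measurable fun ω =>
      ENNReal.ofReal (lagCost D.β D.O (runCost D P) (c.L (fun s => w s ω)) t) := fun t =>
    (measurable_from_nat (f := fun s => ENNReal.ofReal
      (D.β ^ t * runCost D P (t - s) + if 0 < t ∧ s = t then D.β ^ t * D.O else 0))).comp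
      (c.measurable_last hw t)
  rw [← lintegral_finsetSum _ fun t _ => hm t]
  refine lintegral_congr fun ω => ?_
  rw [scheduleCost, ENNReal.ofReal_sum_of_nonneg fun t _ => ?_]
  have h1 := pow_nonneg hD.beta_pos.le t
  refine add_nonneg (mul_nonneg h1 (hD.runCost_nonneg hP _)) ?_
  split_ifs
  exacts [mul_nonneg h1 hD.O_nonneg, le_rfl]

end

/-- The constant part of the cost that is due to the noise. -/
lemma tendsto_noiseCost (hD : StandingAssumptions D) {κ : ℝ} (hκ : 0 ≤ κ) :
    Tendsto (fun n => ∑ t ∈ Finset.range n, ENNReal.ofReal D.β ^ (t + 1) * ENNReal.ofReal κ)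
      atTop (𝓝 (ENNReal.ofReal (D.β / (1 - D.β) * κ))) := by
  have h : HasSum (fun t : ℕ => D.β ^ (t + 1) * κ) (D.β / (1 - D.β) * κ) := by
    have := ((hasSum_geometric_of_lt_one hD.beta_pos.le hD.beta_lt_one).mul_left D.β).mul_right κ
    simpa only [← pow_succ', ← div_eq_mul_inv] using this
  refine ((ENNReal.continuous_ofReal.tendsto _).comp h.tendsto_sum_nat).congr fun n => ?_
  rw [Function.comp_apply, ENNReal.ofReal_sum_of_nonneg fun t _ =>
    mul_nonneg (pow_nonneg hD.beta_pos.le _) hκ]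
  refine Finset.sum_congr rfl fun t _ => ?_
  rw [ENNReal.ofReal_mul (pow_nonneg hD.beta_pos.le _), ENNReal.ofReal_pow hD.beta_pos.le]

/-- Lower bound for the cost of every strategy. -/
theorem le_cost [IsProbabilityMeasure Pr] (hw : IsGaussianWhiteNoise Pr D.S w)
    (hD : StandingAssumptions D) (hP : P.PosSemidef) (hR : SolvesRiccati D P)
    (hV : (valueIter D q).PosDef) {x : ℝ}
    (hx : ∀ T, 1 ≤ T → x ≤ waitCost D.β D.O (runCost D P) x T) :
    ENNReal.ofReal (quad P x₀)
      + ENNReal.ofReal (D.β / (1 - D.β) * (D.C * D.S * D.Cᵀ * P).trace) + ENNReal.ofReal x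
      ≤ c.cost Pr w := by
  by_cases hfin : c.cost Pr w = ⊤
  · rw [hfin]; exact le_top
  have hκ : 0 ≤ (D.C * D.S * D.Cᵀ * P).trace := trace_mul_nonneg hD.noise_posDef.posSemidef hP
  have hβ := hD.beta_pos
  set b := ENNReal.ofReal D.β with hb
  have hstep : ∀ n, ENNReal.ofReal (quad P x₀)
      + ∑ t ∈ Finset.range (n + 1), b ^ (t + 1) * ENNReal.ofReal (D.C * D.S * D.Cᵀ * P).trace
      + ENNReal.ofReal x ≤ c.cost Pr w + b ^ (n + 1) * c.expQuad Pr w P (n + 1)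
      + ENNReal.ofReal (D.β ^ (n + 1) * (x + D.O)) := by
    intro n
    have h1 := c.sum_expStage_add hw hD hP hR (n + 1)
    have h2 : ENNReal.ofReal x ≤ ∑ t ∈ Finset.range (n + 1), b ^ t * c.expLoss Pr w P t
        + ∑ t ∈ Finset.range (n + 1), ∫⁻ ω, c.measureCost (fun s => w s ω) t ∂Pr
        + ENNReal.ofReal (D.β ^ (n + 1) * (x + D.O)) := by
      have h3 : ∑ t ∈ Finset.range (n + 1), ∫⁻ ω, ENNReal.ofReal
            (lagCost D.β D.O (runCost D P) (c.L (fun s => w s ω)) t) ∂Pr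
          ≤ ∑ t ∈ Finset.range (n + 1), b ^ t * c.expLoss Pr w P t
            + ∑ t ∈ Finset.range (n + 1), ∫⁻ ω, c.measureCost (fun s => w s ω) t ∂Pr := by
        rw [← Finset.sum_add_distrib]
        refine Finset.sum_le_sum fun t _ => ?_
        rw [c.lintegral_lagCost hw hD hP]
        gcongr
        exact c.lintegral_runCost_le_expLoss hw hD hP t
      rw [c.sum_lintegral_lagCost hw hD hP] at h3
      refine le_trans ?_ (add_le_add_left h3 _)
      calc ENNReal.ofReal x = ∫⁻ _ω, ENNReal.ofReal x ∂Pr := by simp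
        _ ≤ ∫⁻ ω, (ENNReal.ofReal (scheduleCost D.β D.O (runCost D P)
              (c.L (fun s => w s ω)) (n + 1)) + ENNReal.ofReal (D.β ^ (n + 1) * (x + D.O))) ∂Pr :=
          lintegral_mono fun ω => (ENNReal.ofReal_le_ofReal
            ((c.isLastTime _).le_scheduleCost hβ hx n)).trans ENNReal.ofReal_add_le
        _ = _ := by rw [lintegral_add_right _ measurable_const]; simp
    calc _ ≤ ENNReal.ofReal (quad P x₀) + ∑ t ∈ Finset.range (n + 1), b ^ (t + 1) *
            ENNReal.ofReal (D.C * D.S * D.Cᵀ * P).trace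
          + (∑ t ∈ Finset.range (n + 1), b ^ t * c.expLoss Pr w P t
            + ∑ t ∈ Finset.range (n + 1), ∫⁻ ω, c.measureCost (fun s => w s ω) t ∂Pr
            + ENNReal.ofReal (D.β ^ (n + 1) * (x + D.O))) := by gcongr
      _ = (ENNReal.ofReal (quad P x₀) + ∑ t ∈ Finset.range (n + 1), b ^ t * c.expLoss Pr w P t
            + ∑ t ∈ Finset.range (n + 1), b ^ (t + 1) *
              ENNReal.ofReal (D.C * D.S * D.Cᵀ * P).trace)
          + ∑ t ∈ Finset.range (n + 1), ∫⁻ ω, c.measureCost (fun s => w s ω) t ∂Pr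
          + ENNReal.ofReal (D.β ^ (n + 1) * (x + D.O)) := by ring
      _ = ∑ t ∈ Finset.range (n + 1), (b ^ t * c.expStage Pr w t
            + ∫⁻ ω, c.measureCost (fun s => w s ω) t ∂Pr)
          + b ^ (n + 1) * c.expQuad Pr w P (n + 1)
          + ENNReal.ofReal (D.β ^ (n + 1) * (x + D.O)) := by
        rw [← h1, Finset.sum_add_distrib]; ring
      _ ≤ _ := by
        rw [c.cost_eq hw hD]
        gcongr
        exact ENNReal.sum_le_tsum _
  have hl := ((tendsto_noiseCost hD hκ).const_add (ENNReal.ofReal (quad P x₀))).add_const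
    (ENNReal.ofReal x)
  have hr0 : Tendsto (fun n => ENNReal.ofReal (D.β ^ n * (x + D.O))) atTop (𝓝 0) := by
    have := ENNReal.tendsto_ofReal
      ((tendsto_pow_atTop_nhds_zero_of_lt_one hβ.le hD.beta_lt_one).mul_const (x + D.O))
    simpa using this
  have hr := ((c.tendsto_expQuad hw hD hV P hfin).const_add (c.cost Pr w)).add hr0
  rw [add_zero, add_zero] at hr
  exact le_of_tendsto_of_tendsto' (hl.comp (tendsto_add_atTop_nat 1))
    (hr.comp (tendsto_add_atTop_nat 1)) hstep

/-- Upper bound for the cost of the certainty-equivalent control with a fixed measurement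
schedule. -/
theorem cost_le [IsProbabilityMeasure Pr] (hw : IsGaussianWhiteNoise Pr D.S w)
    (hD : StandingAssumptions D) (hP : P.PosSemidef) (hR : SolvesRiccati D P) {ℓ : ℕ → ℕ}
    (hℓ : ∀ v, c.L v = ℓ)
    (hU : ∀ v t, c.U v t + gain D P *ᵥ c.X v t = gain D P *ᵥ err D (ℓ t) v (t - ℓ t)) {x : ℝ}
    (hx : ∀ n, scheduleCost D.β D.O (runCost D P) ℓ n ≤ x) :
    c.cost Pr w ≤ ENNReal.ofReal (quad P x₀)
      + ENNReal.ofReal (D.β / (1 - D.β) * (D.C * D.S * D.Cᵀ * P).trace) + ENNReal.ofReal x := by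
  have hκ : 0 ≤ (D.C * D.S * D.Cᵀ * P).trace := trace_mul_nonneg hD.noise_posDef.posSemidef hP
  set b := ENNReal.ofReal D.β with hb
  rw [c.cost_eq hw hD, ENNReal.tsum_eq_iSup_nat]
  refine iSup_le fun n => ?_
  have hloss : ∀ t, c.expLoss Pr w P t
      = ∫⁻ ω, ENNReal.ofReal (runCost D P (t - c.L (fun s => w s ω) t)) ∂Pr := fun t => by
    simp only [expLoss, hU, hℓ, ← hD.quad_phi hP]
    rw [hw.lintegral_quad_err D hD.noise_posDef.posSemidef (hD.phi_posSemidef hP)]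
    simp [runCost]
  have h1 := c.sum_expStage_add hw hD hP hR n
  have h2 : ∑ t ∈ Finset.range n, b ^ (t + 1) * ENNReal.ofReal (D.C * D.S * D.Cᵀ * P).trace
      ≤ ENNReal.ofReal (D.β / (1 - D.β) * (D.C * D.S * D.Cᵀ * P).trace) := by
    refine Monotone.ge_of_tendsto (fun i j hij => ?_) (tendsto_noiseCost hD hκ) n
    exact Finset.sum_le_sum_of_subset (Finset.range_mono hij)
  have h3 : ∑ t ∈ Finset.range n, b ^ t * c.expLoss Pr w P t
      + ∑ t ∈ Finset.range n, ∫⁻ ω, c.measureCost (fun s => w s ω) t ∂Pr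
      ≤ ENNReal.ofReal x := by
    rw [← Finset.sum_add_distrib]
    simp only [hloss]
    simp only [hb, ← c.lintegral_lagCost hw hD hP]
    rw [c.sum_lintegral_lagCost hw hD hP]
    simp only [hℓ, lintegral_const, measure_univ, mul_one]
    exact ENNReal.ofReal_le_ofReal (hx n)
  calc ∑ t ∈ Finset.range n, (b ^ t * c.expStage Pr w t
          + ∫⁻ ω, c.measureCost (fun s => w s ω) t ∂Pr)
      ≤ (∑ t ∈ Finset.range n, b ^ t * c.expStage Pr w t + b ^ n * c.expQuad Pr w P n)
        + ∑ t ∈ Finset.range n, ∫⁻ ω, c.measureCost (fun s => w s ω) t ∂Pr := by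
        rw [Finset.sum_add_distrib]
        gcongr
        exact le_self_add
    _ = ENNReal.ofReal (quad P x₀) + ∑ t ∈ Finset.range n,
          b ^ (t + 1) * ENNReal.ofReal (D.C * D.S * D.Cᵀ * P).trace
        + (∑ t ∈ Finset.range n, b ^ t * c.expLoss Pr w P t
          + ∑ t ∈ Finset.range n, ∫⁻ ω, c.measureCost (fun s => w s ω) t ∂Pr) := by
        rw [h1]; ring
    _ ≤ _ := by gcongr

end ClosedLoop

variable {q p m : ℕ} (D : Data q p m)

/-! ### Strategies of the first kind as closed loops -/

namespace Policy

variable (π : Policy q p) (x₀ : Fin q → ℝ)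

/-- The record made at time `t` along the noise path `w`. -/
def record (w : ℕ → Fin m → ℝ) (t : ℕ) : Record q p :=
  π.nextRecord x₀ t (π.run D x₀ w t).1 (π.run D x₀ w t).2

lemma run_succ (w : ℕ → Fin m → ℝ) (t : ℕ) : π.run D x₀ w (t + 1)
    = (Fin.snoc (α := fun _ => Record q p) (π.run D x₀ w t).1 (π.record D x₀ w t),
      step D (π.state D x₀ w t) (π.input D x₀ w t) (w t)) := rfl

lemma run_fst_apply (w : ℕ → Fin m → ℝ) (t : ℕ) (k : Fin t) :
    (π.run D x₀ w t).1 k = π.record D x₀ w k := by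
  induction t with
  | zero => exact k.elim0
  | succ t ih =>
    rw [run_succ]
    refine Fin.lastCases ?_ (fun k => ?_) k
    · simp
    · simp [ih]

lemma measurable_step : Measurable fun z : (Fin q → ℝ) × (Fin p → ℝ) × (Fin m → ℝ) =>
    step D z.1 z.2.1 z.2.2 := by
  refine Continuous.measurable ?_
  unfold step
  fun_prop

lemma measurable_nextRecord (t : ℕ) :
    Measurable fun z : (Fin t → Record q p) × (Fin q → ℝ) => π.nextRecord x₀ t z.1 z.2 := by
  have hi : Measurable fun z : (Fin t → Record q p) × (Fin q → ℝ) => π.measure t x₀ z.1 :=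
    (π.measurable_measure t).comp (measurable_const.prodMk measurable_fst)
  have hy : Measurable fun z : (Fin t → Record q p) × (Fin q → ℝ) =>
      if π.measure t x₀ z.1 then z.2 else (0 : Fin q → ℝ) :=
    Measurable.ite (hi (measurableSet_singleton true)) measurable_snd measurable_const
  exact hi.prodMk (((π.measurable_control t).comp (measurable_const.prodMk
    (measurable_fst.prodMk (hi.prodMk hy)))).prodMk hy)

lemma measurable_run (t : ℕ) : Measurable fun w : ℕ → Fin m → ℝ => π.run D x₀ w t := by
  induction t with
  | zero => exact measurable_const
  | succ t ih =>
    have hrec : Measurable fun w : ℕ → Fin m → ℝ => π.record D x₀ w t :=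
      (π.measurable_nextRecord x₀ t).comp ih
    refine Measurable.prodMk (f := fun w => Fin.snoc (α := fun _ => Record q p)
      (π.run D x₀ w t).1 (π.record D x₀ w t)) (g := fun w =>
      step D (π.state D x₀ w t) (π.input D x₀ w t) (w t)) ?_ ?_
    · refine measurable_pi_lambda _ fun k => ?_
      refine Fin.lastCases ?_ (fun k => ?_) k
      · simpa using hrec
      · simpa [Function.comp_def] using (measurable_pi_apply k).comp ih.fst
    · exact (measurable_step D).comp (ih.snd.prodMk
        ((hrec.snd.fst).prodMk (measurable_pi_apply t)))

lemma measurable_indicator (t : ℕ) :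
    Measurable fun w : ℕ → Fin m → ℝ => π.indicator D x₀ w t :=
  ((π.measurable_nextRecord x₀ t).comp (π.measurable_run D x₀ t)).fst

/-- The time of the last measurement, where time `0` counts as one. -/
def lastTime (w : ℕ → Fin m → ℝ) : ℕ → ℕ
  | 0 => 0
  | t + 1 => if π.indicator D x₀ w (t + 1) then t + 1 else lastTime w t

lemma isLastTime (w : ℕ → Fin m → ℝ) : IsLastTime (π.lastTime D x₀ w) := by
  refine ⟨rfl, fun t => ?_⟩
  rw [lastTime]
  split_ifs
  exacts [Or.inl rfl, Or.inr rfl]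

lemma measurable_lastTime (t : ℕ) :
    Measurable fun w : ℕ → Fin m → ℝ => π.lastTime D x₀ w t := by
  induction t with
  | zero => exact measurable_const
  | succ t ih =>
    exact Measurable.ite (π.measurable_indicator D x₀ (t + 1) (measurableSet_singleton true))
      measurable_const ih

lemma indicator_eq_iff (w : ℕ → Fin m → ℝ) {t : ℕ} (ht : 0 < t) :
    π.lastTime D x₀ w t = t ↔ π.indicator D x₀ w t = true := by
  obtain ⟨t, rfl⟩ : ∃ k, t = k + 1 := ⟨t - 1, by omega⟩
  have := (π.isLastTime D x₀ w).le t
  rw [lastTime]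
  split_ifs with h
  · simp [h]
  · simp [h]; omega

lemma run_congr {w w' : ℕ → Fin m → ℝ} {t : ℕ} (h : ∀ j < t, w j = w' j) :
    π.run D x₀ w' t = π.run D x₀ w t := by
  induction t with
  | zero => rfl
  | succ t ih =>
    have := ih fun j hj => h j (by omega)
    simp only [run, this, h t (by omega)]

lemma causal (w w' : ℕ → Fin m → ℝ) (t : ℕ) (h : ∀ j < π.lastTime D x₀ w t, w j = w' j) :
    (π.run D x₀ w' t).1 = (π.run D x₀ w t).1 ∧ π.record D x₀ w' t = π.record D x₀ w t
      ∧ π.lastTime D x₀ w' t = π.lastTime D x₀ w t := by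
  induction t with
  | zero => exact ⟨rfl, rfl, rfl⟩
  | succ t ih =>
    have hL := π.isLastTime D x₀ w
    obtain ⟨h1, h2, h3⟩ := ih fun j hj =>
      h j (hj.trans_le (hL.monotone (Nat.le_succ t)))
    have hhist : (π.run D x₀ w' (t + 1)).1 = (π.run D x₀ w (t + 1)).1 := by
      rw [run_succ, run_succ, h1, h2]
    have hind : π.indicator D x₀ w' (t + 1) = π.indicator D x₀ w (t + 1) := by
      simp only [indicator, nextRecord, hhist]
    refine ⟨hhist, ?_, by rw [lastTime, lastTime, hind, h3]⟩
    by_cases hi : π.indicator D x₀ w (t + 1) = true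
    · have hlast := (π.indicator_eq_iff D x₀ w t.succ_pos).2 hi
      rw [hlast] at h
      rw [record, record, π.run_congr D x₀ h]
    · have hi' : π.measure (t + 1) x₀ (π.run D x₀ w (t + 1)).1 = false := by
        simpa [indicator, nextRecord] using hi
      simp [record, nextRecord, hhist, hi']

/-- The closed loop of a strategy of the first kind. -/
def closedLoop : ClosedLoop D x₀ where
  X w t := π.state D x₀ w t
  U w t := π.input D x₀ w t
  L w t := π.lastTime D x₀ w t
  X_zero _ := rfl
  X_succ _ _ := rfl
  isLastTime := π.isLastTime D x₀
  measurable_X t := (π.measurable_run D x₀ t).snd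
  measurable_U t := ((π.measurable_nextRecord x₀ t).comp (π.measurable_run D x₀ t)).snd.fst
  measurable_L t := π.measurable_lastTime D x₀ t
  causal w w' t h := by
    obtain ⟨-, h2, h3⟩ := π.causal D x₀ w w' t h
    exact ⟨h3, congrArg (fun e : Record q p => e.2.1) h2⟩

variable {Ω : Type*} [MeasurableSpace Ω] {Pr : Measure Ω} {w : ℕ → Ω → (Fin m → ℝ)}
variable {D} (hD : StandingAssumptions D)
include hD

lemma stageCost_nonneg (x : Fin q → ℝ) (u : Fin p → ℝ) (t : ℕ) :
    0 ≤ D.β ^ t * (quad D.Q x + quad D.R u) :=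
  mul_nonneg (pow_nonneg hD.beta_pos.le t) (add_nonneg (quad_nonneg hD.Q_posSemidef x)
    (quad_nonneg hD.R_posDef.posSemidef u))

lemma closedLoop_cost_le : (π.closedLoop D x₀).cost Pr w ≤ π.cost D x₀ Pr w := by
  refine lintegral_mono fun ω => ENNReal.tsum_le_tsum fun t => ?_
  set v : ℕ → Fin m → ℝ := fun s => w s ω
  have h1 := stageCost_nonneg hD (π.state D x₀ v t) (π.input D x₀ v t) t
  have h2 := mul_nonneg (pow_nonneg hD.beta_pos.le t) hD.O_nonneg
  change ENNReal.ofReal (D.β ^ t * (quad D.Q (π.state D x₀ v t) + quad D.R (π.input D x₀ v t)))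
    + (if 0 < t ∧ π.lastTime D x₀ v t = t then ENNReal.ofReal (D.β ^ t * D.O) else 0)
    ≤ ENNReal.ofReal (D.β ^ t * (quad D.Q (π.state D x₀ v t) + quad D.R (π.input D x₀ v t)
      + if π.indicator D x₀ v t then D.O else 0))
  rw [mul_add _ (_ + _)]
  split_ifs with ha hb hb
  · rw [ENNReal.ofReal_add h1 h2]
  · exact absurd ((π.indicator_eq_iff D x₀ v ha.1).1 ha.2) hb
  · rw [add_zero]
    exact ENNReal.ofReal_le_ofReal (le_add_of_nonneg_right h2)
  · simp

lemma cost_le_closedLoop (h0 : ∀ x h, π.measure 0 x h = false) :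
    π.cost D x₀ Pr w ≤ (π.closedLoop D x₀).cost Pr w := by
  refine lintegral_mono fun ω => ENNReal.tsum_le_tsum fun t => ?_
  set v : ℕ → Fin m → ℝ := fun s => w s ω
  have h1 := stageCost_nonneg hD (π.state D x₀ v t) (π.input D x₀ v t) t
  have h2 := mul_nonneg (pow_nonneg hD.beta_pos.le t) hD.O_nonneg
  change ENNReal.ofReal (D.β ^ t * (quad D.Q (π.state D x₀ v t) + quad D.R (π.input D x₀ v t)
      + if π.indicator D x₀ v t then D.O else 0))
    ≤ ENNReal.ofReal (D.β ^ t * (quad D.Q (π.state D x₀ v t) + quad D.R (π.input D x₀ v t)))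
      + (if 0 < t ∧ π.lastTime D x₀ v t = t then ENNReal.ofReal (D.β ^ t * D.O) else 0)
  rw [mul_add _ (_ + _)]
  split_ifs with hb ha ha
  · rw [ENNReal.ofReal_add h1 h2]
  · refine absurd ?_ ha
    have ht : 0 < t := by
      rcases Nat.eq_zero_or_pos t with rfl | ht
      · simp [indicator, nextRecord, h0] at hb
      · exact ht
    exact ⟨ht, (π.indicator_eq_iff D x₀ v ht).2 hb⟩
  · simp
  · simp

end Policy

/-! ### Strategies of the second kind as closed loops -/

namespace LookaheadPolicy

variable (σ : LookaheadPolicy q p) (x₀ : Fin q → ℝ)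

/-- The time since the last measurement. -/
def lag (w : ℕ → Fin m → ℝ) (t : ℕ) : ℕ := (σ.run D x₀ w t).2.2

/-- The last measured state. -/
def lastState (w : ℕ → Fin m → ℝ) (t : ℕ) : Fin q → ℝ := (σ.run D x₀ w t).2.1

lemma state_succ (w : ℕ → Fin m → ℝ) (t : ℕ) : σ.state D x₀ w (t + 1)
    = step D (σ.state D x₀ w t) (σ.input D x₀ w t) (w t) := by
  simp only [state, run, input]
  split_ifs <;> rfl

lemma lag_succ (w : ℕ → Fin m → ℝ) (t : ℕ) : σ.lag D x₀ w (t + 1)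
    = if ((σ.lag D x₀ w t + 1 : ℕ) : ℕ∞) = σ.wait (σ.lastState D x₀ w t) then 0
      else σ.lag D x₀ w t + 1 := by
  by_cases h : ((σ.lag D x₀ w t + 1 : ℕ) : ℕ∞) = σ.wait (σ.lastState D x₀ w t)
  · rw [if_pos h]
    exact congrArg (fun z => z.2.2) (if_pos h : σ.run D x₀ w (t + 1) = _)
  · rw [if_neg h]
    exact congrArg (fun z => z.2.2) (if_neg h : σ.run D x₀ w (t + 1) = _)

lemma lastState_succ (w : ℕ → Fin m → ℝ) (t : ℕ) : σ.lastState D x₀ w (t + 1)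
    = if ((σ.lag D x₀ w t + 1 : ℕ) : ℕ∞) = σ.wait (σ.lastState D x₀ w t)
      then σ.state D x₀ w (t + 1) else σ.lastState D x₀ w t := by
  simp only [state_succ, lag, lastState]
  simp only [run]
  split_ifs <;> rfl

lemma lag_le (w : ℕ → Fin m → ℝ) (t : ℕ) : σ.lag D x₀ w t ≤ t := by
  induction t with
  | zero => exact le_rfl
  | succ t ih => rw [lag_succ]; split_ifs <;> omega

lemma lastState_eq (w : ℕ → Fin m → ℝ) (t : ℕ) :
    σ.lastState D x₀ w t = σ.state D x₀ w (t - σ.lag D x₀ w t) := by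
  induction t with
  | zero => rfl
  | succ t ih =>
    rw [lastState_succ, lag_succ]
    split_ifs
    · rw [Nat.sub_zero]
    · rw [ih, Nat.add_sub_add_right]

lemma isLastTime (w : ℕ → Fin m → ℝ) : IsLastTime fun t => t - σ.lag D x₀ w t := by
  refine ⟨Nat.zero_sub _, fun t => ?_⟩
  simp only [lag_succ]
  split_ifs <;> omega

lemma measurable_run (t : ℕ) : Measurable fun w : ℕ → Fin m → ℝ => σ.run D x₀ w t := by
  induction t with
  | zero => exact measurable_const
  | succ t ih =>
    have hz : Measurable fun w : ℕ → Fin m → ℝ => (σ.run D x₀ w t).2.1 := ih.snd.fst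
    have hn : Measurable fun w : ℕ → Fin m → ℝ => (σ.run D x₀ w t).2.2 := ih.snd.snd
    have hu : Measurable fun w : ℕ → Fin m → ℝ =>
        σ.control (σ.run D x₀ w t).2.1 (σ.run D x₀ w t).2.2 := by
      have h : Measurable fun z : (ℕ → Fin p → ℝ) × ℕ => z.1 z.2 :=
        measurable_from_prod_countable_left fun n => measurable_pi_apply n
      exact h.comp ((σ.measurable_control.comp hz).prodMk hn)
    have hx : Measurable fun w : ℕ → Fin m → ℝ => step D (σ.run D x₀ w t).1
        (σ.control (σ.run D x₀ w t).2.1 (σ.run D x₀ w t).2.2) (w t) :=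
      (Policy.measurable_step D).comp (ih.fst.prodMk (hu.prodMk (measurable_pi_apply t)))
    have hset : MeasurableSet {w : ℕ → Fin m → ℝ |
        (((σ.run D x₀ w t).2.2 + 1 : ℕ) : ℕ∞) = σ.wait (σ.run D x₀ w t).2.1} :=
      measurableSet_eq_fun ((measurable_from_nat (f := fun n => ((n + 1 : ℕ) : ℕ∞))).comp hn)
        (σ.measurable_wait.comp hz)
    exact Measurable.ite hset (hx.prodMk (hx.prodMk measurable_const))
      (hx.prodMk (hz.prodMk ((measurable_from_nat (f := fun n => n + 1)).comp hn)))

lemma run_congr {w w' : ℕ → Fin m → ℝ} {t : ℕ} (h : ∀ j < t, w j = w' j) :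
    σ.run D x₀ w' t = σ.run D x₀ w t := by
  induction t with
  | zero => rfl
  | succ t ih =>
    have := ih fun j hj => h j (by omega)
    simp only [run, this, h t (by omega)]

lemma causal (w w' : ℕ → Fin m → ℝ) (t : ℕ)
    (h : ∀ j < t - σ.lag D x₀ w t, w j = w' j) :
    (σ.run D x₀ w' t).2 = (σ.run D x₀ w t).2 := by
  induction t with
  | zero => rfl
  | succ t ih =>
    have hL := σ.isLastTime D x₀ w
    have h1 := ih fun j hj => h j (hj.trans_le (hL.monotone (Nat.le_succ t)))
    have hz : σ.lastState D x₀ w' t = σ.lastState D x₀ w t := congrArg Prod.fst h1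
    have hn : σ.lag D x₀ w' t = σ.lag D x₀ w t := congrArg Prod.snd h1
    refine Prod.ext (?_ : σ.lastState D x₀ w' (t + 1) = σ.lastState D x₀ w (t + 1))
      (?_ : σ.lag D x₀ w' (t + 1) = σ.lag D x₀ w (t + 1))
    · rw [lastState_succ, lastState_succ, hz, hn]
      split_ifs with hif
      · have hlag : σ.lag D x₀ w (t + 1) = 0 := by rw [lag_succ, if_pos hif]
        rw [hlag, Nat.sub_zero] at h
        rw [state, state, σ.run_congr D x₀ h]
      · rfl
    · rw [lag_succ, lag_succ, hz, hn]

/-- The closed loop of a strategy of the second kind. -/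
def closedLoop : ClosedLoop D x₀ where
  X w t := σ.state D x₀ w t
  U w t := σ.input D x₀ w t
  L w t := t - σ.lag D x₀ w t
  X_zero _ := rfl
  X_succ w t := σ.state_succ D x₀ w t
  isLastTime := σ.isLastTime D x₀
  measurable_X t := (σ.measurable_run D x₀ t).fst
  measurable_U t := by
    have h : Measurable fun z : (ℕ → Fin p → ℝ) × ℕ => z.1 z.2 :=
      measurable_from_prod_countable_left fun n => measurable_pi_apply n
    exact h.comp ((σ.measurable_control.comp (σ.measurable_run D x₀ t).snd.fst).prodMk
      (σ.measurable_run D x₀ t).snd.snd)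
  measurable_L t := (measurable_from_nat (f := fun n => t - n)).comp
    (σ.measurable_run D x₀ t).snd.snd
  causal w w' t h := by
    have h1 := σ.causal D x₀ w w' t h
    have hz : σ.lastState D x₀ w' t = σ.lastState D x₀ w t := congrArg Prod.fst h1
    have hn : σ.lag D x₀ w' t = σ.lag D x₀ w t := congrArg Prod.snd h1
    refine ⟨by rw [hn], ?_⟩
    change σ.control (σ.lastState D x₀ w' t) (σ.lag D x₀ w' t)
      = σ.control (σ.lastState D x₀ w t) (σ.lag D x₀ w t)
    rw [hz, hn]

/-- Every last measurement time is among the `T̄_k`. -/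
lemma exists_measurementTime_eq (w : ℕ → Fin m → ℝ) (t : ℕ) :
    ∃ k, σ.measurementTime D x₀ w k = ((t - σ.lag D x₀ w t : ℕ) : ℕ∞) := by
  induction t with
  | zero => exact ⟨0, by simp [measurementTime]⟩
  | succ t ih =>
    obtain ⟨k, hk⟩ := ih
    rw [lag_succ]
    have hle := σ.lag_le D x₀ w t
    split_ifs with h
    · refine ⟨k + 1, ?_⟩
      rw [measurementTime, hk, ENat.toNat_natCast, ← lastState_eq, ← h]
      norm_cast
      omega
    · exact ⟨k, by rw [hk, Nat.add_sub_add_right]⟩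

variable {Ω : Type*} [MeasurableSpace Ω] {Pr : Measure Ω} {w : ℕ → Ω → (Fin m → ℝ)}

omit [MeasurableSpace Ω] in
lemma cost_integrand (v : ℕ → Fin m → ℝ) :
    ∑' t, (ENNReal.ofReal (D.β ^ t * (quad D.Q ((σ.closedLoop D x₀).X v t)
      + quad D.R ((σ.closedLoop D x₀).U v t))) + (σ.closedLoop D x₀).measureCost v t)
    = ∑' t : ℕ, ENNReal.ofReal (D.β ^ t * (σ.state D x₀ v t ⬝ᵥ D.Q *ᵥ σ.state D x₀ v t
        + σ.input D x₀ v t ⬝ᵥ D.R *ᵥ σ.input D x₀ v t))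
      + ∑' t, (σ.closedLoop D x₀).measureCost v t := ENNReal.tsum_add

lemma closedLoop_cost_le : (σ.closedLoop D x₀).cost Pr w ≤ σ.cost D x₀ Pr w := by
  refine lintegral_mono fun ω => ?_
  set v : ℕ → Fin m → ℝ := fun s => w s ω
  simp only
  rw [cost_integrand]
  refine add_le_add_right ?_ _
  have hk : ∀ t, ∃ k, 0 < t ∧ (σ.closedLoop D x₀).L v t = t →
      σ.measurementTime D x₀ v (k + 1) = (t : ℕ∞) := fun t => by
    by_cases ht : 0 < t ∧ (σ.closedLoop D x₀).L v t = t
    · obtain ⟨k, hk⟩ := σ.exists_measurementTime_eq D x₀ v t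
      have hL : t - σ.lag D x₀ v t = t := ht.2
      rw [hL] at hk
      cases k with
      | zero =>
        have : (0 : ℕ∞) = (t : ℕ∞) := hk
        have : 0 = t := by exact_mod_cast this
        omega
      | succ k => exact ⟨k, fun _ => hk⟩
    · exact ⟨0, fun h => absurd h ht⟩
  choose κ hκ using hk
  set s : Set ℕ := {t | 0 < t ∧ (σ.closedLoop D x₀).L v t = t}
  have hinj : Function.Injective fun t : s => κ t := fun a b hab => by
    have ha := hκ a a.2
    have hb := hκ b b.2
    simp only at hab
    rw [hab, hb] at ha
    exact Subtype.ext (by exact_mod_cast ha.symm)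
  have h1 : ∑' t, (σ.closedLoop D x₀).measureCost v t
      = ∑' t : s, ENNReal.ofReal (D.β ^ (t : ℕ) * D.O) := by
    rw [tsum_subtype s fun t => ENNReal.ofReal (D.β ^ t * D.O)]
    refine tsum_congr fun t => ?_
    simp [ClosedLoop.measureCost, Set.indicator, s]
  rw [h1]
  refine le_trans (le_of_eq (tsum_congr fun t => ?_)) (ENNReal.tsum_comp_le_tsum_of_injective hinj _)
  simp [hκ t t.2]

lemma measurementTime_const {T : ℕ∞} (hT : ∀ z, σ.wait z = T) (v : ℕ → Fin m → ℝ) (k : ℕ) :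
    σ.measurementTime D x₀ v k = k * T := by
  induction k with
  | zero => simp [measurementTime]
  | succ k ih => rw [measurementTime, ih, hT]; push_cast; ring

lemma cost_le_closedLoop {T : ℕ∞} (hT : ∀ z, σ.wait z = T)
    (hL : ∀ v, (σ.closedLoop D x₀).L v = periodicLast T) :
    σ.cost D x₀ Pr w ≤ (σ.closedLoop D x₀).cost Pr w := by
  have hT1 : 1 ≤ T := hT 0 ▸ σ.one_le_wait 0
  refine lintegral_mono fun ω => ?_
  set v : ℕ → Fin m → ℝ := fun s => w s ω
  simp only
  rw [cost_integrand]
  refine add_le_add_right ?_ _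
  simp only [σ.measurementTime_const D x₀ hT]
  induction T with
  | top =>
    simp
  | coe T =>
    have hT' : 0 < T := by exact_mod_cast hT1
    have hinj : Function.Injective fun k : ℕ => (k + 1) * T := fun a b hab => by
      have := Nat.eq_of_mul_eq_mul_right hT' hab
      omega
    refine le_trans (ENNReal.tsum_le_tsum fun k => ?_)
      (ENNReal.tsum_comp_le_tsum_of_injective hinj ((σ.closedLoop D x₀).measureCost v))
    have h1 : ((k + 1 : ℕ) : ℕ∞) * (T : ℕ∞) = (((k + 1) * T : ℕ) : ℕ∞) := by push_cast; ring
    have hpos : 0 < (k + 1) * T := Nat.mul_pos k.succ_pos hT'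
    rw [h1, if_neg (ENat.natCast_ne_top _), ENat.toNat_natCast, ClosedLoop.measureCost, hL,
      if_pos ⟨hpos, (periodicLast_eq_self_iff hT1 hpos).2 ⟨T, rfl, dvd_mul_left _ _⟩⟩]

end LookaheadPolicy

variable {q p m : ℕ} (D : Data q p m)

/-! ### Certainty-equivalent control with a fixed measurement schedule -/

lemma IsLastTime.idem {ℓ : ℕ → ℕ} (hℓ : IsLastTime ℓ) (t : ℕ) : ℓ (ℓ t) = ℓ t := by
  induction t with
  | zero => rw [hℓ.zero, hℓ.zero]
  | succ t ih =>
    rcases hℓ.succ t with h | h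
    · rw [h, h]
    · rw [h, ih]

variable {D} in
/-- Feedback of the prediction from the last measured state loses only the prediction error. -/
lemma ClosedLoop.input_add_gain {x₀ : Fin q → ℝ} (c : ClosedLoop D x₀)
    {P : Matrix (Fin q) (Fin q) ℝ} {ℓ : ℕ → ℕ} (hℓ : IsLastTime ℓ)
    (hU : ∀ v t, c.U v t = -(gain D P *ᵥ (closedLoopMatrix D P ^ (t - ℓ t) *ᵥ c.X v (ℓ t))))
    (v : ℕ → Fin m → ℝ) (t : ℕ) :
    c.U v t + gain D P *ᵥ c.X v t = gain D P *ᵥ err D (ℓ t) v (t - ℓ t) := by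
  have hX : c.X v t = closedLoopMatrix D P ^ (t - ℓ t) *ᵥ c.X v (ℓ t)
      + err D (ℓ t) v (t - ℓ t) := by
    induction t with
    | zero => simp [hℓ.zero, err]
    | succ t ih =>
      have hle := hℓ.le t
      rcases hℓ.succ t with h | h
      · simp [h, err]
      · rw [h, show t + 1 - ℓ t = (t - ℓ t) + 1 by omega, c.X_succ, hU, err, pow_succ',
          ← mulVec_mulVec, Nat.add_sub_cancel' hle, step]
        conv_lhs => rw [ih]
        rw [mulVec_add, mulVec_neg]
        conv_rhs => rw [closedLoopMatrix, sub_mulVec, ← mulVec_mulVec]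
        rw [← closedLoopMatrix]
        abel
  rw [hU]
  conv_lhs => rw [hX]
  rw [mulVec_add]
  abel

/-- The strategy that measures at the positive times `t` with `ℓ t = t` and applies the optimal
feedback to the prediction from the last measured state. -/
noncomputable def Policy.ofSchedule (P : Matrix (Fin q) (Fin q) ℝ) (ℓ : ℕ → ℕ) : Policy q p where
  measure t _ _ := decide (0 < t ∧ ℓ t = t)
  control t x h _ y := -(gain D P *ᵥ (closedLoopMatrix D P ^ (t - ℓ t) *ᵥ
    (if ℓ t = 0 then x else if hlt : ℓ t < t then (h ⟨ℓ t, hlt⟩).2.2 else y)))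
  measurable_measure t := measurable_const
  measurable_control t := by
    refine (((measurable_mulVec _).comp ((measurable_mulVec _).comp ?_))).neg
    by_cases h0 : ℓ t = 0
    · simpa only [h0, if_true] using measurable_fst
    by_cases hlt : ℓ t < t
    · simp only [h0, hlt, if_false, dif_pos]
      exact ((measurable_pi_apply (⟨ℓ t, hlt⟩ : Fin t)).comp measurable_snd.fst).snd.snd
    · simp only [h0, hlt, if_false, dif_neg, not_false_eq_true]
      exact measurable_snd.snd.snd

section OfSchedule

variable (P : Matrix (Fin q) (Fin q) ℝ) {ℓ : ℕ → ℕ} (hℓ : IsLastTime ℓ) (x₀ : Fin q → ℝ)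
include hℓ

lemma Policy.ofSchedule_lastTime (v : ℕ → Fin m → ℝ) :
    ((Policy.ofSchedule D P ℓ).closedLoop D x₀).L v = ℓ := by
  funext t
  change (Policy.ofSchedule D P ℓ).lastTime D x₀ v t = ℓ t
  induction t with
  | zero => exact hℓ.zero.symm
  | succ t ih =>
    have hle := hℓ.le t
    have hind : (Policy.ofSchedule D P ℓ).indicator D x₀ v (t + 1)
        = decide (0 < t + 1 ∧ ℓ (t + 1) = t + 1) := rfl
    rw [Policy.lastTime, hind, ih]
    rcases hℓ.succ t with h | h
    · simp [h]
    · simp [h]; omega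

lemma Policy.ofSchedule_input (v : ℕ → Fin m → ℝ) (t : ℕ) :
    ((Policy.ofSchedule D P ℓ).closedLoop D x₀).U v t
      = -(gain D P *ᵥ (closedLoopMatrix D P ^ (t - ℓ t) *ᵥ
        ((Policy.ofSchedule D P ℓ).closedLoop D x₀).X v (ℓ t))) := by
  set π := Policy.ofSchedule D P ℓ with hπ
  have hrec : ∀ s, 0 < s → ℓ s = s → (π.record D x₀ v s).2.2 = π.state D x₀ v s := by
    intro s hs h
    have : π.measure s x₀ (π.run D x₀ v s).1 = true := decide_eq_true ⟨hs, h⟩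
    simp [Policy.record, Policy.nextRecord, this, Policy.state]
  change -(gain D P *ᵥ (closedLoopMatrix D P ^ (t - ℓ t) *ᵥ
    (if ℓ t = 0 then x₀ else if hlt : ℓ t < t then ((π.run D x₀ v t).1 ⟨ℓ t, hlt⟩).2.2
      else (π.record D x₀ v t).2.2)))
    = -(gain D P *ᵥ (closedLoopMatrix D P ^ (t - ℓ t) *ᵥ π.state D x₀ v (ℓ t)))
  congr 3
  have hle := hℓ.le t
  split_ifs with h0 hlt
  · rw [h0]; rfl
  · rw [π.run_fst_apply, hrec _ (by omega) (hℓ.idem t)]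
  · have heq : ℓ t = t := by omega
    rw [hrec t (by omega) heq, heq]

end OfSchedule

/-- The strategy with constant waiting time `T` that applies the optimal feedback to the
prediction from the last measured state. -/
noncomputable def LookaheadPolicy.ofWait (P : Matrix (Fin q) (Fin q) ℝ) {T : ℕ∞} (hT : 1 ≤ T) :
    LookaheadPolicy q p where
  wait _ := T
  control z n := -(gain D P *ᵥ (closedLoopMatrix D P ^ n *ᵥ z))
  one_le_wait _ := hT
  measurable_wait := measurable_const
  measurable_control := measurable_pi_lambda _ fun _ =>
    ((measurable_mulVec _).comp (measurable_mulVec _)).neg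

section OfWait

variable (P : Matrix (Fin q) (Fin q) ℝ) {T : ℕ∞} (hT : 1 ≤ T) (x₀ : Fin q → ℝ)

lemma LookaheadPolicy.ofWait_lastTime (v : ℕ → Fin m → ℝ) :
    ((LookaheadPolicy.ofWait D P hT).closedLoop D x₀).L v = periodicLast T := by
  funext t
  set σ := LookaheadPolicy.ofWait D P hT with hσ
  change t - σ.lag D x₀ v t = periodicLast T t
  have hwait : ∀ z, σ.wait z = T := fun _ => rfl
  induction T with
  | top =>
    have : ∀ t, σ.lag D x₀ v t = t := fun t => by
      induction t with
      | zero => rfl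
      | succ t ih => rw [LookaheadPolicy.lag_succ, hwait, if_neg (ENat.natCast_ne_top _), ih]
    rw [this, periodicLast_top, Nat.sub_self]
  | coe T =>
    have hT' : 0 < T := by exact_mod_cast hT
    have : ∀ t, σ.lag D x₀ v t = t % T := fun t => by
      induction t with
      | zero => exact (Nat.zero_mod T).symm
      | succ t ih =>
        rw [LookaheadPolicy.lag_succ, hwait, ih]
        have h1 := Nat.mod_lt t hT'
        split_ifs with h
        · have h' : t % T + 1 = T := by exact_mod_cast h
          rw [← Nat.mod_add_mod, h', Nat.mod_self]
        · have h' : t % T + 1 ≠ T := fun h' => h (by exact_mod_cast h')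
          rw [← Nat.mod_add_mod, Nat.mod_eq_of_lt (show t % T + 1 < T by omega)]
    rw [this, periodicLast_coe]

lemma LookaheadPolicy.ofWait_input (v : ℕ → Fin m → ℝ) (t : ℕ) :
    ((LookaheadPolicy.ofWait D P hT).closedLoop D x₀).U v t
      = -(gain D P *ᵥ (closedLoopMatrix D P ^ (t - periodicLast T t) *ᵥ
        ((LookaheadPolicy.ofWait D P hT).closedLoop D x₀).X v (periodicLast T t))) := by
  set σ := LookaheadPolicy.ofWait D P hT with hσ
  have hle := σ.lag_le D x₀ v t
  rw [← LookaheadPolicy.ofWait_lastTime D P hT x₀ v]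
  change -(gain D P *ᵥ (closedLoopMatrix D P ^ σ.lag D x₀ v t *ᵥ σ.lastState D x₀ v t))
    = -(gain D P *ᵥ (closedLoopMatrix D P ^ (t - (t - σ.lag D x₀ v t)) *ᵥ
      σ.state D x₀ v (t - σ.lag D x₀ v t)))
  rw [Nat.sub_sub_self hle, σ.lastState_eq]

end OfWait

/-! ### The optimal cost -/

/-- Optimal discounted cost, due to measurements and to estimation errors, of the waiting
time `T`. -/
noncomputable def restartCost (P : Matrix (Fin q) (Fin q) ℝ) (T : ℕ∞) : ℝ :=
  if T = ⊤ then ∑' t, D.β ^ t * runCost D P t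
  else (∑ t ∈ Finset.range T.toNat, D.β ^ t * runCost D P t + D.β ^ T.toNat * D.O)
    / (1 - D.β ^ T.toNat)

lemma restartCost_top (P : Matrix (Fin q) (Fin q) ℝ) :
    restartCost D P ⊤ = ∑' t, D.β ^ t * runCost D P t := if_pos rfl

lemma restartCost_coe (P : Matrix (Fin q) (Fin q) ℝ) (T : ℕ) : restartCost D P T
    = (∑ t ∈ Finset.range T, D.β ^ t * runCost D P t + D.β ^ T * D.O) / (1 - D.β ^ T) := by
  simp [restartCost]

/-- The constant part of the cost that is due to the noise. -/
noncomputable def noiseCost (P : Matrix (Fin q) (Fin q) ℝ) : ℝ :=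
  D.β / (1 - D.β) * (D.S * (D.Cᵀ * P * D.C)).trace

lemma noiseCost_eq (P : Matrix (Fin q) (Fin q) ℝ) :
    noiseCost D P = D.β / (1 - D.β) * (D.C * D.S * D.Cᵀ * P).trace := by
  rw [noiseCost, Matrix.mul_assoc D.C, Matrix.mul_assoc D.C, trace_mul_comm D.C]
  simp only [Matrix.mul_assoc]

variable {D} (hD : StandingAssumptions D) {P : Matrix (Fin q) (Fin q) ℝ}
include hD

lemma StandingAssumptions.lookaheadConstant_eq (y : ℝ) (T : ℕ) :
    lookaheadConstant D P (y + noiseCost D P) T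
      = waitCost D.β D.O (runCost D P) y T + noiseCost D P := by
  have h1 : 1 - D.β ≠ 0 := (sub_pos.2 hD.beta_lt_one).ne'
  have hgeom : ∑ t ∈ Finset.Icc 1 T, D.β ^ t * (D.S * (D.Cᵀ * P * D.C)).trace
      = (1 - D.β ^ T) * noiseCost D P := by
    rw [noiseCost]
    induction T with
    | zero => simp
    | succ T ih =>
      rw [Finset.sum_Icc_succ_top (by omega), ih]
      field_simp
      ring
  rw [lookaheadConstant, hgeom, waitCost]
  simp only [runCost]
  ring

lemma StandingAssumptions.solvesFixedPoint_iff (y : ℝ) :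
    SolvesFixedPoint D P (y + noiseCost D P)
      ↔ IsGLB {c | ∃ T : ℕ, 1 ≤ T ∧ c = waitCost D.β D.O (runCost D P) y T} y := by
  have hset : {c | ∃ T : ℕ, 1 ≤ T ∧ c = lookaheadConstant D P (y + noiseCost D P) T}
      = OrderIso.addRight (noiseCost D P) ''
        {c | ∃ T : ℕ, 1 ≤ T ∧ c = waitCost D.β D.O (runCost D P) y T} := by
    ext c
    simp only [hD.lookaheadConstant_eq, Set.mem_ofPred_eq, Set.mem_image, OrderIso.addRight_apply]
    constructor
    · rintro ⟨T, hT, rfl⟩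
      exact ⟨_, ⟨T, hT, rfl⟩, rfl⟩
    · rintro ⟨_, ⟨T, hT, rfl⟩, rfl⟩
      exact ⟨T, hT, rfl⟩
  rw [SolvesFixedPoint, hset]
  exact OrderIso.isGLB_image' (OrderIso.addRight (noiseCost D P))

lemma StandingAssumptions.solvesFixedPoint_unique {r r' : ℝ} (hr : SolvesFixedPoint D P r)
    (hr' : SolvesFixedPoint D P r') : r' = r := by
  rw [← sub_add_cancel r (noiseCost D P), hD.solvesFixedPoint_iff] at hr
  rw [← sub_add_cancel r' (noiseCost D P), hD.solvesFixedPoint_iff] at hr'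
  have := isGLB_waitCost_unique hD.beta_pos hD.beta_lt_one hr' hr
  linarith

section Optimal

variable (hP : P.PosSemidef) {T : ℕ∞} (hT : IsThresholdIndex D P T)
include hP hT

lemma StandingAssumptions.isGLB_restartCost :
    IsGLB {c | ∃ n : ℕ, 1 ≤ n ∧ c = waitCost D.β D.O (runCost D P) (restartCost D P T) n}
      (restartCost D P T) := by
  have ha := hD.lagIncrement_nonneg hP
  have hg := runCost_eq_sum D P
  obtain ⟨h1, hfin, hinf⟩ := hT
  induction T with
  | top =>
    exact isGLB_waitCost_of_infinite hD.beta_pos hD.beta_lt_one ha hg (hinf rfl)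
      (restartCost_top D P)
  | coe T =>
    obtain ⟨h2, h3⟩ := hfin T rfl
    exact isGLB_waitCost_of_finite hD.beta_pos hD.beta_lt_one ha hg (by exact_mod_cast h1) h2 h3
      (restartCost_coe D P T)

lemma StandingAssumptions.restartCost_nonneg : 0 ≤ restartCost D P T := by
  have hβ := hD.beta_pos.le
  have hg := fun t => mul_nonneg (pow_nonneg hβ t) (hD.runCost_nonneg hP t)
  obtain ⟨h1, -, -⟩ := hT
  induction T with
  | top => rw [restartCost_top]; exact tsum_nonneg hg
  | coe T =>
    rw [restartCost_coe]
    exact div_nonneg (add_nonneg (Finset.sum_nonneg fun t _ => hg t)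
      (mul_nonneg (pow_nonneg hβ T) hD.O_nonneg))
      (sub_nonneg.2 (pow_le_one₀ hβ hD.beta_lt_one.le))

lemma StandingAssumptions.scheduleCost_le_restartCost (n : ℕ) :
    scheduleCost D.β D.O (runCost D P) (periodicLast T) n ≤ restartCost D P T := by
  have hβ := hD.beta_pos
  refine scheduleCost_periodicLast_le hβ (hD.runCost_nonneg hP) (hD.restartCost_nonneg hP hT)
    hD.O_nonneg hT.1 (fun k hk => ?_) (fun h k => ?_) n
  · subst hk
    have hk1 : 1 ≤ k := by exact_mod_cast hT.1
    exact waitCost_eq_of_finite (pow_lt_one₀ hβ.le hD.beta_lt_one (by omega)).ne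
      (restartCost_coe D P k)
  · subst h
    rw [restartCost_top]
    exact (summable_of_weightedSum_le hβ hD.beta_lt_one (hD.lagIncrement_nonneg hP)
      (runCost_eq_sum D P) (hT.2.2 rfl)).sum_le_tsum _
      fun t _ => mul_nonneg (pow_nonneg hβ.le t) (hD.runCost_nonneg hP t)

lemma StandingAssumptions.optimal_cost_eq (x₀ : Fin q → ℝ) :
    ENNReal.ofReal (quad P x₀)
      + ENNReal.ofReal (D.β / (1 - D.β) * (D.C * D.S * D.Cᵀ * P).trace)
      + ENNReal.ofReal (restartCost D P T)
    = ENNReal.ofReal (quad P x₀ + noiseCost D P + restartCost D P T) := by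
  have hκ : 0 ≤ D.β / (1 - D.β) * (D.C * D.S * D.Cᵀ * P).trace :=
    mul_nonneg (div_nonneg hD.beta_pos.le (sub_nonneg.2 hD.beta_lt_one.le))
      (trace_mul_nonneg hD.noise_posDef.posSemidef hP)
  rw [noiseCost_eq, ENNReal.ofReal_add (add_nonneg (quad_nonneg hP _) hκ)
    (hD.restartCost_nonneg hP hT), ENNReal.ofReal_add (quad_nonneg hP _) hκ]

variable {Ω : Type*} [MeasurableSpace Ω] {Pr : Measure Ω} [IsProbabilityMeasure Pr]
  {w : ℕ → Ω → (Fin m → ℝ)} (hw : IsGaussianWhiteNoise Pr D.S w)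
  (hR : SolvesRiccati D P) (hV : (valueIter D q).PosDef)
include hw hR

lemma StandingAssumptions.cost_ofSchedule_le (x₀ : Fin q → ℝ) :
    (Policy.ofSchedule D P (periodicLast T)).cost D x₀ Pr w
      ≤ ENNReal.ofReal (quad P x₀ + noiseCost D P + restartCost D P T) := by
  have hℓ := isLastTime_periodicLast hT.1
  rw [← hD.optimal_cost_eq hP hT]
  refine (Policy.cost_le_closedLoop _ x₀ hD fun x h => ?_).trans
    (ClosedLoop.cost_le _ hw hD hP hR (Policy.ofSchedule_lastTime D P hℓ x₀)
      (ClosedLoop.input_add_gain _ hℓ (Policy.ofSchedule_input D P hℓ x₀))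
      (hD.scheduleCost_le_restartCost hP hT))
  exact decide_eq_false fun hc : 0 < 0 ∧ periodicLast T 0 = 0 => lt_irrefl 0 hc.1

lemma StandingAssumptions.cost_ofWait_le (x₀ : Fin q → ℝ) :
    (LookaheadPolicy.ofWait D P hT.1).cost D x₀ Pr w
      ≤ ENNReal.ofReal (quad P x₀ + noiseCost D P + restartCost D P T) := by
  rw [← hD.optimal_cost_eq hP hT]
  have hL := LookaheadPolicy.ofWait_lastTime D P hT.1 x₀
  exact (LookaheadPolicy.cost_le_closedLoop D _ x₀ (fun _ => rfl) hL).trans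
    (ClosedLoop.cost_le _ hw hD hP hR hL
      (ClosedLoop.input_add_gain _ (isLastTime_periodicLast hT.1)
        (LookaheadPolicy.ofWait_input D P hT.1 x₀))
      (hD.scheduleCost_le_restartCost hP hT))

include hV

lemma StandingAssumptions.le_closedLoop_cost {x₀ : Fin q → ℝ} (c : ClosedLoop D x₀) :
    ENNReal.ofReal (quad P x₀ + noiseCost D P + restartCost D P T) ≤ c.cost Pr w := by
  rw [← hD.optimal_cost_eq hP hT]
  exact c.le_cost hw hD hP hR hV fun n hn => (hD.isGLB_restartCost hP hT).1 ⟨n, hn, rfl⟩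

lemma StandingAssumptions.value_eq (x₀ : Fin q → ℝ) : value D Pr w x₀
    = ENNReal.ofReal (quad P x₀ + noiseCost D P + restartCost D P T) :=
  le_antisymm ((iInf_le _ _).trans (hD.cost_ofSchedule_le hP hT hw hR x₀))
    (le_iInf fun π => (hD.le_closedLoop_cost hP hT hw hR hV (π.closedLoop D x₀)).trans
      (π.closedLoop_cost_le x₀ hD))

lemma StandingAssumptions.lookaheadValue_eq (x₀ : Fin q → ℝ) : lookaheadValue D Pr w x₀
    = ENNReal.ofReal (quad P x₀ + noiseCost D P + restartCost D P T) :=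
  le_antisymm ((iInf_le _ _).trans (hD.cost_ofWait_le hP hT hw hR x₀))
    (le_iInf fun σ => (hD.le_closedLoop_cost hP hT hw hR hV (σ.closedLoop D x₀)).trans
      (σ.closedLoop_cost_le D x₀))

lemma StandingAssumptions.isValueFunction {f : (Fin q → ℝ) → ℝ}
    (hf : ∀ x, f x = quad P x + noiseCost D P + restartCost D P T) :
    IsValueFunction D Pr w f := by
  intro x
  have hκ : 0 ≤ noiseCost D P := by
    rw [noiseCost_eq]
    exact mul_nonneg (div_nonneg hD.beta_pos.le (sub_nonneg.2 hD.beta_lt_one.le))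
      (trace_mul_nonneg hD.noise_posDef.posSemidef hP)
  have h0 : 0 ≤ quad P x + noiseCost D P + restartCost D P T :=
    add_nonneg (add_nonneg (quad_nonneg hP x) hκ) (hD.restartCost_nonneg hP hT)
  rw [hD.value_eq hP hT hw hR hV, hD.lookaheadValue_eq hP hT hw hR hV, hf,
    ENNReal.toReal_ofReal h0]
  exact ⟨⟨ENNReal.ofReal_ne_top, rfl⟩, ENNReal.ofReal_ne_top, rfl⟩

lemma StandingAssumptions.optimalWaitingTime : OptimalWaitingTime D Pr w T := by
  refine ⟨⟨Policy.ofSchedule D P (periodicLast T), fun t x h => ?_, fun x => ?_⟩,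
    LookaheadPolicy.ofWait D P hT.1, fun _ => rfl, fun x => ?_⟩
  · refine decide_eq_true_iff.trans (and_congr_right fun ht => ?_)
    exact periodicLast_eq_self_iff hT.1 ht
  · refine le_antisymm ?_ (iInf_le _ _)
    rw [hD.value_eq hP hT hw hR hV]
    exact hD.cost_ofSchedule_le hP hT hw hR x
  · refine le_antisymm ?_ (iInf_le _ _)
    rw [hD.lookaheadValue_eq hP hT hw hR hV]
    exact hD.cost_ofWait_le hP hT hw hR x

end Optimal

end CostlyLQG

theorem mainTheorem1 {q p m l : ℕ} (D : CostlyLQG.Data q p m)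
    (hD : CostlyLQG.StandingAssumptions D)
    {Ω : Type*} [MeasurableSpace Ω] (Pr : Measure Ω) [IsProbabilityMeasure Pr]
    (w : ℕ → Ω → (Fin m → ℝ)) (hw : CostlyLQG.IsGaussianWhiteNoise Pr D.S w)
    (J : Matrix (Fin l) (Fin q) ℝ) (hJ : D.Q = Jᵀ * J)
    (hAB : CostlyLQG.Controllable D.A D.B) (hAJ : CostlyLQG.Observable D.A J) :
    ∃ (P : Matrix (Fin q) (Fin q) ℝ) (r : ℝ),
      -- `P` is the unique positive semidefinite solution of the Riccati equation
      (P.PosDef ∧ CostlyLQG.SolvesRiccati D P ∧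
        ∀ P' : Matrix (Fin q) (Fin q) ℝ,
          P'.PosSemidef → CostlyLQG.SolvesRiccati D P' → P' = P) ∧
      -- `r` is the unique solution of the fixed-point equation, and `V(x) = x' P x + r`
      (CostlyLQG.SolvesFixedPoint D P r ∧
        ∀ r' : ℝ, CostlyLQG.SolvesFixedPoint D P r' → r' = r) ∧
      CostlyLQG.IsValueFunction D Pr w (fun x => x ⬝ᵥ P *ᵥ x + r) ∧
      -- measuring periodically, with the waiting time determined by `O`, is optimal
      (∃! T : ℕ∞, CostlyLQG.IsThresholdIndex D P T) ∧
      (∀ T : ℕ∞, CostlyLQG.IsThresholdIndex D P T → CostlyLQG.OptimalWaitingTime D Pr w T) ∧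
      -- 1) measuring at every step
      (D.O < (D.C * D.S * D.Cᵀ * CostlyLQG.phi D P).trace →
        CostlyLQG.OptimalWaitingTime D Pr w 1 ∧
        r = D.β / (1 - D.β) * (D.S * (D.Cᵀ * P * D.C)).trace + D.β / (1 - D.β) * D.O ∧
        CostlyLQG.IsValueFunction D Pr w (fun x => x ⬝ᵥ P *ᵥ x
          + D.β / (1 - D.β) * (D.S * (D.Cᵀ * P * D.C)).trace + D.β / (1 - D.β) * D.O)) ∧
      -- 2) measuring every `T` steps
      (∀ T : ℕ, 1 ≤ T → CostlyLQG.threshold D P (T - 1) ≤ D.O →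
        D.O < CostlyLQG.threshold D P T →
        CostlyLQG.OptimalWaitingTime D Pr w T ∧
        r = (∑ t ∈ Finset.range T,
              D.β ^ t * (CostlyLQG.errorCov D t * CostlyLQG.phi D P).trace) / (1 - D.β ^ T)
            + D.β / (1 - D.β) * (D.S * (D.Cᵀ * P * D.C)).trace
            + D.β ^ T / (1 - D.β ^ T) * D.O ∧
        CostlyLQG.IsValueFunction D Pr w (fun x => x ⬝ᵥ P *ᵥ x
          + (∑ t ∈ Finset.range T,
              D.β ^ t * (CostlyLQG.errorCov D t * CostlyLQG.phi D P).trace) / (1 - D.β ^ T)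
          + D.β / (1 - D.β) * (D.S * (D.Cᵀ * P * D.C)).trace
          + D.β ^ T / (1 - D.β ^ T) * D.O)) ∧
      -- 3) never measuring
      (CostlyLQG.Stable D.A →
        ∃ W : Matrix (Fin q) (Fin q) ℝ, CostlyLQG.SolvesLyapunov D W ∧
          (∀ W' : Matrix (Fin q) (Fin q) ℝ, CostlyLQG.SolvesLyapunov D W' → W' = W) ∧
          Summable (fun t : ℕ =>
            D.β ^ t * (CostlyLQG.errorCov D t * CostlyLQG.phi D P).trace) ∧
          ((W * CostlyLQG.phi D P).trace / (1 - D.β)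
              - ∑' t : ℕ, D.β ^ t * (CostlyLQG.errorCov D t * CostlyLQG.phi D P).trace ≤ D.O →
            CostlyLQG.OptimalWaitingTime D Pr w ⊤ ∧
            r = ∑' t : ℕ, D.β ^ t * (CostlyLQG.errorCov D t * CostlyLQG.phi D P).trace
                + D.β / (1 - D.β) * (D.S * (D.Cᵀ * P * D.C)).trace ∧
            CostlyLQG.IsValueFunction D Pr w (fun x => x ⬝ᵥ P *ᵥ x
              + ∑' t : ℕ, D.β ^ t * (CostlyLQG.errorCov D t * CostlyLQG.phi D P).trace
              + D.β / (1 - D.β) * (D.S * (D.Cᵀ * P * D.C)).trace)) ∧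
          (D.O < (W * CostlyLQG.phi D P).trace / (1 - D.β)
              - ∑' t : ℕ, D.β ^ t * (CostlyLQG.errorCov D t * CostlyLQG.phi D P).trace →
            ∃ T : ℕ, 1 ≤ T ∧ CostlyLQG.threshold D P (T - 1) ≤ D.O ∧
              D.O < CostlyLQG.threshold D P T)) ∧
      (¬ CostlyLQG.Stable D.A → (CostlyLQG.phi D P).PosDef →
        ∃ T : ℕ, 1 ≤ T ∧ CostlyLQG.threshold D P (T - 1) ≤ D.O ∧
          D.O < CostlyLQG.threshold D P T) := by
  obtain ⟨P, hPd, hR, hPu⟩ := hD.existsUnique_riccati hJ hAB hAJ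
  have hP := hPd.posSemidef
  have hV := hD.valueIter_posDef hJ hAJ
  have hβ := hD.beta_pos
  have hβ1 := hD.beta_lt_one
  obtain ⟨T₀, hT₀, hTu⟩ := hD.existsUnique_thresholdIndex hP
  set r := CostlyLQG.restartCost D P T₀ + CostlyLQG.noiseCost D P with hr
  have hrT : ∀ T, CostlyLQG.IsThresholdIndex D P T →
      r = CostlyLQG.restartCost D P T + CostlyLQG.noiseCost D P := fun T hT => by
    rw [hr, hTu T hT]
  have hfix : CostlyLQG.SolvesFixedPoint D P r :=
    (hD.solvesFixedPoint_iff _).2 (hD.isGLB_restartCost hP hT₀)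
  have hval : ∀ f : (Fin q → ℝ) → ℝ, (∀ x, f x = x ⬝ᵥ P *ᵥ x + r) →
      CostlyLQG.IsValueFunction D Pr w f := fun f hf =>
    hD.isValueFunction hP hT₀ hw hR hV fun x => by rw [hf, hr, CostlyLQG.quad]; ring
  have hopt : ∀ T, CostlyLQG.IsThresholdIndex D P T → CostlyLQG.OptimalWaitingTime D Pr w T :=
    fun T hT => hD.optimalWaitingTime hP hT hw hR hV
  have hindex : ∀ T : ℕ, 1 ≤ T → CostlyLQG.threshold D P (T - 1) ≤ D.O →
      D.O < CostlyLQG.threshold D P T → CostlyLQG.IsThresholdIndex D P T := by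
    refine fun T hT h1 h2 => ⟨by exact_mod_cast hT, fun n hn => ?_, fun h => ?_⟩
    · obtain rfl : T = n := by exact_mod_cast hn
      exact ⟨h1, h2⟩
    · exact absurd h (ENat.natCast_ne_top T)
  have hperiodic : ∀ T : ℕ, 1 ≤ T → CostlyLQG.threshold D P (T - 1) ≤ D.O →
      D.O < CostlyLQG.threshold D P T →
      r = (∑ t ∈ Finset.range T,
            D.β ^ t * (CostlyLQG.errorCov D t * CostlyLQG.phi D P).trace) / (1 - D.β ^ T)
          + D.β / (1 - D.β) * (D.S * (D.Cᵀ * P * D.C)).trace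
          + D.β ^ T / (1 - D.β ^ T) * D.O := fun T hT h1 h2 => by
    rw [hrT T (hindex T hT h1 h2), CostlyLQG.restartCost_coe, CostlyLQG.noiseCost, add_div]
    simp only [CostlyLQG.runCost]
    ring
  refine ⟨P, r, ⟨hPd, hR, hPu⟩, ⟨hfix, fun r' hr' => hD.solvesFixedPoint_unique hfix hr'⟩,
    hval _ fun _ => rfl, ⟨T₀, hT₀, hTu⟩, hopt, fun hO => ?_, fun T hT h1 h2 => ?_,
    fun hA => ?_, fun hA hphi => ?_⟩
  · have h1 : CostlyLQG.threshold D P (1 - 1) ≤ D.O := by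
      simpa [CostlyLQG.threshold] using hD.O_nonneg
    have h2 : D.O < CostlyLQG.threshold D P 1 := by
      have hne : 1 - D.β ≠ 0 := (sub_pos.2 hβ1).ne'
      simpa [CostlyLQG.threshold, hne] using hO
    have hr1 : r = D.β / (1 - D.β) * (D.S * (D.Cᵀ * P * D.C)).trace
        + D.β / (1 - D.β) * D.O := by
      rw [hperiodic 1 le_rfl h1 h2]
      simp [CostlyLQG.errorCov]
    exact ⟨by simpa using hopt _ (hindex 1 le_rfl h1 h2), hr1,
      hval _ fun x => by rw [hr1]; ring⟩
  · have hr2 := hperiodic T hT h1 h2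
    exact ⟨hopt _ (hindex T hT h1 h2), hr2, hval _ fun x => by rw [hr2]; ring⟩
  · obtain ⟨W, hW, hWu, hWlim⟩ := CostlyLQG.exists_lyapunov hA
    obtain ⟨hs, hlim⟩ := hD.summable_and_tendsto_threshold hP hWlim
    refine ⟨W, hW, hWu, hs, fun hO => ?_, fun hO => ?_⟩
    · have hT : CostlyLQG.IsThresholdIndex D P ⊤ :=
        ⟨le_top, fun n hn => absurd hn.symm (ENat.natCast_ne_top n),
          fun _ n => ((hD.threshold_mono hP).ge_of_tendsto hlim n).trans hO⟩
      have hr3 : r = ∑' t : ℕ, D.β ^ t * (CostlyLQG.errorCov D t * CostlyLQG.phi D P).trace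
          + D.β / (1 - D.β) * (D.S * (D.Cᵀ * P * D.C)).trace := by
        rw [hrT ⊤ hT, CostlyLQG.restartCost_top]
        rfl
      exact ⟨hopt _ hT, hr3, hval _ fun x => by rw [hr3]; ring⟩
    · exact hD.exists_threshold (hlim.eventually_const_lt hO).exists
  · exact hD.exists_threshold (hD.exists_lt_threshold_of_not_stable hP hA hphi)
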